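/- **Setting.** Let $dx$, $dh$ be $\sigma$-finite measures on measurable spaces $X$, $H$. Let $p_\theta(x)=e^{u_\theta(x)}/Z(\theta)$, $Z(\theta)=\int e^{u_\theta(x)}\,dx$, be a random field with parameter $\theta\in\mathbb R^a$. Let $q_\phi(x,h)=q(h)\,q_\phi(x|h)$, $\phi\in\mathbb R^b$, be a generator with prior density $q(h)\ge 0$ and conditional density $q_\phi(x|h)>0$; write $q_\phi(x)=\int q_\phi(x,h)\,dh$ and $q_\phi(h|x)=q_\phi(x,h)/q_\phi(x)$. Let $\tilde p=\frac1n\sum_{k=1}^n\delta_{\tilde x_k}$ ($n\ge1$) be the empirical distribution of data. All of $u_\theta(x)$, $q(h)$, $q_\phi(x|h)$ are measurable in $(x,h)$. Let $\Lambda\subset\mathbb R^{a+b}$ be compact, and assume that at every $\lambda=(\theta,\phi)\in\Lambda$: * $Z(\theta)<\infty$; near $\theta$, $u_{\theta'}(x)$ is differentiable in $\theta'$ for every $x$, and $\|\nabla_\theta u_{\theta'}(x)\|e^{u_{\theta'}(x)}$ is dominated by a $dx$-integrable function of $x$; * on a ball around $\phi$, $q_{\phi'}(x|h)$ is differentiable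 in $\phi'$ for all $x,h$; for a.e. $x$, $\|\nabla_\phi q_{\phi'}(x,h)\|$ is dominated on that ball by a $dh$-integrable function of $h$; and $p_\theta(x)\|\nabla_\phi\log q_{\phi'}(x)\|$ is dominated on that ball by a $dx$-integrable function of $x$; * $p_\theta\log(p_\theta/q_\phi)$ is $dx$-integrable and $\nabla_\phi\log q_\phi(x,h)$ is integrable under $p_\theta(x)q_\phi(h|x)$. For $z=(\tilde x,x,h)$ put $p(z;\lambda)=\tilde p(\tilde x)\,p_\theta(x)\,q_\phi(h|x)$, $$F(z;\lambda)=\begin{pmatrix}\nabla_\theta u_\theta(\tilde x)-\nabla_\theta u_\theta(x)\\ \nabla_\phi\log q_\phi(x,h)\end{pmatrix},\qquad f(\lambda)=E_{p(z;\lambda)}[F(z;\lambda)].$$ **(1)** For every $\lambda=(\theta,\phi)\in\Lambda$, $p(\cdot;\lambda)$ is a probability distribution, $F(\cdot;\lambda)$ is integrable under it, and $$\nabla_\theta E_{\tilde p}[\log p_\theta(\tilde x)]=E_{\tilde p}[\nabla_\theta\log p_\theta(\tilde x)]=E_{\tilde p}[\nabla_\theta u_\theta(\tilde x)]-E_{p_\theta}[\nabla_\theta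 u_\theta(x)],$$ $$-\nabla_\phi KL[p_\theta\|q_\phi]=E_{p_\theta}[\nabla_\phi\log q_\phi(x)]=E_{p_\theta(x)q_\phi(h|x)}[\nabla_\phi\log q_\phi(x,h)],$$ and $f(\lambda)=\big(E_{\tilde p}[\nabla_\theta\log p_\theta(\tilde x)],\,E_{p_\theta}[\nabla_\phi\log q_\phi(x)]\big)$. Hence the stationarity system $$E_{\tilde p}[\nabla_\theta\log p_\theta(\tilde x)]=0,\qquad E_{p_\theta}[\nabla_\phi\log q_\phi(x)]=0\tag{$*$}$$ holds at $\lambda$ if and only if $f(\lambda)=0$. **(2)** Suppose that $(*)$ has a solution in $\Lambda$, and let $\mathcal L\subset\Lambda$ be the set of its solutions in $\Lambda$. Let $K_\lambda(\cdot|z)$ be a Markov kernel, jointly measurable in $(\lambda,z)$, such that $K_\lambda$ leaves $p(\cdot;\lambda)$ invariant for each $\lambda\in\Lambda$. Let $\gamma_t>0$ be nonincreasing with $\sum\gamma_t=\infty$, $\sum\gamma_t^2<\infty$. Assume: * *Lyapunov condition:* $f$ is continuous on $\Lambda$, and there is $v$, continuously differentiable on a neighbourhood of $\Lambda$, with $\langle\nabla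 v(\lambda),f(\lambda)\rangle<0$ for $\lambda\in\Lambda$ with $f(\lambda)\ne0$, such that $v(\{\lambda\in\Lambda:f(\lambda)=0\})$ has empty interior; * *Drift condition:* there are a measurable $V\ge1$, a probability measure $\nu$, an integer $l\ge1$ and constants $\rho\in(0,1)$, $b\ge0$, $R>2b/(1-\rho)$, $\delta>0$, $c\ge0$ such that for all $\lambda,\lambda'\in\Lambda$ and all $z$: $K_\lambda V^2(z)\le\rho V^2(z)+b$; $K_\lambda^l(\cdot|z)\ge\delta\nu$ if $V^2(z)\le R$; $\|F(z;\lambda)\|\le cV(z)$; $\|F(z;\lambda)-F(z;\lambda')\|\le cV(z)\|\lambda-\lambda'\|$; and $|K_\lambda g(z)-K_{\lambda'}g(z)|\le cV(z)\|\lambda-\lambda'\|$ for all measurable $g$ with $|g|\le V$. Let $(\lambda^{(t)},z^{(t)})_{t\ge0}$ be generated by the stochastic approximation algorithm: from an arbitrary initialization, for $t\ge 1$, $z^{(t)}\sim K_{\lambda^{(t-1)}}(\cdot|z^{(t-1)})$ conditionally on the past, and $\lambda^{(t)}=\lambda^{(t-1)}+\gamma_tF(z^{(t)};\lambda^{(t-1)})$.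 Then almost surely, if $\lambda^{(t)}\in\Lambda$ for all $t$, then $\inf_{\lambda'\in\mathcal L}\|\lambda^{(t)}-\lambda'\|\to0$ as $t\to\infty$. -/

import Mathlib

open MeasureTheory ProbabilityTheory Filter Topology
open scoped ENNReal

noncomputable section

namespace NRF

/-! ### Stochastic approximation with Markovian observations -/

section SA

variable {E Z Ω : Type*} [NormedAddCommGroup E] [InnerProductSpace ℝ E] [CompleteSpace E]
  [MeasurableSpace E] [MeasurableSpace Z]

/-- The mean field `f(w) = E_{z ∼ p(·; w)} [F(z; w)]`. -/
def meanField (p : E → Measure Z) (F : Z → E → E) (w : E) : E :=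
  ∫ z, F z w ∂(p w)

/-- Learning rates: positive, nonincreasing, with divergent sum and convergent sum of squares. -/
structure LearningRates (γ : ℕ → ℝ) : Prop where
  pos : ∀ t, 0 < γ t
  anti : Antitone γ
  sum_eq_top : ¬ Summable γ
  sum_sq : Summable fun t => γ t ^ 2

/-- `(w t, z t)` is a run of the stochastic approximation algorithm: given the past up to time `t`,
the observation `z (t+1)` is drawn from the Markov kernel `K_{w t}(· | z t)`, and then
`w (t+1) = w t + γ (t+1) F(z (t+1); w t)`. The initialization `(w 0, z 0)` is arbitrary. -/
structure IsSARun [MeasurableSpace Ω] (P : Measure Ω) (ℱ : Filtration ℕ ‹MeasurableSpace Ω›)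
    (K : Kernel (E × Z) Z) (F : Z → E → E) (γ : ℕ → ℝ)
    (w : ℕ → Ω → E) (z : ℕ → Ω → Z) : Prop where
  measurable_param : ∀ t, Measurable[ℱ t] (w t)
  measurable_obs : ∀ t, Measurable[ℱ t] (z t)
  draw : ∀ t, ∀ A : Set Z, MeasurableSet A →
    condExp (ℱ t) P ((z (t + 1) ⁻¹' A).indicator fun _ => (1 : ℝ))
      =ᵐ[P] fun ω => (K (w t ω, z t ω)).real A
  update : ∀ t ω, w (t + 1) ω = w t ω + γ (t + 1) • F (z (t + 1) ω) (w t ω)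

/-- Lyapunov condition for a field `f` on `S`, with zero set `L = {w ∈ S | f w = 0}`: `f` is
continuous on `S`, and some `v`, continuously differentiable near `S`, strictly decreases along `f`
off `L`, with `v(L)` having empty interior. -/
def LyapunovCondition (S : Set E) (f : E → E) : Prop :=
  ContinuousOn f S ∧
  ∃ (v : E → ℝ) (U : Set E), IsOpen U ∧ S ⊆ U ∧ ContDiffOn ℝ 1 v U ∧
    (∀ w ∈ S, f w ≠ 0 → inner ℝ (gradient v w) (f w) < 0) ∧
    interior (v '' {w ∈ S | f w = 0}) = ∅

/-- Drift condition, uniform over `w ∈ S`, for the kernels `K_w`, with a function `V ≥ 1`: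
geometric drift of `V²`; minorization of the `l`-step kernel on a sublevel set of `V²` that is large
relative to the drift constants; `F` is bounded by `V` and Lipschitz in `w` relative to `V`;
`K_w` is Lipschitz in `w` for the `V`-norm. -/
def DriftCondition (S : Set E) (K : Kernel (E × Z) Z) (F : Z → E → E) : Prop :=
  ∃ (V : Z → ℝ) (ν : Measure Z) (l : ℕ) (ρ b R δ c : ℝ),
    Measurable V ∧ (∀ z, 1 ≤ V z) ∧ IsProbabilityMeasure ν ∧
    1 ≤ l ∧ 0 < ρ ∧ ρ < 1 ∧ 0 ≤ b ∧ 2 * b / (1 - ρ) < R ∧ 0 < δ ∧ 0 ≤ c ∧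
    (∀ w ∈ S, ∀ z, ∫⁻ z', ENNReal.ofReal (V z' ^ 2) ∂(K (w, z)) ≤
      ENNReal.ofReal (ρ * V z ^ 2 + b)) ∧
    (∀ w ∈ S, ∀ z, V z ^ 2 ≤ R → ∀ A : Set Z, MeasurableSet A →
      ENNReal.ofReal δ * ν A ≤ ((K.sectR w) ^ l) z A) ∧
    (∀ w ∈ S, ∀ z, ‖F z w‖ ≤ c * V z) ∧
    (∀ w ∈ S, ∀ w' ∈ S, ∀ z, ‖F z w - F z w'‖ ≤ c * V z * ‖w - w'‖) ∧
    (∀ w ∈ S, ∀ w' ∈ S, ∀ g : Z → ℝ, Measurable g → (∀ z, |g z| ≤ V z) → ∀ z,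
      |∫ z', g z' ∂(K (w, z)) - ∫ z', g z' ∂(K (w', z))| ≤ c * V z * ‖w - w'‖)

end SA

/-! ### Random field with an inclusive auxiliary generator -/

/-- The parameter space of `w = (θ, φ)`, with its Euclidean norm. -/
abbrev Param (a b : ℕ) : Type :=
  WithLp 2 (EuclideanSpace ℝ (Fin a) × EuclideanSpace ℝ (Fin b))

/-- A random field with potential `u θ x`, a directed generator `q_φ(x,h) = q(h) q_φ(x|h)`, and
data `x̃_1, …, x̃_n`. Densities are relative to σ-finite measures `dx` and `dh`, so that discrete
and continuous variables are both covered. -/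
structure Model (a b n : ℕ) (X H : Type*) [MeasurableSpace X] [MeasurableSpace H] where
  dx : Measure X
  dh : Measure H
  sigmaFinite_dx : SigmaFinite dx
  sigmaFinite_dh : SigmaFinite dh
  u : EuclideanSpace ℝ (Fin a) → X → ℝ
  measurable_u : ∀ θ, Measurable (u θ)
  prior : H → ℝ
  measurable_prior : Measurable prior
  prior_nonneg : ∀ h, 0 ≤ prior h
  integral_prior : ∫ h, prior h ∂dh = 1
  /-- `decoder φ x h` is `q_φ(x|h)`. -/
  decoder : EuclideanSpace ℝ (Fin b) → X → H → ℝ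
  measurable_decoder : ∀ φ, Measurable fun y : X × H => decoder φ y.1 y.2
  decoder_pos : ∀ φ x h, 0 < decoder φ x h
  integral_decoder : ∀ φ h, ∫ x, decoder φ x h ∂dx = 1
  data : Fin n → X

namespace Model

variable {a b n : ℕ} {X H : Type*} [MeasurableSpace X] [MeasurableSpace H] (M : Model a b n X H)

/-- The normalizing constant `Z(θ) = ∫ exp(u_θ(x)) dx`. -/
def partition (θ : EuclideanSpace ℝ (Fin a)) : ℝ := ∫ x, Real.exp (M.u θ x) ∂M.dx

/-- The density `p_θ(x)`. -/
def p (θ : EuclideanSpace ℝ (Fin a)) (x : X) : ℝ := Real.exp (M.u θ x) / M.partition θ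

/-- The joint density `q_φ(x,h)`. -/
def qJoint (φ : EuclideanSpace ℝ (Fin b)) (x : X) (h : H) : ℝ := M.prior h * M.decoder φ x h

/-- The marginal density `q_φ(x)`. -/
def q (φ : EuclideanSpace ℝ (Fin b)) (x : X) : ℝ := ∫ h, M.qJoint φ x h ∂M.dh

/-- The posterior density `q_φ(h|x)`. -/
def qPost (φ : EuclideanSpace ℝ (Fin b)) (x : X) (h : H) : ℝ := M.qJoint φ x h / M.q φ x

/-- The empirical distribution `p̃` of the data. -/
def empirical : Measure X := (n : ℝ≥0∞)⁻¹ • ∑ k : Fin n, Measure.dirac (M.data k)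

/-- The distribution `p_θ(x) dx`. -/
def pDist (θ : EuclideanSpace ℝ (Fin a)) : Measure X :=
  M.dx.withDensity fun x => ENNReal.ofReal (M.p θ x)

/-- The distribution `p_θ(x) q_φ(h|x) dx dh`. -/
def pqDist (θ : EuclideanSpace ℝ (Fin a)) (φ : EuclideanSpace ℝ (Fin b)) : Measure (X × H) :=
  (M.dx.prod M.dh).withDensity fun y => ENNReal.ofReal (M.p θ y.1 * M.qPost φ y.1 y.2)

/-- The log-likelihood `E_{p̃(x̃)} [log p_θ(x̃)]`; up to sign and a constant this is
`KL[p̃ || p_θ]` as a function of `θ`. -/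
def logLik (θ : EuclideanSpace ℝ (Fin a)) : ℝ := ∫ x, Real.log (M.p θ x) ∂M.empirical

/-- The inclusive divergence `KL[p_θ || q_φ] = ∫ p_θ log (p_θ / q_φ) dx`. -/
def klInclusive (θ : EuclideanSpace ℝ (Fin a)) (φ : EuclideanSpace ℝ (Fin b)) : ℝ :=
  ∫ x, M.p θ x * Real.log (M.p θ x / M.q φ x) ∂M.dx

/-- `∇_θ u_θ(x)`. -/
def gradU (θ : EuclideanSpace ℝ (Fin a)) (x : X) : EuclideanSpace ℝ (Fin a) :=
  gradient (fun t => M.u t x) θ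

/-- `∇_θ log p_θ(x)`. -/
def gradLogP (θ : EuclideanSpace ℝ (Fin a)) (x : X) : EuclideanSpace ℝ (Fin a) :=
  gradient (fun t => Real.log (M.p t x)) θ

/-- `∇_φ log q_φ(x)`. -/
def gradLogQ (φ : EuclideanSpace ℝ (Fin b)) (x : X) : EuclideanSpace ℝ (Fin b) :=
  gradient (fun s => Real.log (M.q s x)) φ

/-- `∇_φ log q_φ(x,h)`. -/
def gradLogQJoint (φ : EuclideanSpace ℝ (Fin b)) (x : X) (h : H) : EuclideanSpace ℝ (Fin b) :=
  gradient (fun s => Real.log (M.qJoint s x h)) φ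

/-- The stationarity equations `E_{p̃}[∇_θ log p_θ(x̃)] = 0` and `E_{p_θ}[∇_φ log q_φ(x)] = 0`. -/
def IsStationary (w : Param a b) : Prop :=
  ∫ x, M.gradLogP w.fst x ∂M.empirical = 0 ∧
  ∫ x, M.gradLogQ w.snd x ∂(M.pDist w.fst) = 0

/-- The law `p(z; w) = p̃(x̃) p_θ(x) q_φ(h|x)` of `z = (x̃, x, h)`. -/
def law (w : Param a b) : Measure (X × X × H) := M.empirical.prod (M.pqDist w.fst w.snd)

/-- The noisy measurement `F(z; w) = (∇_θ u_θ(x̃) - ∇_θ u_θ(x), ∇_φ log q_φ(x,h))`. -/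
def F (z : X × X × H) (w : Param a b) : Param a b :=
  WithLp.toLp 2 (M.gradU w.fst z.1 - M.gradU w.fst z.2.1, M.gradLogQJoint w.snd z.2.1 z.2.2)

/-- The expectations and gradients in the learning problem make sense at `w = (θ, φ)`, and
differentiation under the integrals defining `Z(θ)`, `q_φ(x)` and `KL[p_θ || q_φ]` is justified by
local domination. -/
structure RegularAt (w : Param a b) : Prop where
  integrable_exp : Integrable (fun x => Real.exp (M.u w.fst x)) M.dx
  partition_dominated : ∃ ε > 0,
    (∀ x, ∀ t ∈ Metric.ball w.fst ε, DifferentiableAt ℝ (fun t => M.u t x) t) ∧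
    ∃ G : X → ℝ, Integrable G M.dx ∧
      ∀ᵐ x ∂M.dx, ∀ t ∈ Metric.ball w.fst ε, ‖M.gradU t x‖ * Real.exp (M.u t x) ≤ G x
  generator_dominated : ∃ ε > 0,
    (∀ x h, ∀ s ∈ Metric.ball w.snd ε, DifferentiableAt ℝ (fun s => M.decoder s x h) s) ∧
    (∀ᵐ x ∂M.dx, ∃ G : H → ℝ, Integrable G M.dh ∧
      ∀ᵐ h ∂M.dh, ∀ s ∈ Metric.ball w.snd ε, ‖gradient (fun s => M.qJoint s x h) s‖ ≤ G h) ∧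
    ∃ G : X → ℝ, Integrable G M.dx ∧
      ∀ᵐ x ∂M.dx, ∀ s ∈ Metric.ball w.snd ε, M.p w.fst x * ‖M.gradLogQ s x‖ ≤ G x
  integrable_kl : Integrable
    (fun x => M.p w.fst x * Real.log (M.p w.fst x / M.q w.snd x)) M.dx
  integrable_score : Integrable (fun y : X × H => M.gradLogQJoint w.snd y.1 y.2)
    (M.pqDist w.fst w.snd)

end Model

end NRF

end

/-! Part (1) is the log-derivative trick. Local domination allows differentiation under the
integrals defining `Z(θ)`, `q_φ(x)` and the divergence. Then `∇ log Z` is the model mean of `∇u`,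
and the posterior mean of `∇ log q_φ(x,h)` is `∇ log q_φ(x)`. Under the product law the three terms
of `F` integrate against their marginals, so the mean field is exactly the pair of left-hand sides
of the stationarity system.

Part (2) is the ODE method for Robbins-Monro recursions with Markovian noise. If `∑ γ (F - f)`
converges along a path, adding its tail `r t` to `w t` gives a sequence that follows `f` with no
noise. A `C¹` Lyapunov function then decreases along this sequence away from the zeros of `f`. Since
`v` of the zero set has empty interior, the values of `v` converge; were the parameters far from the
zeros infinitely often, `v` would lose a fixed amount each time, because `∑ γ` diverges
(`tendsto_infDist_of_lyapunovCondition`).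

Convergence of the noise series comes from the Poisson equation `G_w - K_w G_w = F_w - f(w)`. It
splits the noise into a martingale difference, an error from the change of `w` in one step, and a
telescoping term handled by Abel summation (`exists_tendsto_sum_noise`). The three parts are
controlled by `∑ γ² < ∞`, the monotonicity of `γ` and bounded second moments of `V` on the event
that the run stays in `S`.

Solutions `G_w` of size `V`, with `K_w G_w` Lipschitz in `w`, come from geometric ergodicity uniform
in `w` (`exists_geometric_contraction`), a Hairer-Mattingly contraction argument: far out the drift
shrinks oscillations, and in the centre the minorization does. The weight is a square root of an
affine function of `V²`, so functions of size `V` are contracted by a drift condition on `V²`. -/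

set_option linter.unusedSectionVars false

noncomputable section

namespace NRF

/-! ### Deterministic part: perturbed Euler recursions with a Lyapunov function. -/

section Deterministic

variable {E : Type*} [NormedAddCommGroup E] [InnerProductSpace ℝ E] [CompleteSpace E]

/-- First order expansion of a `C¹` function, uniform on a compact set. -/
lemma exists_uniform_gradient_approx {S U : Set E} (hS : IsCompact S) (hU : IsOpen U)
    (hSU : S ⊆ U) {v : E → ℝ} (hv : ContDiffOn ℝ 1 v U) {ε : ℝ} (hε : 0 < ε) :
    ∃ δ > 0, ∀ w ∈ S, ∀ x ∈ Metric.ball w δ, ∀ y ∈ Metric.ball w δ,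
      |v y - v x - inner ℝ (gradient v w) (y - x)| ≤ ε * ‖y - x‖ := by
  have hgrad : ∀ w y, inner ℝ (gradient v w) y = fderiv ℝ v w y := by
    intro w y
    simp [gradient]
  -- Strict differentiability gives the estimate for two moving points but with the derivative at
  -- the centre; the other `ε / 2` pays for moving the derivative to a nearby point.
  have key : ∀ w : S, ∃ r > 0, (∀ x ∈ Metric.ball (w : E) r, ∀ y ∈ Metric.ball (w : E) r,
      |v y - v x - fderiv ℝ v w (y - x)| ≤ ε / 2 * ‖y - x‖) ∧
      ∀ x ∈ Metric.ball (w : E) r, ‖fderiv ℝ v w - fderiv ℝ v x‖ ≤ ε / 2 := by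
    rintro ⟨w, hw⟩
    have hc : ContDiffAt ℝ 1 v w := hv.contDiffAt (hU.mem_nhds (hSU hw))
    have h1 := (hc.hasStrictFDerivAt one_ne_zero).isLittleO.def (half_pos hε)
    have h2 : ContinuousAt (fderiv ℝ v) w := (hc.fderiv_right (m := 0) (by simp)).continuousAt
    have h3 : ∀ᶠ x in 𝓝 w, ‖fderiv ℝ v w - fderiv ℝ v x‖ ≤ ε / 2 := by
      have := Metric.tendsto_nhds.1 h2 (ε / 2) (half_pos hε)
      filter_upwards [this] with x hx
      rw [dist_comm, dist_eq_norm] at hx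
      exact hx.le
    rw [nhds_prod_eq] at h1
    obtain ⟨t, ht, h1⟩ := Filter.eventually_prod_self_iff'.1 h1
    obtain ⟨r, hr, hrt⟩ := Metric.mem_nhds_iff.1 (Filter.inter_mem ht h3)
    refine ⟨r, hr, fun x hx y hy => ?_, fun x hx => (hrt hx).2⟩
    simpa [Real.norm_eq_abs] using h1 _ (hrt hy).1 _ (hrt hx).1
  choose r hr h1 h2 using key
  -- A Lebesgue number of the cover makes the radius uniform over `S`.
  obtain ⟨δ, hδ, hcov⟩ := lebesgue_number_lemma_of_metric (c := fun w : S => Metric.ball (w : E) (r w))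
    hS (fun _ => Metric.isOpen_ball)
    (fun w hw => Set.mem_iUnion.2 ⟨⟨w, hw⟩, Metric.mem_ball_self (hr _)⟩)
  refine ⟨δ, hδ, fun w hw x hx y hy => ?_⟩
  obtain ⟨i, hi⟩ := hcov w hw
  have e1 := h1 i x (hi hx) y (hi hy)
  have e2 := h2 i w (hi (Metric.mem_ball_self hδ))
  have e3 := (fderiv ℝ v i - fderiv ℝ v w).le_of_opNorm_le e2 (y - x)
  rw [hgrad]
  rw [_root_.sub_apply, Real.norm_eq_abs] at e3
  calc |v y - v x - fderiv ℝ v w (y - x)|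
      = |(v y - v x - fderiv ℝ v i (y - x)) + (fderiv ℝ v i (y - x) - fderiv ℝ v w (y - x))| := by
        congr 1; ring
    _ ≤ _ := (abs_add_le _ _).trans (by linarith)

lemma continuousOn_gradient {U : Set E} (hU : IsOpen U) {v : E → ℝ} (hv : ContDiffOn ℝ 1 v U) :
    ContinuousOn (gradient v) U := by
  intro w hw
  have hc : ContDiffAt ℝ 1 v w := hv.contDiffAt (hU.mem_nhds hw)
  have h2 : ContinuousAt (fderiv ℝ v) w := (hc.fderiv_right (m := 0) (by simp)).continuousAt
  exact ((InnerProductSpace.toDual ℝ E).symm.continuous.continuousAt.comp h2).continuousWithinAt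

/-- A sequence which decreases whenever it passes through intervals from a dense family, and whose
upward steps are asymptotically negligible, converges. -/
lemma exists_tendsto_of_decreasing_gaps {a : ℕ → ℝ} {C : Set ℝ} (hC : IsClosed C)
    (hint : interior C = ∅) {B : ℝ} (hB : ∀ᶠ t in atTop, |a t| ≤ B)
    (hup : ∀ ε > 0, ∀ᶠ t in atTop, a (t + 1) ≤ a t + ε)
    (hdec : ∀ x y, Disjoint (Set.Icc x y) C →
      ∀ᶠ t in atTop, a t ∈ Set.Icc x y → a (t + 1) ≤ a t) :
    ∃ l, Tendsto a atTop (𝓝 l) := by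
  refine tendsto_of_no_upcrossings (s := Set.univ) dense_univ ?_ ?_ ?_
  · rintro x - y - hxy ⟨h1, h2⟩
    obtain ⟨c, hc, hcC⟩ : ∃ c ∈ Set.Ioo x y, c ∉ C := by
      by_contra! h
      have : Set.Ioo x y ⊆ interior C := interior_maximal h isOpen_Ioo
      rw [hint] at this
      exact (Set.nonempty_Ioo.2 hxy).ne_empty (Set.subset_empty_iff.1 this)
    obtain ⟨r, hr, hrC⟩ := Metric.isOpen_iff.1 (isOpen_Ioo.inter hC.isOpen_compl) c ⟨hc, hcC⟩
    have hIcc : Set.Icc (c - r / 2) (c + r / 2) ⊆ Metric.ball c r := by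
      rw [Real.ball_eq_Ioo]
      exact Set.Icc_subset_Ioo (by linarith) (by linarith)
    have hd : Disjoint (Set.Icc (c - r / 2) (c + r / 2)) C :=
      Set.disjoint_left.2 fun s hs => (hrC (hIcc hs)).2
    have hlo : x < c - r / 2 := (hrC (hIcc ⟨le_rfl, by linarith⟩)).1.1
    have hhi : c + r / 2 < y := (hrC (hIcc ⟨by linarith, le_rfl⟩)).1.2
    obtain ⟨T, hT⟩ := eventually_atTop.1 ((hdec _ _ hd).and (hup r hr))
    obtain ⟨t₀, ht₀, hat₀⟩ := frequently_atTop.1 h1 T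
    -- The barrier `[c - r/2, c + r/2]` avoids `C` and has width `r`. From below it a single step
    -- rises by at most `r`, so cannot jump over it, and inside it the sequence decreases.
    have hinv : ∀ t ≥ t₀, a t ≤ c + r / 2 := by
      intro t ht
      induction t, ht using Nat.le_induction with
      | base => linarith
      | succ t ht ih =>
        obtain ⟨hd', hu'⟩ := hT t (ht₀.trans ht)
        by_cases hlt : c - r / 2 ≤ a t
        · exact (hd' ⟨hlt, ih⟩).trans ih
        · linarith
    obtain ⟨t₁, ht₁, hat₁⟩ := frequently_atTop.1 h2 t₀
    linarith [hinv t₁ ht₁]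
  · exact ⟨B, by simpa using hB.mono fun t ht => (abs_le.1 ht).2⟩
  · exact ⟨-B, by simpa using hB.mono fun t ht => (abs_le.1 ht).1⟩

/-- Robbins–Monro recursions with summable noise (absorbed into the vanishing perturbation `r`)
which stay in a compact set converge to the zero set of a mean field with a Lyapunov function. -/
theorem tendsto_infDist_of_lyapunovCondition {S : Set E} (hS : IsCompact S) {f : E → E}
    (hf : LyapunovCondition S f) {γ : ℕ → ℝ} (hpos : ∀ t, 0 < γ t) (hγ : Tendsto γ atTop (𝓝 0))
    (hsum : ¬ Summable γ) {w r : ℕ → E} (hw : ∀ t, w t ∈ S) (hr : Tendsto r atTop (𝓝 0))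
    (hrec : ∀ t, w (t + 1) + r (t + 1) = w t + r t + γ (t + 1) • f (w t)) :
    Tendsto (fun t => Metric.infDist (w t) {w ∈ S | f w = 0}) atTop (𝓝 0) := by
  obtain ⟨hfc, v, U, hU, hSU, hv, hneg, hint⟩ := hf
  set L : Set E := {w ∈ S | f w = 0} with hL
  set φ : E → ℝ := fun w => inner ℝ (gradient v w) (f w) with hφ
  have hgc : ContinuousOn (gradient v) S := (continuousOn_gradient hU hv).mono hSU
  have hφc : ContinuousOn φ S := hgc.inner hfc
  have hvc : ContinuousOn v S := hv.continuousOn.mono hSU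
  have hLclosed : IsClosed L := by
    have := hfc.preimage_isClosed_of_isClosed hS.isClosed (isClosed_singleton (x := (0 : E)))
    simpa [hL, Set.ofPred_and, Set.preimage] using this
  have hLc : IsCompact L := hS.of_isClosed_subset hLclosed fun w hw => hw.1
  have hφ0 : ∀ w ∈ S, φ w ≤ 0 := by
    intro w hw
    by_cases h : f w = 0
    · simp [hφ, h]
    · exact (hneg w hw h).le
  obtain ⟨B₀, hB₀⟩ := hS.exists_bound_of_continuousOn hfc
  obtain ⟨G₀, hG₀⟩ := hS.exists_bound_of_continuousOn hgc
  obtain ⟨A₀, hA₀⟩ := hS.exists_bound_of_continuousOn hvc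
  set B := max B₀ 1 with hBdef
  set G := max G₀ 1 with hGdef
  have hB1 : 0 < B := lt_of_lt_of_le one_pos (le_max_right _ _)
  have hG1 : 0 < G := lt_of_lt_of_le one_pos (le_max_right _ _)
  have hB : ∀ w ∈ S, ‖f w‖ ≤ B := fun w hw => (hB₀ w hw).trans (le_max_left _ _)
  have hG : ∀ w ∈ S, ‖gradient v w‖ ≤ G := fun w hw => (hG₀ w hw).trans (le_max_left _ _)
  have hγ1 : Tendsto (fun t => γ (t + 1)) atTop (𝓝 0) := (tendsto_add_atTop_iff_nat 1).2 hγ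
  have hr1 : Tendsto (fun t => r (t + 1)) atTop (𝓝 0) := (tendsto_add_atTop_iff_nat 1).2 hr
  -- The shifted sequence satisfies `x (t+1) = x t + γ (t+1) f (w t)` exactly; it may leave `S` but
  -- stays asymptotically close to `w`.
  set x : ℕ → E := fun t => w t + r t with hx
  set a : ℕ → ℝ := fun t => v (x t) with ha
  have hrsmall : ∀ δ > 0, ∀ᶠ t in atTop, ‖r t‖ < δ := by
    intro δ hδ
    simpa [dist_eq_norm] using Metric.tendsto_nhds.1 hr δ hδ
  have hγsmall : ∀ δ > 0, ∀ᶠ t in atTop, γ (t + 1) < δ := fun δ hδ =>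
    hγ1.eventually (gt_mem_nhds hδ)
  -- the perturbed Lyapunov function along the trajectory
  have hkey : ∀ ε > 0, ∀ᶠ t in atTop, a (t + 1) ≤ a t + γ (t + 1) * (φ (w t) + ε) := by
    intro ε hε
    -- The tolerance `ε / B` turns into `γ ε`, as a step has length at most `γ B`.
    obtain ⟨δ, hδ, happ⟩ := exists_uniform_gradient_approx hS hU hSU hv (div_pos hε hB1)
    filter_upwards [hrsmall (δ / 2) (half_pos hδ), hγsmall (δ / (2 * B)) (by positivity)]
      with t hrt hγt
    have hstep : x (t + 1) - x t = γ (t + 1) • f (w t) := by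
      simp only [hx, hrec t]; abel
    have hnorm : ‖x (t + 1) - x t‖ ≤ γ (t + 1) * B := by
      rw [hstep, norm_smul, Real.norm_of_nonneg (hpos _).le]
      exact mul_le_mul_of_nonneg_left (hB _ (hw t)) (hpos _).le
    have hγB : γ (t + 1) * B < δ / 2 := by
      have := mul_lt_mul_of_pos_right hγt hB1
      calc _ < δ / (2 * B) * B := this
        _ = δ / 2 := by field_simp
    have hxt : ‖x t - w t‖ < δ / 2 := by simpa [hx] using hrt
    have hx1 : x t ∈ Metric.ball (w t) δ := by
      rw [Metric.mem_ball, dist_eq_norm]; linarith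
    have hx2 : x (t + 1) ∈ Metric.ball (w t) δ := by
      rw [Metric.mem_ball, dist_eq_norm]
      have : x (t + 1) - w t = (x (t + 1) - x t) + (x t - w t) := by abel
      rw [this]
      exact (norm_add_le _ _).trans_lt (by linarith)
    have h := (abs_le.1 (happ _ (hw t) _ hx1 _ hx2)).2
    have h' : ε / B * ‖x (t + 1) - x t‖ ≤ γ (t + 1) * ε := by
      calc _ ≤ ε / B * (γ (t + 1) * B) := by gcongr
        _ = _ := by field_simp
    have hin : inner ℝ (gradient v (w t)) (x (t + 1) - x t) = γ (t + 1) * φ (w t) := by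
      rw [hstep, inner_smul_right]
    rw [hin] at h
    simp only [ha]
    linarith
  have hva : Tendsto (fun t => a t - v (w t)) atTop (𝓝 0) := by
    obtain ⟨δ, hδ, happ⟩ := exists_uniform_gradient_approx hS hU hSU hv one_pos
    have : Tendsto (fun t => (G + 1) * ‖r t‖) atTop (𝓝 0) := by
      simpa using hr.norm.const_mul (G + 1)
    refine squeeze_zero_norm' ?_ this
    filter_upwards [hrsmall δ hδ] with t ht
    have h := happ _ (hw t) (w t) (Metric.mem_ball_self hδ) (x t)
      (by simpa [Metric.mem_ball, dist_eq_norm, hx] using ht)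
    have hxr : x t - w t = r t := by simp [hx]
    rw [hxr] at h
    have h2 : |inner ℝ (gradient v (w t)) (r t)| ≤ G * ‖r t‖ :=
      (abs_real_inner_le_norm _ _).trans (by gcongr; exact hG _ (hw t))
    rw [Real.norm_eq_abs]
    calc |a t - v (w t)| = |(v (x t) - v (w t) - inner ℝ (gradient v (w t)) (r t)) +
          inner ℝ (gradient v (w t)) (r t)| := by simp [ha]
      _ ≤ _ := (abs_add_le _ _).trans (by linarith)
  have hup : ∀ ε > 0, ∀ᶠ t in atTop, a (t + 1) ≤ a t + ε := by
    intro ε hε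
    filter_upwards [hkey ε hε, hγsmall 1 one_pos] with t h1 h2
    have h3 := hφ0 _ (hw t)
    have h4 := hpos (t + 1)
    nlinarith [mul_nonneg h4.le (neg_nonneg.2 h3), mul_pos h4 hε]
  have hcpt : ∀ C ⊆ S, IsClosed C → Disjoint C L → ∃ c > 0, ∀ w ∈ C, φ w ≤ -c := by
    intro C hCS hC hCL
    rcases C.eq_empty_or_nonempty with rfl | hne
    · exact ⟨1, one_pos, by simp⟩
    · obtain ⟨w₀, hw₀, hmax⟩ := (hS.of_isClosed_subset hC hCS).exists_isMaxOn hne (hφc.mono hCS)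
      refine ⟨-φ w₀, ?_, fun w hw => by simpa using hmax hw⟩
      have : f w₀ ≠ 0 := fun h => Set.disjoint_left.1 hCL hw₀ ⟨hCS hw₀, h⟩
      exact neg_pos.2 (hneg w₀ (hCS hw₀) this)
  obtain ⟨l, hl⟩ : ∃ l, Tendsto a atTop (𝓝 l) := by
    refine exists_tendsto_of_decreasing_gaps
      (hLc.image_of_continuousOn (hvc.mono fun w hw => hw.1)).isClosed hint (B := A₀ + 1) ?_ hup ?_
    · filter_upwards [Metric.tendsto_nhds.1 hva 1 one_pos] with t ht
      rw [dist_zero_right, Real.norm_eq_abs] at ht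
      have := hA₀ _ (hw t)
      rw [Real.norm_eq_abs] at this
      calc |a t| = |(a t - v (w t)) + v (w t)| := by ring_nf
        _ ≤ _ := (abs_add_le _ _).trans (by linarith)
    · intro y y' hd
      have hcl : IsClosed (v '' L) :=
        (hLc.image_of_continuousOn (hvc.mono fun w hw => hw.1)).isClosed
      obtain ⟨ε, hε, hthick⟩ := (isCompact_Icc (a := y) (b := y')).exists_thickening_subset_open
        hcl.isOpen_compl (Set.subset_compl_iff_disjoint_right.2 hd)
      -- The interval bounds `a t = v (x t)`, whereas `φ` is evaluated at `w t`; the thickening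
      -- absorbs the vanishing difference between `a t` and `v (w t)`.
      obtain ⟨c, hc, hφC⟩ := hcpt (S ∩ v ⁻¹' (Metric.cthickening (ε / 2) (Set.Icc y y')))
        Set.inter_subset_left
        (hvc.preimage_isClosed_of_isClosed hS.isClosed Metric.isClosed_cthickening) (by
          rw [Set.disjoint_left]
          rintro s ⟨_, hs⟩ hsL
          exact hthick (Metric.cthickening_subset_thickening' hε (half_lt_self hε) _ hs) ⟨s, hsL, rfl⟩)
      filter_upwards [hkey c hc, Metric.tendsto_nhds.1 hva (ε / 2) (half_pos hε)] with t h1 h2 h3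
      have hmem : w t ∈ S ∩ v ⁻¹' (Metric.cthickening (ε / 2) (Set.Icc y y')) := by
        refine ⟨hw t, Metric.thickening_subset_cthickening _ _ ?_⟩
        rw [Metric.mem_thickening_iff]
        refine ⟨a t, h3, ?_⟩
        rw [dist_zero_right] at h2
        rwa [dist_comm, dist_eq_norm]
      have := hφC _ hmem
      nlinarith [hpos (t + 1)]
  -- convergence of the parameters
  rw [Metric.tendsto_atTop']
  by_contra! hcon
  obtain ⟨ε, hε, hfar⟩ := hcon
  obtain ⟨c, hc, hφC⟩ := hcpt (S ∩ {w | ε / 2 ≤ Metric.infDist w L}) Set.inter_subset_left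
    (hS.isClosed.inter (isClosed_le continuous_const (Metric.continuous_infDist_pt L))) (by
      rw [Set.disjoint_left]
      rintro s ⟨_, hs⟩ hsL
      have : ε / 2 ≤ 0 := by simpa [Metric.infDist_zero_of_mem hsL] using hs
      linarith)
  -- During elapsed time `T₀` the sequence `x` moves at most `ε/8`, hence `w` at most `3ε/8`, and
  -- stays `ε/2` away from `L`. So `a` drops by at least `c T₀ / 2`, while convergence to `l` allows
  -- only `c T₀ / 4`.
  set T₀ : ℝ := ε / (8 * B) with hT₀
  have hT₀pos : 0 < T₀ := by positivity
  obtain ⟨N, hN⟩ := eventually_atTop.1 ((hkey (c / 2) (half_pos hc)).and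
    ((hrsmall (ε / 8) (by positivity)).and
      (Metric.tendsto_nhds.1 hl (c * T₀ / 8) (by positivity))))
  obtain ⟨t₀, ht₀, hd₀⟩ := hfar N
  rw [dist_zero_right, Real.norm_of_nonneg Metric.infDist_nonneg] at hd₀
  set s : ℕ → ℝ := fun m => ∑ i ∈ Finset.range m, γ (t₀ + i + 1) with hs
  have hs_unb : ∃ m, T₀ ≤ s m := by
    by_contra! h
    refine hsum ((summable_nat_add_iff (t₀ + 1)).1 ?_)
    refine summable_of_sum_range_le (c := T₀) (fun i => (hpos _).le) fun m => ?_
    refine le_trans (le_of_eq ?_) (h m).le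
    exact Finset.sum_congr rfl fun i _ => by congr 1; omega
  classical
  -- The first time the elapsed step sizes reach `T₀`; it exists because `∑ γ` diverges.
  set m := Nat.find hs_unb with hm
  have hm1 : T₀ ≤ s m := Nat.find_spec hs_unb
  have hm2 : ∀ i < m, s i < T₀ := fun i hi => not_le.1 (Nat.find_min hs_unb hi)
  have hxdist : ∀ i, ‖x (t₀ + i) - x t₀‖ ≤ s i * B := by
    intro i
    induction i with
    | zero => simp [hs]
    | succ i ih =>
      have hstep : x (t₀ + i + 1) - x (t₀ + i) = γ (t₀ + i + 1) • f (w (t₀ + i)) := by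
        simp only [hx, hrec (t₀ + i)]; abel
      have hn : ‖x (t₀ + i + 1) - x (t₀ + i)‖ ≤ γ (t₀ + i + 1) * B := by
        rw [hstep, norm_smul, Real.norm_of_nonneg (hpos _).le]
        exact mul_le_mul_of_nonneg_left (hB _ (hw _)) (hpos _).le
      have hsucc : s (i + 1) = s i + γ (t₀ + i + 1) := Finset.sum_range_succ _ _
      calc ‖x (t₀ + (i + 1)) - x t₀‖
          = ‖(x (t₀ + i + 1) - x (t₀ + i)) + (x (t₀ + i) - x t₀)‖ := by
            rw [← add_assoc]; congr 1; abel
        _ ≤ _ := (norm_add_le _ _).trans (by rw [hsucc]; linarith)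
  have hfar' : ∀ i < m, ε / 2 ≤ Metric.infDist (w (t₀ + i)) L := by
    intro i hi
    have h1 := hxdist i
    have h2 : s i * B ≤ ε / 8 := by
      calc s i * B ≤ T₀ * B := by gcongr; exact (hm2 i hi).le
        _ = ε / 8 := by rw [hT₀]; field_simp
    have h3 := (hN t₀ ht₀.le).2.1
    have h4 := (hN (t₀ + i) (by omega)).2.1
    have h5 : dist (w t₀) (w (t₀ + i)) ≤ 3 * ε / 8 := by
      rw [dist_comm, dist_eq_norm]
      have : w (t₀ + i) - w t₀ = (x (t₀ + i) - x t₀) + r t₀ - r (t₀ + i) := by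
        simp only [hx]; abel
      rw [this]
      have e1 := norm_sub_le (x (t₀ + i) - x t₀ + r t₀) (r (t₀ + i))
      have e2 := norm_add_le (x (t₀ + i) - x t₀) (r t₀)
      linarith
    have h6 := Metric.infDist_le_infDist_add_dist (s := L) (x := w t₀) (y := w (t₀ + i))
    linarith
  have hdescent : ∀ i ≤ m, a (t₀ + i) ≤ a t₀ - c / 2 * s i := by
    intro i hi
    induction i with
    | zero => simp [hs]
    | succ i ih =>
      have h1 := ih (by omega)
      have h2 := (hN (t₀ + i) (by omega)).1
      have h3 := hφC _ ⟨hw (t₀ + i), hfar' i (by omega)⟩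
      have hsucc : s (i + 1) = s i + γ (t₀ + i + 1) := Finset.sum_range_succ _ _
      have h4 : γ (t₀ + i + 1) * (φ (w (t₀ + i)) + c / 2) ≤ γ (t₀ + i + 1) * (-(c / 2)) :=
        mul_le_mul_of_nonneg_left (by linarith) (hpos _).le
      rw [hsucc, ← add_assoc]
      linarith
  have e1 := hdescent m le_rfl
  have e2 := (abs_lt.1 (hN t₀ ht₀.le).2.2).2
  have e3 := (abs_lt.1 (hN (t₀ + m) (by omega)).2.2).1
  have e4 : c / 2 * T₀ ≤ c / 2 * s m := by gcongr
  have e5 : 0 < c * T₀ := by positivity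
  linarith

end Deterministic

/-! ### Uniform geometric ergodicity from drift and minorization. -/

section Ergodicity

variable {Z : Type*} [MeasurableSpace Z]
  {E : Type*} [NormedAddCommGroup E] [NormedSpace ℝ E] [CompleteSpace E]

/-- The weight controlling oscillations in the contraction estimate. -/
def oscWeight (β : ℝ) (V : Z → ℝ) (x y : Z) : ℝ := √(2 + β * (V x ^ 2 + V y ^ 2))

lemma oscWeight_sq {β : ℝ} (hβ : 0 ≤ β) (V : Z → ℝ) (x y : Z) :
    oscWeight β V x y ^ 2 = 2 + β * (V x ^ 2 + V y ^ 2) :=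
  Real.sq_sqrt (by positivity)

lemma oscWeight_nonneg (β : ℝ) (V : Z → ℝ) (x y : Z) : 0 ≤ oscWeight β V x y :=
  Real.sqrt_nonneg _

lemma measurable_oscWeight {V : Z → ℝ} (hV : Measurable V) (β : ℝ) :
    Measurable fun y : Z × Z => oscWeight β V y.1 y.2 := by
  unfold oscWeight
  fun_prop

lemma integrable_of_norm_sub_le_oscWeight {V : Z → ℝ} {β M : ℝ} (hβ : 0 ≤ β) (hM : 0 ≤ M)
    {g : Z → E} (hg : StronglyMeasurable g)
    (hosc : ∀ x y, ‖g x - g y‖ ≤ M * oscWeight β V x y) {μ : Measure Z} [IsFiniteMeasure μ]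
    (hμ : Integrable (fun z => V z ^ 2) μ) : Integrable g μ := by
  rcases isEmpty_or_nonempty Z with hZ | ⟨⟨z₀⟩⟩
  · rw [Measure.eq_zero_of_isEmpty μ]; exact integrable_zero_measure
  have hbd : Integrable (fun z => ‖g z₀‖ + M * (1 + (2 + β * (V z ^ 2 + V z₀ ^ 2)))) μ :=
    (integrable_const _).add (((integrable_const _).add ((integrable_const _).add
      ((hμ.add (integrable_const _)).const_mul β))).const_mul M)
  refine hbd.mono' hg.aestronglyMeasurable (ae_of_all _ fun z => ?_)
  have h1 : ‖g z‖ ≤ ‖g z₀‖ + ‖g z - g z₀‖ := by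
    have := norm_add_le (g z₀) (g z - g z₀)
    simpa using this
  have h2 : oscWeight β V z z₀ ≤ 1 + (2 + β * (V z ^ 2 + V z₀ ^ 2)) := by
    rw [← oscWeight_sq hβ]
    nlinarith [oscWeight_nonneg β V z z₀]
  exact h1.trans (add_le_add le_rfl ((hosc z z₀).trans (mul_le_mul_of_nonneg_left h2 hM)))

/-- Independent coupling bound for two finite measures of equal mass. -/
lemma norm_integral_sub_le_of_oscWeight {V : Z → ℝ} (hV : Measurable V) {β M m : ℝ} (hβ : 0 ≤ β)
    (hM : 0 ≤ M) {g : Z → E} (hg : StronglyMeasurable g)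
    (hosc : ∀ x y, ‖g x - g y‖ ≤ M * oscWeight β V x y) {μ ν : Measure Z} [IsFiniteMeasure μ]
    [IsFiniteMeasure ν] (hμm : μ.real Set.univ = m) (hνm : ν.real Set.univ = m)
    (hμ : Integrable (fun z => V z ^ 2) μ) (hν : Integrable (fun z => V z ^ 2) ν) :
    ‖∫ z, g z ∂μ - ∫ z, g z ∂ν‖ ≤
      M * √(m * (2 * m + β * (∫ z, V z ^ 2 ∂μ + ∫ z, V z ^ 2 ∂ν))) := by
  have hm0 : 0 ≤ m := hμm ▸ measureReal_nonneg
  rcases hm0.eq_or_lt with hm | hm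
  · have h1 : μ = 0 := by
      rw [← Measure.measure_univ_eq_zero]
      simpa [Measure.real, ENNReal.toReal_eq_zero_iff, measure_ne_top, ← hm] using hμm
    have h2 : ν = 0 := by
      rw [← Measure.measure_univ_eq_zero]
      simpa [Measure.real, ENNReal.toReal_eq_zero_iff, measure_ne_top, ← hm] using hνm
    simp [h1, h2, ← hm]
  have hgμ := integrable_of_norm_sub_le_oscWeight hβ hM hg hosc hμ
  have hgν := integrable_of_norm_sub_le_oscWeight hβ hM hg hosc hν
  set A : ℝ := m * (2 * m + β * (∫ z, V z ^ 2 ∂μ + ∫ z, V z ^ 2 ∂ν)) with hA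
  have hIμ : 0 ≤ ∫ z, V z ^ 2 ∂μ := integral_nonneg fun z => sq_nonneg _
  have hIν : 0 ≤ ∫ z, V z ^ 2 ∂ν := integral_nonneg fun z => sq_nonneg _
  have hApos : 0 < A := by positivity
  have hV1 : Integrable (fun y : Z × Z => V y.1 ^ 2) (μ.prod ν) := hμ.comp_fst ν
  have hV2 : Integrable (fun y : Z × Z => V y.2 ^ 2) (μ.prod ν) := hν.comp_snd μ
  have hmass : (μ.prod ν).real Set.univ = m * m := by
    rw [← Set.univ_prod_univ, measureReal_prod_prod, hμm, hνm]
  have hV12 : Integrable (fun y : Z × Z => V y.1 ^ 2 + V y.2 ^ 2) (μ.prod ν) := hV1.add hV2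
  have hsqint : Integrable (fun y : Z × Z => 2 + β * (V y.1 ^ 2 + V y.2 ^ 2)) (μ.prod ν) :=
    (integrable_const _).add (hV12.const_mul β)
  have hsq : ∫ y : Z × Z, (2 + β * (V y.1 ^ 2 + V y.2 ^ 2)) ∂(μ.prod ν) = A := by
    rw [integral_add (integrable_const _) (hV12.const_mul β), integral_const_mul,
      integral_add hV1 hV2, integral_fun_fst (fun z => V z ^ 2), integral_fun_snd (fun z => V z ^ 2),
      hμm, hνm, integral_const, hmass, hA]
    simp only [smul_eq_mul]
    ring
  have hDint : Integrable (fun y : Z × Z => oscWeight β V y.1 y.2) (μ.prod ν) := by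
    refine (hsqint.add (integrable_const 1)).mono'
      (measurable_oscWeight hV β).aestronglyMeasurable (ae_of_all _ fun y => ?_)
    rw [Real.norm_of_nonneg (oscWeight_nonneg _ _ _ _), Pi.add_apply, ← oscWeight_sq hβ]
    nlinarith [oscWeight_nonneg β V y.1 y.2]
  have hD : ∫ y : Z × Z, oscWeight β V y.1 y.2 ∂(μ.prod ν) ≤ m * √A := by
    have hs : 0 < √A := Real.sqrt_pos.2 hApos
    -- Cauchy-Schwarz in the form `2τD ≤ D² + τ²`, with the optimal `τ`: the second moment of the
    -- weight is `A` and the total mass is `m²`.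
    set τ : ℝ := √A / m with hτ
    have hτpos : 0 < τ := by positivity
    have hle : ∫ y : Z × Z, 2 * τ * oscWeight β V y.1 y.2 ∂(μ.prod ν) ≤
        ∫ y : Z × Z, ((2 + β * (V y.1 ^ 2 + V y.2 ^ 2)) + τ ^ 2) ∂(μ.prod ν) := by
      refine integral_mono (hDint.const_mul _) (hsqint.add (integrable_const _)) fun y => ?_
      change 2 * τ * oscWeight β V y.1 y.2 ≤ (2 + β * (V y.1 ^ 2 + V y.2 ^ 2)) + τ ^ 2
      rw [← oscWeight_sq hβ]
      nlinarith [sq_nonneg (oscWeight β V y.1 y.2 - τ)]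
    rw [integral_const_mul, integral_add hsqint (integrable_const _), hsq, integral_const, hmass,
      smul_eq_mul] at hle
    have h1 : A + m * m * τ ^ 2 = 2 * τ * (m * √A) := by
      rw [hτ]; field_simp; rw [Real.sq_sqrt hApos.le]; ring
    rw [h1] at hle
    exact le_of_mul_le_mul_left hle (by positivity)
  have hdiff : m • (∫ z, g z ∂μ - ∫ z, g z ∂ν) = ∫ y : Z × Z, (g y.1 - g y.2) ∂(μ.prod ν) := by
    rw [integral_sub (hgμ.comp_fst ν) (hgν.comp_snd μ), integral_fun_fst g, integral_fun_snd g,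
      hμm, hνm, smul_sub]
  have hfin : m * ‖∫ z, g z ∂μ - ∫ z, g z ∂ν‖ ≤ m * (M * √A) := by
    calc m * ‖∫ z, g z ∂μ - ∫ z, g z ∂ν‖ = ‖m • (∫ z, g z ∂μ - ∫ z, g z ∂ν)‖ := by
          rw [norm_smul, Real.norm_of_nonneg hm.le]
      _ ≤ ∫ y : Z × Z, M * oscWeight β V y.1 y.2 ∂(μ.prod ν) := by
          rw [hdiff]
          exact norm_integral_le_of_norm_le (hDint.const_mul M) (ae_of_all _ fun y => hosc _ _)
      _ ≤ M * (m * √A) := by rw [integral_const_mul]; gcongr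
      _ = _ := by ring
  exact le_of_mul_le_mul_left hfin hm

/-- Contraction constants for a geometric drift and a minorization on a large sublevel set. -/
lemma exists_contraction_constants {ρ b R δ : ℝ} (hρ : 0 < ρ) (hρ1 : ρ < 1) (hb : 0 ≤ b)
    (hR : 2 * b / (1 - ρ) < R) (hδ : 0 < δ) (hδ1 : δ ≤ 1) :
    ∃ β α : ℝ, 0 < β ∧ 0 < α ∧ α < 1 ∧
      (∀ s, 0 ≤ s → (1 - δ) * (2 * (1 - δ) + β * (ρ * s + 2 * b)) ≤ α ^ 2 * (2 + β * s)) ∧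
      (∀ s, R ≤ s → 2 + β * (ρ * s + 2 * b) ≤ α ^ 2 * (2 + β * s)) := by
  have h1ρ : 0 < 1 - ρ := by linarith
  have hR0 : 0 < R := lt_of_le_of_lt (by positivity) hR
  have hgap : 0 < (1 - ρ) * R - 2 * b := by
    rw [div_lt_iff₀ h1ρ] at hR; linarith
  -- Small enough that `2βb ≤ 2δ`: the mass removed by the minorization then pays for the additive
  -- drift constant.
  set β : ℝ := δ / (b + 1) with hβ
  have hβpos : 0 < β := by positivity
  have hβb : β * b ≤ δ := by
    rw [hβ, div_mul_eq_mul_div, div_le_iff₀ (by positivity)]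
    nlinarith
  -- The value making the second inequality an equality at `s = R` with factor `1 - η`. It is
  -- positive precisely because `R > 2b / (1 - ρ)`, and `η ≤ 1 - ρ` carries the inequality to all `s
  -- ≥ R`.
  set η : ℝ := β * ((1 - ρ) * R - 2 * b) / (2 + β * R) with hη
  have hden : 0 < 2 + β * R := by positivity
  have hηpos : 0 < η := by positivity
  have hηeq : η * (2 + β * R) = β * ((1 - ρ) * R - 2 * b) := by
    rw [hη]; field_simp
  have hη1 : η ≤ 1 - ρ := by
    rw [hη, div_le_iff₀ hden]
    nlinarith [mul_nonneg hβpos.le hb]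
  set A : ℝ := max (1 - δ) (1 - η) with hAdef
  have hA0 : 0 < A := lt_of_lt_of_le (by linarith) (le_max_right _ _)
  have hA1 : A < 1 := max_lt (by linarith) (by linarith)
  refine ⟨β, √A, hβpos, Real.sqrt_pos.2 hA0, ?_, ?_, ?_⟩
  · rw [Real.sqrt_lt' one_pos]; simpa using hA1
  · intro s hs
    rw [Real.sq_sqrt hA0.le]
    have hA2 : 1 - δ ≤ A := le_max_left _ _
    have h1 : 2 * (1 - δ) + β * (ρ * s + 2 * b) ≤ 2 + β * s := by
      nlinarith [mul_nonneg (mul_nonneg hβpos.le hs) h1ρ.le]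
    have h2 : 0 ≤ 2 + β * s := by positivity
    exact (mul_le_mul_of_nonneg_left h1 (by linarith)).trans (mul_le_mul_of_nonneg_right hA2 h2)
  · intro s hs
    rw [Real.sq_sqrt hA0.le]
    have hA2 : 1 - η ≤ A := le_max_right _ _
    have h2 : 0 ≤ 2 + β * s := by nlinarith
    refine le_trans ?_ (mul_le_mul_of_nonneg_right hA2 h2)
    have h3 : 0 ≤ β * (1 - ρ - η) * (s - R) := by
      have : 0 ≤ 1 - ρ - η := by linarith
      have : 0 ≤ s - R := by linarith
      positivity
    nlinarith

lemma integrable_sq_of_drift {V : Z → ℝ} (hV : Measurable V) {μ : Measure Z} {B : ℝ}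
    (h : ∫⁻ z, ENNReal.ofReal (V z ^ 2) ∂μ ≤ ENNReal.ofReal B) :
    Integrable (fun z => V z ^ 2) μ := by
  refine ⟨(hV.pow_const 2).aestronglyMeasurable, ?_⟩
  rw [hasFiniteIntegral_iff_ofReal (ae_of_all _ fun z => sq_nonneg _)]
  exact h.trans_lt ENNReal.ofReal_lt_top

lemma integral_sq_le_of_drift {V : Z → ℝ} (hV : Measurable V) {μ : Measure Z} {B : ℝ} (hB : 0 ≤ B)
    (h : ∫⁻ z, ENNReal.ofReal (V z ^ 2) ∂μ ≤ ENNReal.ofReal B) :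
    ∫ z, V z ^ 2 ∂μ ≤ B := by
  rw [integral_eq_lintegral_of_nonneg_ae (ae_of_all _ fun z => sq_nonneg _)
    (hV.pow_const 2).aestronglyMeasurable]
  exact ENNReal.toReal_le_of_le_ofReal hB h

/-- One application of a kernel with drift and minorization contracts oscillations. -/
lemma norm_integral_sub_le_contraction {V : Z → ℝ} (hV : Measurable V) {κ : Kernel Z Z}
    [IsMarkovKernel κ] {ρ b R δ β α : ℝ} (hρ : 0 ≤ ρ) (hb : 0 ≤ b)
    (hδ : 0 < δ) (hβ : 0 < β) (hα : 0 ≤ α)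
    (h1 : ∀ s, 0 ≤ s → (1 - δ) * (2 * (1 - δ) + β * (ρ * s + 2 * b)) ≤ α ^ 2 * (2 + β * s))
    (h2 : ∀ s, R ≤ s → 2 + β * (ρ * s + 2 * b) ≤ α ^ 2 * (2 + β * s))
    (hdrift : ∀ z, ∫⁻ z', ENNReal.ofReal (V z' ^ 2) ∂κ z ≤ ENNReal.ofReal (ρ * V z ^ 2 + b))
    {ν : Measure Z} [IsProbabilityMeasure ν]
    (hmin : ∀ z, V z ^ 2 ≤ R → ENNReal.ofReal δ • ν ≤ κ z)
    {M : ℝ} (hM : 0 ≤ M) {g : Z → E} (hg : StronglyMeasurable g)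
    (hosc : ∀ x y, ‖g x - g y‖ ≤ M * oscWeight β V x y) (x y : Z) :
    ‖∫ z, g z ∂κ x - ∫ z, g z ∂κ y‖ ≤ M * (α * oscWeight β V x y) := by
  have hint : ∀ z, Integrable (fun z' => V z' ^ 2) (κ z) := fun z =>
    integrable_sq_of_drift hV (hdrift z)
  have hle : ∀ z, ∫ z', V z' ^ 2 ∂κ z ≤ ρ * V z ^ 2 + b := fun z =>
    integral_sq_le_of_drift hV (by positivity) (hdrift z)
  have hα' : α * oscWeight β V x y = √(α ^ 2 * (2 + β * (V x ^ 2 + V y ^ 2))) := by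
    rw [Real.sqrt_mul (sq_nonneg _), Real.sqrt_sq hα, oscWeight]
  rw [hα']
  -- Far out, the drift alone contracts. Otherwise both points lie in the sublevel set, the common
  -- part `δν` is removed from both transition laws and cancels, and the residuals of mass `1 - δ`
  -- are coupled independently.
  by_cases hcase : R ≤ V x ^ 2 + V y ^ 2
  · refine (norm_integral_sub_le_of_oscWeight hV hβ.le hM hg hosc (m := 1) (by simp) (by simp)
      (hint x) (hint y)).trans ?_
    refine mul_le_mul_of_nonneg_left (Real.sqrt_le_sqrt (le_trans ?_ (h2 _ hcase))) hM
    nlinarith [hle x, hle y]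
  · push Not at hcase
    have hsub : ∀ z, V z ^ 2 ≤ R → ∃ μ : Measure Z, IsFiniteMeasure μ ∧ μ ≤ κ z ∧
        μ.real Set.univ = 1 - δ ∧
        (∫ z', g z' ∂κ z = ∫ z', g z' ∂μ + ∫ z', g z' ∂(ENNReal.ofReal δ • ν)) := by
      intro z hz
      have hfin : IsFiniteMeasure (ENNReal.ofReal δ • ν) := Measure.smul_finite _ ENNReal.ofReal_ne_top
      have hadd := Measure.sub_add_cancel_of_le (hmin z hz)
      have hgint := integrable_of_norm_sub_le_oscWeight hβ.le hM hg hosc (hint z)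
      refine ⟨κ z - ENNReal.ofReal δ • ν, inferInstance, Measure.sub_le, ?_, ?_⟩
      · have := congrArg (fun μ : Measure Z => μ.real Set.univ) hadd
        simp only [probReal_univ] at this
        rw [measureReal_add_apply, measureReal_ennreal_smul_apply, probReal_univ (μ := ν),
          ENNReal.toReal_ofReal hδ.le] at this
        linarith
      · rw [← integral_add_measure (hgint.mono_measure Measure.sub_le)
          (hgint.mono_measure (hmin z hz)), hadd]
    obtain ⟨μ, hμf, hμle, hμm, hμg⟩ := hsub x (by nlinarith [sq_nonneg (V y)])
    obtain ⟨μ', hμf', hμle', hμm', hμg'⟩ := hsub y (by nlinarith [sq_nonneg (V x)])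
    have hi := (hint x).mono_measure hμle
    have hi' := (hint y).mono_measure hμle'
    have hl : ∫ z', V z' ^ 2 ∂μ ≤ ρ * V x ^ 2 + b :=
      (integral_mono_measure hμle (ae_of_all _ fun _ => sq_nonneg _) (hint x)).trans (hle x)
    have hl' : ∫ z', V z' ^ 2 ∂μ' ≤ ρ * V y ^ 2 + b :=
      (integral_mono_measure hμle' (ae_of_all _ fun _ => sq_nonneg _) (hint y)).trans (hle y)
    have hδ1 : 0 ≤ 1 - δ := hμm ▸ measureReal_nonneg
    rw [hμg, hμg', add_sub_add_right_eq_sub]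
    refine (norm_integral_sub_le_of_oscWeight hV hβ.le hM hg hosc hμm hμm' hi hi').trans ?_
    refine mul_le_mul_of_nonneg_left (Real.sqrt_le_sqrt
      (le_trans ?_ (h1 (V x ^ 2 + V y ^ 2) (by positivity)))) hM
    exact mul_le_mul_of_nonneg_left
      (add_le_add le_rfl (mul_le_mul_of_nonneg_left (by linarith) hβ.le)) hδ1

instance isMarkovKernel_pow (κ : Kernel Z Z) [IsMarkovKernel κ] (k : ℕ) :
    IsMarkovKernel (κ ^ k) := by
  induction k with
  | zero => rw [pow_zero]; exact inferInstanceAs (IsMarkovKernel Kernel.id)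
  | succ k ih => rw [Kernel.pow_add, pow_one]; infer_instance

/-- The partial geometric sum is kept rather than bounded by `b / (1 - ρ)`: with `b_l` the additive
constant after `l` steps, `2 b_l / (1 - ρ ^ l) = 2b / (1 - ρ)`, so the condition on `R` passes
unchanged to the `l`-step kernel. -/
lemma drift_pow {V : Z → ℝ} (hV : Measurable V) {κ : Kernel Z Z} [IsMarkovKernel κ] {ρ b : ℝ}
    (hρ : 0 < ρ) (hρ1 : ρ < 1) (hb : 0 ≤ b)
    (hdrift : ∀ z, ∫⁻ z', ENNReal.ofReal (V z' ^ 2) ∂κ z ≤ ENNReal.ofReal (ρ * V z ^ 2 + b))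
    (k : ℕ) (z : Z) :
    ∫⁻ z', ENNReal.ofReal (V z' ^ 2) ∂(κ ^ k) z ≤
      ENNReal.ofReal (ρ ^ k * V z ^ 2 + b * (1 - ρ ^ k) / (1 - ρ)) := by
  have h1ρ : 0 < 1 - ρ := by linarith
  have hVm : Measurable fun z => ENNReal.ofReal (V z ^ 2) := by fun_prop
  induction k with
  | zero =>
    rw [pow_zero, show ((1 : Kernel Z Z) = Kernel.id) from rfl, Kernel.id_apply,
      lintegral_dirac' _ hVm]
    simp
  | succ k ih =>
    have hpk : ρ ^ k ≤ 1 := pow_le_one₀ hρ.le hρ1.le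
    have hnn : 0 ≤ b * (1 - ρ ^ k) / (1 - ρ) := by
      have : 0 ≤ 1 - ρ ^ k := by linarith
      positivity
    have hint : Integrable (fun z => V z ^ 2) ((κ ^ k) z) := integrable_sq_of_drift hV ih
    have hle := integral_sq_le_of_drift hV (by positivity) ih
    rw [add_comm k 1, Kernel.pow_add, pow_one, Kernel.lintegral_comp _ _ _ hVm]
    calc ∫⁻ y, ∫⁻ z', ENNReal.ofReal (V z' ^ 2) ∂κ y ∂(κ ^ k) z
        ≤ ∫⁻ y, ENNReal.ofReal (ρ * V y ^ 2 + b) ∂(κ ^ k) z := lintegral_mono fun y => hdrift y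
      _ = ENNReal.ofReal (∫ y, (ρ * V y ^ 2 + b) ∂(κ ^ k) z) := by
          refine (ofReal_integral_eq_lintegral_ofReal
            ((hint.const_mul ρ).add (integrable_const b)) (ae_of_all _ fun y => ?_)).symm
          change 0 ≤ ρ * V y ^ 2 + b
          positivity
      _ ≤ _ := by
          apply ENNReal.ofReal_le_ofReal
          rw [integral_add (hint.const_mul ρ) (integrable_const b), integral_const_mul]
          simp only [integral_const, probReal_univ, one_smul]
          calc ρ * ∫ y, V y ^ 2 ∂(κ ^ k) z + b
              ≤ ρ * (ρ ^ k * V z ^ 2 + b * (1 - ρ ^ k) / (1 - ρ)) + b := by gcongr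
            _ = _ := by field_simp; ring

lemma integral_pow_add {κ : Kernel Z Z} {g : Z → E} {m n : ℕ} {z : Z}
    (hg : Integrable g ((κ ^ (m + n)) z)) :
    ∫ y, g y ∂(κ ^ (m + n)) z = ∫ y, ∫ y', g y' ∂(κ ^ m) y ∂(κ ^ n) z := by
  rw [Kernel.pow_add] at hg ⊢
  exact Kernel.integral_comp hg

lemma stronglyMeasurable_integral_pow {κ : Kernel Z Z} [IsMarkovKernel κ] {g : Z → E}
    (hg : StronglyMeasurable g) (k : ℕ) : StronglyMeasurable fun z => ∫ y, g y ∂(κ ^ k) z := by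
  exact (hg.comp_measurable measurable_snd).integral_kernel_prod_right' (κ := κ ^ k)

/-- With `add_le_oscWeight`, this makes the weight equivalent to `V x + V y`, so a contraction for
one is geometric decay for the other. -/
lemma oscWeight_le {V : Z → ℝ} (hV1 : ∀ z, 1 ≤ V z) {β : ℝ} (hβ : 0 ≤ β) (x y : Z) :
    oscWeight β V x y ≤ √(2 + β) * (V x + V y) := by
  have hx := hV1 x
  have hy := hV1 y
  rw [oscWeight, Real.sqrt_le_left (by positivity), mul_pow, Real.sq_sqrt (by positivity)]
  nlinarith [mul_nonneg hβ (mul_nonneg (zero_le_one.trans hx) (zero_le_one.trans hy)),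
    mul_nonneg (zero_le_one.trans hx) (zero_le_one.trans hy)]

lemma add_le_oscWeight {V : Z → ℝ} {β : ℝ} (hβ : 0 < β) (x y : Z) :
    V x + V y ≤ √(2 / β) * oscWeight β V x y := by
  rw [oscWeight, ← Real.sqrt_mul (by positivity)]
  apply Real.le_sqrt_of_sq_le
  have : 2 / β * (2 + β * (V x ^ 2 + V y ^ 2)) = 4 / β + 2 * (V x ^ 2 + V y ^ 2) := by
    field_simp; ring
  rw [this]
  have : 0 < 4 / β := by positivity
  nlinarith [sq_nonneg (V x - V y)]

/-- **Uniform geometric ergodicity**: oscillations measured relative to `V` decay geometrically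
under every Markov kernel with a geometric drift for `V²` and an `l`-step minorization, at a rate
depending only on the constants. -/
theorem exists_geometric_contraction {V : Z → ℝ} (hV : Measurable V) (hV1 : ∀ z, 1 ≤ V z)
    {l : ℕ} (hl : 1 ≤ l) {ρ b R δ : ℝ} (hρ : 0 < ρ) (hρ1 : ρ < 1) (hb : 0 ≤ b)
    (hR : 2 * b / (1 - ρ) < R) (hδ : 0 < δ) (ν : Measure Z) [IsProbabilityMeasure ν] :
    ∃ C r : ℝ, 0 ≤ C ∧ 0 < r ∧ r < 1 ∧ ∀ (κ : Kernel Z Z) [IsMarkovKernel κ],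
      (∀ z, ∫⁻ z', ENNReal.ofReal (V z' ^ 2) ∂κ z ≤ ENNReal.ofReal (ρ * V z ^ 2 + b)) →
      (∀ z, V z ^ 2 ≤ R → ∀ A : Set Z, MeasurableSet A →
        ENNReal.ofReal δ * ν A ≤ (κ ^ l) z A) →
      ∀ (g : Z → E) (M : ℝ), 0 ≤ M → StronglyMeasurable g →
      (∀ x y, ‖g x - g y‖ ≤ M * (V x + V y)) → ∀ k x y,
      ‖∫ z, g z ∂(κ ^ k) x - ∫ z, g z ∂(κ ^ k) y‖ ≤ C * r ^ k * M * (V x + V y) := by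
  have h1ρ : 0 < 1 - ρ := by linarith
  have hpl : ρ ^ l < 1 := pow_lt_one₀ hρ.le hρ1 (by omega)
  have h1ρl : 0 < 1 - ρ ^ l := by linarith
  -- The minorization forces `δ ≤ 1` only if the sublevel set is nonempty.
  set δ' := min δ 1 with hδ'
  have hδ'0 : 0 < δ' := lt_min hδ one_pos
  set bl := b * (1 - ρ ^ l) / (1 - ρ) with hbl
  have hbl0 : 0 ≤ bl := by positivity
  have hRl : 2 * bl / (1 - ρ ^ l) < R := by
    convert hR using 1
    rw [hbl]; field_simp
  obtain ⟨β, α, hβ, hα, hα1, hc1, hc2⟩ := exists_contraction_constants (pow_pos hρ l) hpl hbl0 hRl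
    hδ'0 (min_le_right _ _)
  set B := b / (1 - ρ) with hB
  have hB0 : 0 ≤ B := by positivity
  set C₁ := √(1 + β * B) with hC₁
  -- The kernel contracts by `α` once every `l` steps; the factor `1 / α` in the constant below pays
  -- for rounding `k / l` down.
  set r : ℝ := α ^ ((l : ℝ)⁻¹) with hr
  have hr0 : 0 < r := Real.rpow_pos_of_pos hα _
  have hrl : r ^ l = α := Real.rpow_inv_natCast_pow hα.le (by omega)
  have hr1 : r < 1 := Real.rpow_lt_one hα.le hα1 (by positivity)
  refine ⟨C₁ / α * √(2 / β) * √(2 + β), r, by positivity, hr0, hr1, ?_⟩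
  intro κ _ hdrift hmin g M hM hg hosc k x y
  have hdl := drift_pow hV hρ hρ1 hb hdrift
  have hpk1 : ∀ k, ρ ^ k ≤ 1 := fun k => pow_le_one₀ hρ.le hρ1.le
  have hrhs : ∀ k z, 0 ≤ ρ ^ k * V z ^ 2 + b * (1 - ρ ^ k) / (1 - ρ) := by
    intro k z
    have : 0 ≤ 1 - ρ ^ k := by linarith [hpk1 k]
    positivity
  have hsqint : ∀ k z, Integrable (fun z' => V z' ^ 2) ((κ ^ k) z) := fun k z =>
    integrable_sq_of_drift hV (hdl k z)
  have hsqle : ∀ k z, ∫ z', V z' ^ 2 ∂(κ ^ k) z ≤ V z ^ 2 + B := by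
    intro k z
    refine (integral_sq_le_of_drift hV (hrhs k z) (hdl k z)).trans ?_
    have h1 : ρ ^ k * V z ^ 2 ≤ V z ^ 2 := mul_le_of_le_one_left (sq_nonneg _) (hpk1 k)
    have h2 : b * (1 - ρ ^ k) / (1 - ρ) ≤ B := by
      rw [hB]
      gcongr
      exact mul_le_of_le_one_right hb (by linarith [pow_pos hρ k])
    linarith
  have hmin' : ∀ z, V z ^ 2 ≤ R → ENNReal.ofReal δ' • ν ≤ (κ ^ l) z := by
    intro z hz
    refine Measure.le_iff.2 fun A hA => ?_
    rw [Measure.smul_apply, smul_eq_mul]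
    refine le_trans ?_ (hmin z hz A hA)
    gcongr
    exact min_le_left _ _
  -- Any number of steps inflates an oscillation by at most `C₁`, by the bound on second moments;
  -- this serves the `k % l` steps that do not fill a block.
  have hgen : ∀ k (h : Z → E) (M' : ℝ), 0 ≤ M' → StronglyMeasurable h →
      (∀ x y, ‖h x - h y‖ ≤ M' * oscWeight β V x y) → ∀ x y,
      ‖∫ z, h z ∂(κ ^ k) x - ∫ z, h z ∂(κ ^ k) y‖ ≤ M' * (C₁ * oscWeight β V x y) := by
    intro k h M' hM' hh hho x y
    refine (norm_integral_sub_le_of_oscWeight hV hβ.le hM' hh hho (m := 1) (by simp) (by simp)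
      (hsqint k x) (hsqint k y)).trans ?_
    refine mul_le_mul_of_nonneg_left ?_ hM'
    rw [hC₁, oscWeight, ← Real.sqrt_mul (by positivity)]
    apply Real.sqrt_le_sqrt
    have h1 : β * (∫ z, V z ^ 2 ∂(κ ^ k) x + ∫ z, V z ^ 2 ∂(κ ^ k) y) ≤
        β * ((V x ^ 2 + B) + (V y ^ 2 + B)) := by
      gcongr <;> exact hsqle _ _
    have h2 : 0 ≤ β * B * (β * (V x ^ 2 + V y ^ 2)) := by positivity
    nlinarith
  set M₁ := M * √(2 / β) with hM₁
  have hM₁0 : 0 ≤ M₁ := by positivity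
  have hosc₁ : ∀ x y, ‖g x - g y‖ ≤ M₁ * oscWeight β V x y := by
    intro x y
    refine (hosc x y).trans ?_
    rw [hM₁, mul_assoc]
    exact mul_le_mul_of_nonneg_left (add_le_oscWeight hβ x y) hM
  have hgint : ∀ k z, Integrable g ((κ ^ k) z) := fun k z =>
    integrable_of_norm_sub_le_oscWeight hβ.le hM₁0 hg hosc₁ (hsqint k z)
  have hblock : ∀ q x y, ‖∫ z, g z ∂(κ ^ (l * q)) x - ∫ z, g z ∂(κ ^ (l * q)) y‖ ≤
      M₁ * α ^ q * oscWeight β V x y := by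
    intro q
    induction q with
    | zero =>
      intro x y
      rw [mul_zero, pow_zero, pow_zero, mul_one, show ((1 : Kernel Z Z) = Kernel.id) from rfl,
        Kernel.id_apply, Kernel.id_apply, integral_dirac' _ _ hg, integral_dirac' _ _ hg]
      exact hosc₁ x y
    | succ q ih =>
      intro x y
      rw [Nat.mul_succ, integral_pow_add (hgint _ _), integral_pow_add (hgint _ _)]
      refine (norm_integral_sub_le_contraction hV (pow_nonneg hρ.le l) hbl0 hδ'0 hβ hα.le hc1 hc2
        (hdl l) hmin' (mul_nonneg hM₁0 (pow_nonneg hα.le q)) (stronglyMeasurable_integral_pow hg _)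
        ih x y).trans (le_of_eq ?_)
      ring
  have hk : l * (k / l) + k % l = k := Nat.div_add_mod k l
  have hmain : ‖∫ z, g z ∂(κ ^ k) x - ∫ z, g z ∂(κ ^ k) y‖ ≤
      M₁ * α ^ (k / l) * (C₁ * oscWeight β V x y) := by
    conv_lhs => rw [← hk]
    rw [integral_pow_add (hgint _ _), integral_pow_add (hgint _ _)]
    exact hgen _ _ _ (by positivity) (stronglyMeasurable_integral_pow hg _) (hblock _) x y
  have hαr : α ^ (k / l) ≤ r ^ k / α := by
    rw [le_div_iff₀ hα]
    calc α ^ (k / l) * α = r ^ (l * (k / l) + l) := by rw [pow_add, pow_mul, hrl]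
      _ ≤ r ^ k := pow_le_pow_of_le_one hr0.le hr1.le
        (by have := Nat.mod_lt k (show 0 < l by omega); omega)
  refine hmain.trans ?_
  calc M₁ * α ^ (k / l) * (C₁ * oscWeight β V x y)
      ≤ M₁ * (r ^ k / α) * (C₁ * (√(2 + β) * (V x + V y))) := by
        have := oscWeight_nonneg β V x y
        gcongr
        exact oscWeight_le hV1 hβ.le x y
    _ = _ := by rw [hM₁]; ring

end Ergodicity

/-! ### The Poisson equation of a single kernel. -/

section Poisson

variable {Z : Type*} [MeasurableSpace Z]
  {E : Type*} [NormedAddCommGroup E] [NormedSpace ℝ E] [CompleteSpace E]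

/-- Geometric ergodicity of `κ` relative to `V`, with constants `B`, `C` and rate `r`: second moments
of `V` stay bounded and oscillations of `E`-valued functions decay geometrically. -/
structure GeomErgodic (E : Type*) [NormedAddCommGroup E] [NormedSpace ℝ E]
    (κ : Kernel Z Z) (V : Z → ℝ) (B C r : ℝ) : Prop where
  moment : ∀ k z, ∫⁻ z', ENNReal.ofReal (V z' ^ 2) ∂(κ ^ k) z ≤ ENNReal.ofReal (V z ^ 2 + B)
  contract : ∀ (g : Z → E) (M : ℝ), 0 ≤ M → StronglyMeasurable g →
    (∀ x y, ‖g x - g y‖ ≤ M * (V x + V y)) → ∀ k x y,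
    ‖∫ z, g z ∂(κ ^ k) x - ∫ z, g z ∂(κ ^ k) y‖ ≤ C * r ^ k * M * (V x + V y)

/-- The constants are chosen before the kernel, so one triple serves every `K_w` with `w ∈ S`. -/
lemma exists_geomErgodic {V : Z → ℝ} (hV : Measurable V) (hV1 : ∀ z, 1 ≤ V z)
    {l : ℕ} (hl : 1 ≤ l) {ρ b R δ : ℝ} (hρ : 0 < ρ) (hρ1 : ρ < 1) (hb : 0 ≤ b)
    (hR : 2 * b / (1 - ρ) < R) (hδ : 0 < δ) (ν : Measure Z) [IsProbabilityMeasure ν] :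
    ∃ B C r : ℝ, 0 ≤ B ∧ 0 ≤ C ∧ 0 < r ∧ r < 1 ∧ ∀ (κ : Kernel Z Z) [IsMarkovKernel κ],
      (∀ z, ∫⁻ z', ENNReal.ofReal (V z' ^ 2) ∂κ z ≤ ENNReal.ofReal (ρ * V z ^ 2 + b)) →
      (∀ z, V z ^ 2 ≤ R → ∀ A : Set Z, MeasurableSet A →
        ENNReal.ofReal δ * ν A ≤ (κ ^ l) z A) →
      GeomErgodic E κ V B C r := by
  obtain ⟨C, r, hC, hr, hr1, h⟩ :=
    exists_geometric_contraction (E := E) hV hV1 hl hρ hρ1 hb hR hδ ν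
  have h1ρ : 0 < 1 - ρ := by linarith
  refine ⟨b / (1 - ρ), C, r, by positivity, hC, hr, hr1, fun κ _ hd hm => ⟨fun k z => ?_, h κ hd hm⟩⟩
  refine (drift_pow hV hρ hρ1 hb hd k z).trans (ENNReal.ofReal_le_ofReal ?_)
  have h1 : ρ ^ k * V z ^ 2 ≤ V z ^ 2 :=
    mul_le_of_le_one_left (sq_nonneg _) (pow_le_one₀ hρ.le hρ1.le)
  have h2 : b * (1 - ρ ^ k) / (1 - ρ) ≤ b / (1 - ρ) := by
    gcongr
    exact mul_le_of_le_one_right hb (by linarith [pow_pos hρ k])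
  linarith

variable {κ : Kernel Z Z} [IsMarkovKernel κ] {V : Z → ℝ} {B C r : ℝ}

lemma integrable_of_integrable_sq (hV : Measurable V) (hV1 : ∀ z, 1 ≤ V z) {μ : Measure Z}
    (h : Integrable (fun z => V z ^ 2) μ) : Integrable V μ :=
  h.mono' hV.aestronglyMeasurable (ae_of_all _ fun z => by
    rw [Real.norm_of_nonneg (zero_le_one.trans (hV1 z))]; nlinarith [hV1 z])

lemma integrable_of_norm_sub_le {μ : Measure Z}
    [IsFiniteMeasure μ] (hμ : Integrable V μ) {g : Z → E} {M : ℝ}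
    (hg : StronglyMeasurable g) (hosc : ∀ x y, ‖g x - g y‖ ≤ M * (V x + V y)) :
    Integrable g μ := by
  rcases isEmpty_or_nonempty Z with hZ | ⟨⟨z₀⟩⟩
  · rw [Measure.eq_zero_of_isEmpty μ]; exact integrable_zero_measure
  refine ((integrable_const ‖g z₀‖).add ((hμ.add (integrable_const (V z₀))).const_mul M)).mono'
    hg.aestronglyMeasurable (ae_of_all _ fun z => ?_)
  have h1 : ‖g z‖ ≤ ‖g z₀‖ + ‖g z - g z₀‖ := by
    simpa using norm_add_le (g z₀) (g z - g z₀)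
  exact h1.trans (add_le_add le_rfl (hosc z z₀))

namespace GeomErgodic

lemma integrable_V (h : GeomErgodic E κ V B C r) (hV : Measurable V) (hV1 : ∀ z, 1 ≤ V z)
    (k : ℕ) (z : Z) : Integrable V ((κ ^ k) z) :=
  integrable_of_integrable_sq hV hV1 (integrable_sq_of_drift hV (h.moment k z))

/-- Integrate `2 V(z) V(y) ≤ V(y)² + V(z)²` in `y`, use the second moment, and divide by `2 V(z)`;
`V ≥ 1` absorbs `B`. -/
lemma integral_V_le (h : GeomErgodic E κ V B C r) (hV : Measurable V) (hV1 : ∀ z, 1 ≤ V z)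
    (hB : 0 ≤ B) (k : ℕ) (z : Z) : ∫ y, V y ∂(κ ^ k) z ≤ (1 + B) * V z := by
  have hz := hV1 z
  have hz0 : 0 < V z := by linarith
  have hsq := integrable_sq_of_drift hV (h.moment k z)
  have hle := integral_sq_le_of_drift hV (by positivity) (h.moment k z)
  have h1 : ∫ y, 2 * V z * V y ∂(κ ^ k) z ≤ ∫ y, (V y ^ 2 + V z ^ 2) ∂(κ ^ k) z :=
    integral_mono ((h.integrable_V hV hV1 k z).const_mul _) (hsq.add (integrable_const _))
      fun y => by
        change 2 * V z * V y ≤ V y ^ 2 + V z ^ 2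
        nlinarith [sq_nonneg (V y - V z)]
  rw [integral_const_mul, integral_add hsq (integrable_const _)] at h1
  simp only [integral_const, probReal_univ, one_smul] at h1
  have h2 : 2 * V z * ∫ y, V y ∂(κ ^ k) z ≤ 2 * V z * ((1 + B) * V z) := by
    nlinarith [mul_nonneg hB (sub_nonneg.2 hz), mul_nonneg hB hz0.le,
      mul_nonneg (mul_nonneg hB hz0.le) (sub_nonneg.2 hz)]
  exact le_of_mul_le_mul_left h2 (by positivity)

lemma integrable (h : GeomErgodic E κ V B C r) (hV : Measurable V) (hV1 : ∀ z, 1 ≤ V z)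
    {g : Z → E} {M : ℝ} (hg : StronglyMeasurable g)
    (hosc : ∀ x y, ‖g x - g y‖ ≤ M * (V x + V y)) (k : ℕ) (z : Z) : Integrable g ((κ ^ k) z) :=
  integrable_of_norm_sub_le (h.integrable_V hV hV1 k z) hg hosc

end GeomErgodic

lemma integral_eq_of_invariant {κ : Kernel Z Z} {π : Measure Z} (hπ : κ.Invariant π) {g : Z → E}
    (hg : Integrable g π) : ∫ y, g y ∂π = ∫ y, ∫ y', g y' ∂κ y ∂π := by
  have h1 : (κ ∘ₖ Kernel.const Unit π) () = π := by
    rw [Kernel.comp_const κ π, Kernel.const_apply, hπ.def]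
  have h2 := Kernel.integral_comp (κ := Kernel.const Unit π) (η := κ) (a := ()) (f := g)
    (by rwa [h1])
  rwa [h1, Kernel.const_apply] at h2

/-- An invariant probability measure of a kernel with geometric drift integrates the drift
function. -/
lemma integrable_sq_of_invariant (hV : Measurable V) {ρ b : ℝ} (hρ : 0 < ρ) (hρ1 : ρ < 1)
    (hb : 0 ≤ b)
    (hdrift : ∀ z, ∫⁻ z', ENNReal.ofReal (V z' ^ 2) ∂κ z ≤ ENNReal.ofReal (ρ * V z ^ 2 + b))
    {π : Measure Z} [IsProbabilityMeasure π] (hπ : κ.Invariant π) :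
    Integrable (fun z => V z ^ 2) π := by
  have h1ρ : 0 < 1 - ρ := by linarith
  have hbound : ∀ N : ℕ, ∫⁻ z in {z | V z ^ 2 ≤ N}, ENNReal.ofReal (V z ^ 2) ∂π ≤
      ENNReal.ofReal (b / (1 - ρ)) := by
    intro N
    set A : Set Z := {z | V z ^ 2 ≤ N} with hA
    have hAm : MeasurableSet A := measurableSet_le (hV.pow_const 2) measurable_const
    -- Invariance cannot be applied to `V²` before it is known to be integrable, so it is applied to
    -- the truncation, where `π(m) = π(κm)`. As `κm ≤ min(ρV² + b, N)`, integrating `m - κm + b`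
    -- bounds `(1 - ρ)V²` over the sublevel set, uniformly in `N`.
    set m : Z → ℝ := fun z => min (V z ^ 2) N with hm
    have hmm : Measurable m := (hV.pow_const 2).min measurable_const
    have hm0 : ∀ z, 0 ≤ m z := fun z => le_min (sq_nonneg _) (Nat.cast_nonneg _)
    have hmN : ∀ z, m z ≤ N := fun z => min_le_right _ _
    have hminteg : ∀ (μ : Measure Z) [IsFiniteMeasure μ], Integrable m μ := fun μ _ =>
      Integrable.of_bound hmm.aestronglyMeasurable N (ae_of_all _ fun z => by
        rw [Real.norm_of_nonneg (hm0 z)]; exact hmN z)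
    have hinv : ∫ z, m z ∂π = ∫ z, ∫ y, m y ∂κ z ∂π := by
      exact integral_eq_of_invariant hπ (hminteg π)
    have hκint : Integrable (fun z => ∫ y, m y ∂κ z) π := by
      refine Integrable.of_bound
        (hmm.stronglyMeasurable.comp_measurable measurable_snd).integral_kernel_prod_right'.aestronglyMeasurable
        N (ae_of_all _ fun z => ?_)
      rw [Real.norm_of_nonneg (integral_nonneg hm0)]
      calc ∫ y, m y ∂κ z ≤ ∫ _, (N : ℝ) ∂κ z := integral_mono (hminteg _) (integrable_const _) hmN
        _ = N := by simp
    have hκle : ∀ z, ∫ y, m y ∂κ z ≤ ρ * V z ^ 2 + b := by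
      intro z
      exact (integral_mono (hminteg _) (integrable_sq_of_drift hV (hdrift z))
        fun y => min_le_left _ _).trans (integral_sq_le_of_drift hV (by positivity) (hdrift z))
    have hκleN : ∀ z, ∫ y, m y ∂κ z ≤ N := by
      intro z
      calc ∫ y, m y ∂κ z ≤ ∫ _, (N : ℝ) ∂κ z := integral_mono (hminteg _) (integrable_const _) hmN
        _ = N := by simp
    have hAint : Integrable (A.indicator fun z => (1 - ρ) * V z ^ 2) π := by
      refine Integrable.of_bound (((hV.pow_const 2).const_mul _).indicator hAm).aestronglyMeasurable
        N (ae_of_all _ fun z => ?_)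
      by_cases hz : z ∈ A
      · rw [Set.indicator_of_mem hz, Real.norm_of_nonneg (by positivity)]
        have : V z ^ 2 ≤ N := hz
        nlinarith [sq_nonneg (V z)]
      · simp [hz]
    have hpt : ∀ z, A.indicator (fun z => (1 - ρ) * V z ^ 2) z ≤ m z - ∫ y, m y ∂κ z + b := by
      intro z
      by_cases hz : z ∈ A
      · have hz' : V z ^ 2 ≤ N := hz
        rw [Set.indicator_of_mem hz]
        have : m z = V z ^ 2 := min_eq_left hz'
        linarith [hκle z]
      · have hz' : (N : ℝ) < V z ^ 2 := not_le.1 hz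
        rw [Set.indicator_of_notMem hz]
        have : m z = N := min_eq_right hz'.le
        linarith [hκleN z]
    have hle : ∫ z, A.indicator (fun z => (1 - ρ) * V z ^ 2) z ∂π ≤ b := by
      calc _ ≤ ∫ z, (m z - ∫ y, m y ∂κ z + b) ∂π :=
            integral_mono hAint (((hminteg π).sub hκint).add (integrable_const b)) hpt
        _ = b := by
            rw [integral_add (f := fun z => m z - ∫ y, m y ∂κ z) ((hminteg π).sub hκint)
              (integrable_const b), integral_sub (hminteg π) hκint, hinv]
            simp
    rw [integral_indicator hAm, integral_const_mul] at hle
    have hIon : Integrable (fun z => V z ^ 2) (π.restrict A) := by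
      refine Integrable.of_bound (hV.pow_const 2).aestronglyMeasurable N ?_
      filter_upwards [ae_restrict_mem hAm] with z hz
      rw [Real.norm_of_nonneg (sq_nonneg _)]
      exact hz
    rw [← ofReal_integral_eq_lintegral_ofReal hIon (ae_of_all _ fun z => sq_nonneg _)]
    apply ENNReal.ofReal_le_ofReal
    rw [le_div_iff₀ h1ρ]
    linarith
  refine integrable_sq_of_drift hV (B := b / (1 - ρ)) ?_
  have hmono : Monotone fun N : ℕ => {z | V z ^ 2 ≤ (N : ℝ)} := fun i j hij z hz =>
    le_trans (show V z ^ 2 ≤ (i : ℝ) from hz) (by exact_mod_cast hij)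
  have hunion : ⋃ N : ℕ, {z | V z ^ 2 ≤ (N : ℝ)} = Set.univ :=
    Set.eq_univ_of_forall fun z => Set.mem_iUnion.2 (exists_nat_ge (V z ^ 2))
  rw [← setLIntegral_univ, ← hunion, setLIntegral_iUnion_of_directed _ hmono.directed_le]
  exact iSup_le hbound

lemma invariant_pow {π : Measure Z} (hπ : κ.Invariant π) (k : ℕ) : (κ ^ k).Invariant π := by
  induction k with
  | zero =>
    rw [pow_zero, show ((1 : Kernel Z Z) = Kernel.id) from rfl, Kernel.Invariant]
    exact Measure.id_comp
  | succ k ih => rw [Kernel.pow_add, pow_one]; exact ih.comp hπ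

/-- The iterates of a geometrically ergodic kernel converge to the invariant mean. -/
lemma GeomErgodic.tendsto_integral (h : GeomErgodic E κ V B C r) (hr : 0 < r) (hr1 : r < 1) {π : Measure Z} [IsProbabilityMeasure π]
    (hπ : κ.Invariant π) (hπV : Integrable V π) {g : Z → E} {M : ℝ} (hM : 0 ≤ M)
    (hg : StronglyMeasurable g) (hosc : ∀ x y, ‖g x - g y‖ ≤ M * (V x + V y)) (z : Z) :
    Tendsto (fun k => ∫ y, g y ∂(κ ^ k) z) atTop (𝓝 (∫ y, g y ∂π)) := by
  rw [tendsto_iff_norm_sub_tendsto_zero]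
  have hlim : Tendsto (fun k : ℕ => C * r ^ k * M * (V z + ∫ y, V y ∂π)) atTop (𝓝 0) := by
    have := (((tendsto_pow_atTop_nhds_zero_of_lt_one hr.le hr1).const_mul C).mul_const M).mul_const
      (V z + ∫ y, V y ∂π)
    simpa using this
  refine squeeze_zero (fun _ => norm_nonneg _) (fun k => ?_) hlim
  have hgπ : Integrable g π := integrable_of_norm_sub_le hπV hg hosc
  have hinv := invariant_pow hπ k
  have heq : ∫ y, g y ∂π = ∫ y, ∫ y', g y' ∂(κ ^ k) y ∂π := by
    exact integral_eq_of_invariant hinv hgπ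
  have hκg : Integrable (fun y => ∫ y', g y' ∂(κ ^ k) y) π :=
    integrable_of_norm_sub_le hπV (stronglyMeasurable_integral_pow hg k)
      (h.contract g M hM hg hosc k)
  -- By invariance `π(g)` is the `π`-average of `κ^k g`, so the difference is an average of
  -- two-point differences.
  calc ‖∫ y, g y ∂(κ ^ k) z - ∫ y, g y ∂π‖
      = ‖∫ y, (∫ y', g y' ∂(κ ^ k) z - ∫ y', g y' ∂(κ ^ k) y) ∂π‖ := by
        rw [integral_sub (integrable_const _) hκg, heq]; simp
    _ ≤ ∫ y, C * r ^ k * M * (V z + V y) ∂π :=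
        norm_integral_le_of_norm_le (((integrable_const _).add hπV).const_mul _)
          (ae_of_all _ fun y => h.contract g M hM hg hosc k z y)
    _ = _ := by
        rw [integral_const_mul, integral_add (integrable_const _) hπV]; simp

/-- The solution, normalized to vanish at `z₀`, of the Poisson equation `u - κu = g - π(g)`. -/
def poissonSol (κ : Kernel Z Z) (g : Z → E) (z₀ z : Z) : E :=
  ∑' k, (∫ y, g y ∂(κ ^ k) z - ∫ y, g y ∂(κ ^ k) z₀)

namespace GeomErgodic

variable {g : Z → E} {M : ℝ} {z₀ : Z}

lemma summable_poissonSol (h : GeomErgodic E κ V B C r) (hr : 0 < r) (hr1 : r < 1)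
    (hM : 0 ≤ M) (hg : StronglyMeasurable g)
    (hosc : ∀ x y, ‖g x - g y‖ ≤ M * (V x + V y)) (x y : Z) :
    Summable fun k => (∫ z, g z ∂(κ ^ k) x - ∫ z, g z ∂(κ ^ k) y) := by
  refine Summable.of_norm_bounded (((summable_geometric_of_lt_one hr.le hr1).mul_left C).mul_right
    (M * (V x + V y))) fun k => ?_
  rw [← mul_assoc]
  exact h.contract g M hM hg hosc k x y

lemma norm_poissonSol_sub_le (h : GeomErgodic E κ V B C r) (hr : 0 < r) (hr1 : r < 1)
    (hM : 0 ≤ M) (hg : StronglyMeasurable g)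
    (hosc : ∀ x y, ‖g x - g y‖ ≤ M * (V x + V y)) (x y : Z) :
    ‖poissonSol κ g z₀ x - poissonSol κ g z₀ y‖ ≤ C / (1 - r) * M * (V x + V y) := by
  unfold poissonSol
  rw [← (h.summable_poissonSol hr hr1 hM hg hosc x z₀).tsum_sub
    (h.summable_poissonSol hr hr1 hM hg hosc y z₀)]
  simp only [sub_sub_sub_cancel_right]
  refine tsum_of_norm_bounded (g := fun k : ℕ => C * r ^ k * M * (V x + V y)) ?_
    fun k => h.contract g M hM hg hosc k x y
  have := (((hasSum_geometric_of_lt_one hr.le hr1).mul_left C).mul_right M).mul_right (V x + V y)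
  simpa [div_eq_mul_inv] using this

lemma poissonSol_self : poissonSol κ g z₀ z₀ = 0 := by
  simp [poissonSol]

lemma stronglyMeasurable_poissonSol (h : GeomErgodic E κ V B C r) (hr : 0 < r) (hr1 : r < 1)
    (hM : 0 ≤ M) (hg : StronglyMeasurable g)
    (hosc : ∀ x y, ‖g x - g y‖ ≤ M * (V x + V y)) :
    StronglyMeasurable (poissonSol κ g z₀) := by
  refine stronglyMeasurable_of_tendsto (u := atTop) (f := fun n z => ∑ k ∈ Finset.range n,
    (∫ y, g y ∂(κ ^ k) z - ∫ y, g y ∂(κ ^ k) z₀)) (fun n => ?_) ?_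
  · exact Finset.stronglyMeasurable_fun_sum _ fun k _ =>
      (stronglyMeasurable_integral_pow hg k).sub stronglyMeasurable_const
  · rw [tendsto_pi_nhds]
    exact fun z => (h.summable_poissonSol hr hr1 hM hg hosc z z₀).hasSum.tendsto_sum_nat

/-- The Poisson equation. -/
lemma poissonSol_sub_integral (h : GeomErgodic E κ V B C r) (hV : Measurable V)
    (hV1 : ∀ z, 1 ≤ V z) (hr : 0 < r) (hr1 : r < 1)
    {π : Measure Z} [IsProbabilityMeasure π]
    (hπ : κ.Invariant π) (hπV : Integrable V π) (hM : 0 ≤ M) (hg : StronglyMeasurable g)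
    (hosc : ∀ x y, ‖g x - g y‖ ≤ M * (V x + V y)) (z : Z) :
    poissonSol κ g z₀ z - ∫ y, poissonSol κ g z₀ y ∂κ z = g z - ∫ y, g y ∂π := by
  have hκ1 : ∀ f : Z → E, ∫ y, f y ∂κ z = ∫ y, f y ∂(κ ^ 1) z := fun f => by rw [pow_one]
  set T : ℕ → Z → E := fun k y => ∫ y', g y' ∂(κ ^ k) y with hT
  have hTm : ∀ k, StronglyMeasurable (T k) := stronglyMeasurable_integral_pow hg
  have hVint := h.integrable_V hV hV1 1 z
  have hTint : ∀ k, Integrable (T k) ((κ ^ 1) z) := fun k =>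
    integrable_of_norm_sub_le hVint (hTm k) (h.contract g M hM hg hosc k)
  have hint : ∀ k, ∫ y, (T k y - T k z₀) ∂(κ ^ 1) z = T (k + 1) z - T k z₀ := by
    intro k
    rw [integral_sub (hTint k) (integrable_const _),
      ← integral_pow_add (h.integrable hV hV1 hg hosc (k + 1) z)]
    simp [hT]
  have hsumint : HasSum (fun k => T (k + 1) z - T k z₀) (∫ y, poissonSol κ g z₀ y ∂(κ ^ 1) z) := by
    simp_rw [← hint]
    refine hasSum_integral_of_summable_integral_norm
      (fun k => (hTint k).sub (integrable_const _)) ?_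
    refine Summable.of_nonneg_of_le (fun k => integral_nonneg fun _ => norm_nonneg _) (fun k => ?_)
      (((summable_geometric_of_lt_one hr.le hr1).mul_left C).mul_right
        (M * ∫ y, (V y + V z₀) ∂(κ ^ 1) z))
    calc ∫ y, ‖T k y - T k z₀‖ ∂(κ ^ 1) z ≤ ∫ y, C * r ^ k * M * (V y + V z₀) ∂(κ ^ 1) z :=
          integral_mono ((hTint k).sub (integrable_const _)).norm
            ((hVint.add (integrable_const _)).const_mul _)
            fun y => h.contract g M hM hg hosc k y z₀
      _ = _ := by rw [integral_const_mul, mul_assoc]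
  have hsum : HasSum (fun k => T k z - T k z₀) (poissonSol κ g z₀ z) :=
    (h.summable_poissonSol hr hr1 hM hg hosc z z₀).hasSum
  -- The terms at `z₀` cancel and the rest telescopes: the partial sums are `g z - κ^n g z`, which
  -- tend to `g z - π(g)`.
  have hdiff := (hsum.sub hsumint).tendsto_sum_nat
  simp only [sub_sub_sub_cancel_right] at hdiff
  simp_rw [Finset.sum_range_sub'] at hdiff
  have hT0 : T 0 z = g z := by
    simp only [hT]
    rw [pow_zero, show ((1 : Kernel Z Z) = Kernel.id) from rfl, Kernel.id_apply,
      integral_dirac' _ _ hg]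
  rw [hT0] at hdiff
  rw [hκ1]
  exact tendsto_nhds_unique hdiff
    (tendsto_const_nhds.sub (h.tendsto_integral hr hr1 hπ hπV hM hg hosc z))

/-- Stability of the Poisson equation: the oscillation of a solution is controlled by the
right-hand side. -/
lemma norm_sub_le_of_sub_integral_eq (h : GeomErgodic E κ V B C r) (hV : Measurable V)
    (hV1 : ∀ z, 1 ≤ V z) (hr : 0 < r) (hr1 : r < 1) {u s : Z → E} {M' m : ℝ} {a : E}
    (hM' : 0 ≤ M') (hm : 0 ≤ m) (hu : StronglyMeasurable u)
    (huosc : ∀ x y, ‖u x - u y‖ ≤ M' * (V x + V y)) (hs : StronglyMeasurable s)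
    (hsV : ∀ z, ‖s z‖ ≤ m * V z) (heq : ∀ z, u z - ∫ y, u y ∂κ z = s z + a) (x y : Z) :
    ‖u x - u y‖ ≤ C / (1 - r) * m * (V x + V y) := by
  have hsosc : ∀ x y, ‖s x - s y‖ ≤ m * (V x + V y) := fun x y =>
    (norm_sub_le _ _).trans (by linarith [hsV x, hsV y])
  have hVx : 0 ≤ V x := zero_le_one.trans (hV1 x)
  have hVy : 0 ≤ V y := zero_le_one.trans (hV1 y)
  have hstep : ∀ k z, ∫ y, u y ∂(κ ^ k) z =
      ∫ y, u y ∂(κ ^ (k + 1)) z + ∫ y, s y ∂(κ ^ k) z + a := by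
    intro k z
    have hui : Integrable u ((κ ^ (1 + k)) z) := h.integrable hV hV1 hu huosc _ z
    have hκu : Integrable (fun y => ∫ y', u y' ∂(κ ^ 1) y) ((κ ^ k) z) :=
      integrable_of_norm_sub_le (h.integrable_V hV hV1 k z)
        (stronglyMeasurable_integral_pow hu 1) (h.contract u M' hM' hu huosc 1)
    have hsi : Integrable s ((κ ^ k) z) := h.integrable hV hV1 hs hsosc k z
    have hκus : Integrable (fun y => ∫ y', u y' ∂(κ ^ 1) y + s y) ((κ ^ k) z) := hκu.add hsi
    rw [add_comm k 1, integral_pow_add hui, ← integral_add hκu hsi]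
    have : ∫ y, (∫ y', u y' ∂(κ ^ 1) y + s y + a) ∂(κ ^ k) z =
        ∫ y, (∫ y', u y' ∂(κ ^ 1) y + s y) ∂(κ ^ k) z + a := by
      rw [integral_add hκus (integrable_const a)]; simp
    rw [← this]
    refine integral_congr_ae (ae_of_all _ fun y => ?_)
    have := heq y
    rw [sub_eq_iff_eq_add] at this
    simp only [pow_one]
    rw [this]
    abel
  -- Iterating `u = κu + s + a`; the constant `a` disappears from two-point differences.
  have hn : ∀ n : ℕ, ‖u x - u y‖ ≤ ∑ k ∈ Finset.range n, C * r ^ k * m * (V x + V y) +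
      ‖∫ z, u z ∂(κ ^ n) x - ∫ z, u z ∂(κ ^ n) y‖ := by
    intro n
    induction n with
    | zero =>
      rw [pow_zero, show ((1 : Kernel Z Z) = Kernel.id) from rfl, Kernel.id_apply, Kernel.id_apply,
        integral_dirac' _ _ hu, integral_dirac' _ _ hu]
      simp
    | succ n ih =>
      refine ih.trans ?_
      rw [Finset.sum_range_succ, add_assoc]
      gcongr
      rw [hstep n x, hstep n y]
      have e : ∀ p q p' q' : E, p + q + a - (p' + q' + a) = (q - q') + (p - p') := by
        intros; abel
      rw [e]
      exact (norm_add_le _ _).trans (by gcongr; exact h.contract s m hm hs hsosc n x y)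
  have hsum : Tendsto (fun n : ℕ => ∑ k ∈ Finset.range n, C * r ^ k * m * (V x + V y)) atTop
      (𝓝 (C / (1 - r) * m * (V x + V y))) := by
    have := ((((hasSum_geometric_of_lt_one hr.le hr1).mul_left C).mul_right m).mul_right
      (V x + V y)).tendsto_sum_nat
    simpa [div_eq_mul_inv] using this
  -- The a priori bound `M'` serves to remove the tail, so it does not enter the final constant.
  have htail : Tendsto (fun n : ℕ => ‖∫ z, u z ∂(κ ^ n) x - ∫ z, u z ∂(κ ^ n) y‖) atTop (𝓝 0) :=
    tendsto_zero_iff_norm_tendsto_zero.1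
      (h.summable_poissonSol hr hr1 hM' hu huosc x y).tendsto_atTop_zero
  have := le_of_tendsto_of_tendsto' tendsto_const_nhds (hsum.add htail) hn
  simpa using this

end GeomErgodic

end Poisson

/-! ### Dependence of the Poisson solution on the parameter. -/

section ParametricPoisson

variable {Z : Type*} [MeasurableSpace Z]

/-- Powers are taken section by section, so joint measurability in `(w, z)` is not automatic. The
induction writes `k + 1` steps as one step of `K`, which is jointly measurable, followed by `k`
steps. -/
lemma stronglyMeasurable_integral_pow_param {E W : Type*} [NormedAddCommGroup E] [NormedSpace ℝ E]
    [CompleteSpace E] [MeasurableSpace W] (K : Kernel (W × Z) Z) [IsMarkovKernel K] {g : W × Z → E}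
    (hg : StronglyMeasurable g)
    (hint : ∀ k w z, Integrable (fun y => g (w, y)) (((K.sectR w) ^ k) z)) (k : ℕ) :
    StronglyMeasurable fun y : W × Z => ∫ z, g (y.1, z) ∂((K.sectR y.1) ^ k) y.2 := by
  induction k with
  | zero =>
    convert hg using 2 with y
    rw [pow_zero, show ((1 : Kernel Z Z) = Kernel.id) from rfl, Kernel.id_apply, integral_dirac']
    exact hg.comp_measurable measurable_prodMk_left
  | succ k ih =>
    have heq : ∀ y : W × Z, ∫ z, g (y.1, z) ∂((K.sectR y.1) ^ (k + 1)) y.2 =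
        ∫ z, ∫ z', g (y.1, z') ∂((K.sectR y.1) ^ k) z ∂K y := by
      intro y
      rw [integral_pow_add (hint _ _ _), pow_one, Kernel.sectR_apply]
    simp_rw [heq]
    have : StronglyMeasurable fun x : (W × Z) × Z =>
        ∫ z', g (x.1.1, z') ∂((K.sectR x.1.1) ^ k) x.2 :=
      ih.comp_measurable (g := fun x : (W × Z) × Z => (x.1.1, x.2)) (by fun_prop)
    exact this.integral_kernel_prod_right'

/-- A Lipschitz bound for a pair of measures, tested on real functions, extends to functions with
values in a Hilbert space. -/
lemma norm_integral_sub_le_of_real {E : Type*} [NormedAddCommGroup E] [InnerProductSpace ℝ E]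
    [CompleteSpace E] {V : Z → ℝ} {μ ν : Measure Z} {L : ℝ}
    (h : ∀ g : Z → ℝ, Measurable g → (∀ z, |g z| ≤ V z) → |∫ z, g z ∂μ - ∫ z, g z ∂ν| ≤ L)
    {g : Z → E} (hg : StronglyMeasurable g) {m : ℝ} (hm : 0 < m) (hgV : ∀ z, ‖g z‖ ≤ m * V z)
    (hμ : Integrable g μ) (hν : Integrable g ν) :
    ‖∫ z, g z ∂μ - ∫ z, g z ∂ν‖ ≤ m * L := by
  set d := ∫ z, g z ∂μ - ∫ z, g z ∂ν with hd
  have hV : ∀ z, 0 ≤ V z := fun z => by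
    have := (norm_nonneg _).trans (hgV z)
    exact nonneg_of_mul_nonneg_right this hm
  have hL : 0 ≤ L := (abs_nonneg _).trans (h (fun _ => 0) measurable_const fun z => by simpa using hV z)
  rcases eq_or_ne d 0 with h0 | h0
  · rw [h0, norm_zero]; positivity
  have hdpos : 0 < ‖d‖ := norm_pos_iff.2 h0
  have hin : ∀ ξ : Measure Z, Integrable g ξ →
      ∫ z, (‖d‖ * m)⁻¹ * inner ℝ d (g z) ∂ξ = (‖d‖ * m)⁻¹ * inner ℝ d (∫ z, g z ∂ξ) := by
    intro ξ hξ
    rw [integral_const_mul, integral_inner hξ]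
  -- The test function is `g` in the direction of the difference `d`, scaled to be bounded by `V`.
  have key := h (fun z => (‖d‖ * m)⁻¹ * inner ℝ d (g z))
    (((stronglyMeasurable_const (b := d)).inner hg).measurable.const_mul _) (fun z => by
      rw [abs_mul, abs_of_pos (by positivity), inv_mul_le_iff₀ (by positivity), mul_assoc]
      exact (abs_real_inner_le_norm _ _).trans (mul_le_mul_of_nonneg_left (hgV z) hdpos.le))
  rw [hin μ hμ, hin ν hν, ← mul_sub, ← inner_sub_right, ← hd, real_inner_self_eq_norm_sq,
    abs_of_nonneg (by positivity)] at key
  have : (‖d‖ * m)⁻¹ * ‖d‖ ^ 2 = ‖d‖ / m := by field_simp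
  rw [this, div_le_iff₀ hm] at key
  linarith

variable {E : Type*} [NormedAddCommGroup E] [InnerProductSpace ℝ E] [CompleteSpace E]
  [MeasurableSpace E] [BorelSpace E] [SecondCountableTopology E]

/-- A measurable retraction onto a nonempty measurable set. -/
lemma exists_measurable_retraction {S : Set E} (hS : MeasurableSet S) (hne : S.Nonempty) :
    ∃ r : E → S, Measurable r ∧ ∀ w (hw : w ∈ S), r w = ⟨w, hw⟩ := by
  classical
  obtain ⟨w₀, hw₀⟩ := hne
  refine ⟨fun w => ⟨if w ∈ S then w else w₀, by split_ifs with h; exacts [h, hw₀]⟩, ?_, ?_⟩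
  · exact (Measurable.ite hS measurable_id measurable_const).subtype_mk
  · intro w hw
    simp [hw]

/-- The analytic input of the noise decomposition: a solution `G` of the Poisson equations
`G_w - K_w G_w = F_w - f(w)` for `w ∈ S`, jointly measurable, bounded by `V`, and with `K_w G_w`
Lipschitz in `w` relative to `V`. -/
structure PoissonFamily (S : Set E) (K : Kernel (E × Z) Z) (F : Z → E → E) (f : E → E) (V : Z → ℝ)
    (A : ℝ) (G : E × Z → E) : Prop where
  stronglyMeasurable : StronglyMeasurable G
  bound : ∀ w ∈ S, ∀ z, ‖G (w, z)‖ ≤ A * V z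
  bound_integral : ∀ w ∈ S, ∀ z, ‖∫ z', G (w, z') ∂K (w, z)‖ ≤ A * V z
  lipschitz : ∀ w ∈ S, ∀ w' ∈ S, ∀ z,
    ‖∫ z', G (w, z') ∂K (w, z) - ∫ z', G (w', z') ∂K (w', z)‖ ≤ A * V z * ‖w - w'‖
  eq : ∀ w ∈ S, ∀ z, G (w, z) - ∫ z', G (w, z') ∂K (w, z) = F z w - f w

/-- Regularity in `w` rests on the stability of the Poisson equation: `G_w - G_w'` solves the
equation of `K_w` with right-hand side `(F_w - F_w') + (K_w - K_w') G_w'` up to a constant, and both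
terms are of order `V ‖w - w'‖`. -/
theorem exists_poissonFamily {S : Set E} (hS : MeasurableSet S) (hne : S.Nonempty)
    {K : Kernel (E × Z) Z} [IsMarkovKernel K] {F : Z → E → E} {p : E → Measure Z}
    (hp : ∀ w ∈ S, IsProbabilityMeasure (p w)) (hinv : ∀ w ∈ S, (K.sectR w).Invariant (p w))
    (hFm : ∀ w ∈ S, StronglyMeasurable fun z => F z w) (hdrift : DriftCondition S K F) :
    ∃ (V : Z → ℝ) (ρ b c : ℝ), Measurable V ∧ (∀ z, 1 ≤ V z) ∧ 0 < ρ ∧ ρ < 1 ∧ 0 ≤ b ∧ 0 ≤ c ∧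
      (∀ w ∈ S, ∀ z, ∫⁻ z', ENNReal.ofReal (V z' ^ 2) ∂(K (w, z)) ≤
        ENNReal.ofReal (ρ * V z ^ 2 + b)) ∧
      (∀ w ∈ S, ∀ z, ‖F z w‖ ≤ c * V z) ∧
      ∃ (A : ℝ) (G : E × Z → E), 0 ≤ A ∧ PoissonFamily S K F (meanField p F) V A G := by
  obtain ⟨V, ν, l, ρ, b, R, δ, c₀, hV, hV1, hν, hl, hρ, hρ1, hb, hR, hδ, hc₀, hdr, hmin, hF₀, hFL₀,
    hKL₀⟩ := hdrift
  have hV0 : ∀ z, 0 ≤ V z := fun z => zero_le_one.trans (hV1 z)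
  obtain ⟨B, C, r, hB, hC, hr, hr1, herg⟩ :=
    exists_geomErgodic (E := E) hV hV1 hl hρ hρ1 hb hR hδ ν
  set c := c₀ + 1 with hc
  have hc0 : 0 < c := by positivity
  have hcc : c₀ ≤ c := by linarith
  have hF : ∀ w ∈ S, ∀ z, ‖F z w‖ ≤ c * V z := fun w hw z =>
    (hF₀ w hw z).trans (mul_le_mul_of_nonneg_right hcc (hV0 z))
  have hFL : ∀ w ∈ S, ∀ w' ∈ S, ∀ z, ‖F z w - F z w'‖ ≤ c * V z * ‖w - w'‖ :=
    fun w hw w' hw' z => (hFL₀ w hw w' hw' z).trans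
      (mul_le_mul_of_nonneg_right (mul_le_mul_of_nonneg_right hcc (hV0 z)) (norm_nonneg _))
  have hge : ∀ w ∈ S, GeomErgodic E (K.sectR w) V B C r := fun w hw =>
    herg (K.sectR w) (fun z => hdr w hw z) (hmin w hw)
  have hπV : ∀ w ∈ S, Integrable V (p w) := by
    intro w hw
    have := hp w hw
    exact integrable_of_integrable_sq hV hV1
      (integrable_sq_of_invariant hV hρ hρ1 hb (fun z => hdr w hw z) (hinv w hw))
  have hFosc : ∀ w ∈ S, ∀ x y, ‖F x w - F y w‖ ≤ c * (V x + V y) := fun w hw x y =>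
    (norm_sub_le _ _).trans (by linarith [hF w hw x, hF w hw y])
  obtain ⟨ret, hret, hretS⟩ := exists_measurable_retraction hS hne
  obtain ⟨z₀⟩ : Nonempty Z := by
    obtain ⟨w, hw⟩ := hne
    have := hp w hw
    exact (p w).nonempty_of_neZero
  -- the solutions
  set G : E × Z → E := fun y => poissonSol (K.sectR (ret y.1 : E)) (fun z => F z (ret y.1 : E)) z₀ y.2
    with hG
  have hGS : ∀ w ∈ S, ∀ z, G (w, z) = poissonSol (K.sectR w) (fun z => F z w) z₀ z := by
    intro w hw z
    simp only [hG, hretS w hw]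
  have h1r : 0 < 1 - r := by linarith
  set D := C / (1 - r) with hD
  have hD0 : 0 ≤ D := by positivity
  set v₀ := V z₀ with hv₀
  have hv0 : 0 ≤ v₀ := hV0 z₀
  have hVadd : ∀ z, V z + v₀ ≤ (1 + v₀) * V z := fun z => by
    nlinarith [mul_nonneg hv0 (sub_nonneg.2 (hV1 z))]
  -- The `+ 1` makes the bound strictly positive, as `norm_integral_sub_le_of_real` requires.
  set A₁ := D * c * (1 + v₀) + 1 with hA₁
  have hA₁0 : 0 < A₁ := by positivity
  have hGosc : ∀ w ∈ S, ∀ x y, ‖G (w, x) - G (w, y)‖ ≤ D * c * (V x + V y) := by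
    intro w hw x y
    rw [hGS w hw, hGS w hw]
    exact (hge w hw).norm_poissonSol_sub_le hr hr1 hc0.le (hFm w hw) (hFosc w hw) x y
  have hGz₀ : ∀ w ∈ S, G (w, z₀) = 0 := fun w hw => by
    rw [hGS w hw]; exact GeomErgodic.poissonSol_self
  have hGb : ∀ w ∈ S, ∀ z, ‖G (w, z)‖ ≤ A₁ * V z := by
    intro w hw z
    have h1 := hGosc w hw z z₀
    rw [hGz₀ w hw, sub_zero] at h1
    calc _ ≤ D * c * (V z + v₀) := h1
      _ ≤ D * c * ((1 + v₀) * V z) := by gcongr; exact hVadd z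
      _ ≤ A₁ * V z := by rw [hA₁]; nlinarith [hV0 z]
  have hGm : ∀ w ∈ S, StronglyMeasurable fun z => G (w, z) := by
    intro w hw
    simp_rw [hGS w hw]
    exact (hge w hw).stronglyMeasurable_poissonSol hr hr1 hc0.le (hFm w hw) (hFosc w hw)
  have hVint : ∀ w ∈ S, ∀ z, Integrable V (K (w, z)) := fun w hw z => by
    simpa using (hge w hw).integrable_V hV hV1 1 z
  have hVle : ∀ w ∈ S, ∀ z, ∫ y, V y ∂K (w, z) ≤ (1 + B) * V z := fun w hw z => by
    simpa using (hge w hw).integral_V_le hV hV1 hB 1 z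
  have hGint : ∀ w' ∈ S, ∀ w ∈ S, ∀ z, Integrable (fun y => G (w', y)) (K (w, z)) :=
    fun w' hw' w hw z => integrable_of_norm_sub_le (hVint w hw z) (hGm w' hw') (hGosc w' hw')
  have hGeq : ∀ w ∈ S, ∀ z, G (w, z) - ∫ z', G (w, z') ∂K (w, z) = F z w - meanField p F w := by
    intro w hw z
    have := hp w hw
    have h := (hge w hw).poissonSol_sub_integral (z₀ := z₀) hV hV1 hr hr1 (hinv w hw) (hπV w hw)
      hc0.le (hFm w hw) (hFosc w hw) z
    simp_rw [hGS w hw]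
    exact h
  have hKL : ∀ w ∈ S, ∀ w' ∈ S, ∀ w'' ∈ S, ∀ z,
      ‖∫ y, G (w'', y) ∂K (w, z) - ∫ y, G (w'', y) ∂K (w', z)‖ ≤ A₁ * (c * V z * ‖w - w'‖) := by
    intro w hw w' hw' w'' hw'' z
    refine norm_integral_sub_le_of_real (V := V) (fun g hg hgV => ?_) (hGm w'' hw'') hA₁0
      (hGb w'' hw'') (hGint w'' hw'' w hw z) (hGint w'' hw'' w' hw' z)
    refine (hKL₀ w hw w' hw' g hg hgV z).trans ?_
    have := hV0 z
    gcongr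
  set A₂ := D * (c + A₁ * c) * (1 + v₀) with hA₂
  have hA₂0 : 0 ≤ A₂ := by positivity
  have hGL : ∀ w ∈ S, ∀ w' ∈ S, ∀ z, ‖G (w, z) - G (w', z)‖ ≤ A₂ * ‖w - w'‖ * V z := by
    intro w hw w' hw' z
    set e := ‖w - w'‖ with he
    have he0 : 0 ≤ e := norm_nonneg _
    have hs : StronglyMeasurable fun y => (F y w - F y w') +
        (∫ y', G (w', y') ∂K (w, y) - ∫ y', G (w', y') ∂K (w', y)) := by
      refine ((hFm w hw).sub (hFm w' hw')).add (StronglyMeasurable.sub ?_ ?_)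
      · simpa using stronglyMeasurable_integral_pow (κ := K.sectR w) (hGm w' hw') 1
      · simpa using stronglyMeasurable_integral_pow (κ := K.sectR w') (hGm w' hw') 1
    -- The change of the mean field is the constant `a`, so no Lipschitz bound on the mean field is
    -- needed.
    have h := (hge w hw).norm_sub_le_of_sub_integral_eq hV hV1 hr hr1
      (u := fun y => G (w, y) - G (w', y)) (M' := 2 * (D * c)) (m := (c + A₁ * c) * e)
      (a := meanField p F w' - meanField p F w) (by positivity) (by positivity)
      ((hGm w hw).sub (hGm w' hw'))
      (fun x y => by
        have : G (w, x) - G (w', x) - (G (w, y) - G (w', y)) =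
          (G (w, x) - G (w, y)) - (G (w', x) - G (w', y)) := by abel
        rw [this]
        refine (norm_sub_le _ _).trans ?_
        linarith [hGosc w hw x y, hGosc w' hw' x y]) hs
      (fun y => by
        refine (norm_add_le _ _).trans ?_
        have h1 := hFL w hw w' hw' y
        have h2 := hKL w hw w' hw' w' hw' y
        rw [← he] at h1 h2
        calc _ ≤ c * V y * e + A₁ * (c * V y * e) := add_le_add h1 h2
          _ = _ := by ring)
      (fun y => by
        rw [Kernel.sectR_apply, integral_sub (hGint w hw w hw y) (hGint w' hw' w hw y)]
        have e1 := hGeq w hw y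
        have e2 := hGeq w' hw' y
        have e3 : G (w, y) = F y w - meanField p F w + ∫ z', G (w, z') ∂K (w, y) := by
          rw [← e1]; abel
        have e4 : G (w', y) = F y w' - meanField p F w' + ∫ z', G (w', z') ∂K (w', y) := by
          rw [← e2]; abel
        rw [e3, e4]
        abel) z z₀
    simp only [hGz₀ w hw, hGz₀ w' hw', sub_zero] at h
    calc _ ≤ D * ((c + A₁ * c) * e) * (V z + v₀) := h
      _ ≤ D * ((c + A₁ * c) * e) * ((1 + v₀) * V z) := by gcongr; exact hVadd z
      _ = _ := by rw [hA₂]; ring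
  refine ⟨V, ρ, b, c, hV, hV1, hρ, hρ1, hb, hc0.le, hdr, hF,
    A₁ * (1 + B) + A₂ * (1 + B) + A₁ * c, G, by positivity, ?_⟩
  refine ⟨?_, fun w hw z => ?_, fun w hw z => ?_,
    fun w hw w' hw' z => ?_, hGeq⟩
  · set K' : Kernel (E × Z) Z := K.comap (fun y : E × Z => ((ret y.1 : E), y.2))
      (by fun_prop) with hK'
    have hsect : ∀ w, K'.sectR w = K.sectR (ret w : E) := by
      intro w; ext z : 1; rfl
    have hg : StronglyMeasurable fun y : E × Z => F y.2 (ret y.1 : E) := by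
      -- A Carathéodory function: Lipschitz in the parameter, measurable in the observation.
      have hu : StronglyMeasurable (Function.uncurry fun (s : S) (z : Z) => F z s) := by
        refine stronglyMeasurable_uncurry_of_continuous_of_stronglyMeasurable (fun z => ?_)
          fun s => hFm s s.2
        refine (LipschitzWith.of_dist_le_mul (K := ⟨c * V z, mul_nonneg hc0.le (hV0 z)⟩) ?_).continuous
        intro s s'
        rw [dist_eq_norm, Subtype.dist_eq, dist_eq_norm]
        exact hFL s s.2 s' s'.2 z
      exact hu.comp_measurable (g := fun y : E × Z => (ret y.1, y.2)) (by fun_prop)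
    have hT := stronglyMeasurable_integral_pow_param K' hg (fun k w z => by
      rw [hsect]
      exact (hge _ (ret w).2).integrable hV hV1 (hFm _ (ret w).2) (hFosc _ (ret w).2) k z)
    refine stronglyMeasurable_of_tendsto (u := atTop) (f := fun n (y : E × Z) =>
      ∑ k ∈ Finset.range n, (∫ z, F z (ret y.1 : E) ∂((K'.sectR y.1) ^ k) y.2 -
        ∫ z, F z (ret y.1 : E) ∂((K'.sectR y.1) ^ k) z₀)) (fun n => ?_) ?_
    · exact Finset.stronglyMeasurable_fun_sum _ fun k _ => (hT k).sub
        ((hT k).comp_measurable (g := fun y : E × Z => (y.1, z₀)) (by fun_prop))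
    · rw [tendsto_pi_nhds]
      intro y
      simp_rw [hsect]
      exact ((hge _ (ret y.1).2).summable_poissonSol hr hr1 hc0.le (hFm _ (ret y.1).2)
        (hFosc _ (ret y.1).2) y.2 z₀).hasSum.tendsto_sum_nat
  · refine (hGb w hw z).trans (mul_le_mul_of_nonneg_right ?_ (hV0 z))
    have : 0 ≤ A₁ * B + A₂ * (1 + B) + A₁ * c := by positivity
    linarith
  · calc ‖∫ z', G (w, z') ∂K (w, z)‖ ≤ ∫ z', A₁ * V z' ∂K (w, z) :=
          norm_integral_le_of_norm_le ((hVint w hw z).const_mul _) (ae_of_all _ (hGb w hw))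
      _ ≤ A₁ * ((1 + B) * V z) := by
          rw [integral_const_mul]; exact mul_le_mul_of_nonneg_left (hVle w hw z) hA₁0.le
      _ ≤ _ := by
          rw [← mul_assoc]
          refine mul_le_mul_of_nonneg_right ?_ (hV0 z)
          have : 0 ≤ A₂ * (1 + B) + A₁ * c := by positivity
          linarith
  · have e : ∫ z', G (w, z') ∂K (w, z) - ∫ z', G (w', z') ∂K (w', z) =
        ∫ z', (G (w, z') - G (w', z')) ∂K (w, z) +
        (∫ z', G (w', z') ∂K (w, z) - ∫ z', G (w', z') ∂K (w', z)) := by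
      rw [integral_sub (hGint w hw w hw z) (hGint w' hw' w hw z)]; abel
    rw [e]
    have h1 : ‖∫ z', (G (w, z') - G (w', z')) ∂K (w, z)‖ ≤ A₂ * ‖w - w'‖ * ((1 + B) * V z) := by
      calc _ ≤ ∫ z', A₂ * ‖w - w'‖ * V z' ∂K (w, z) :=
            norm_integral_le_of_norm_le ((hVint w hw z).const_mul _) (ae_of_all _ (hGL w hw w' hw'))
        _ ≤ _ := by
            rw [integral_const_mul]; exact mul_le_mul_of_nonneg_left (hVle w hw z) (by positivity)
    have h2 := hKL w hw w' hw' w' hw' z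
    refine (norm_add_le _ _).trans ((add_le_add h1 h2).trans ?_)
    have : 0 ≤ A₁ * (1 + B) * V z * ‖w - w'‖ := by
      have := hV0 z
      positivity
    nlinarith

end ParametricPoisson

/-! ### Martingale convergence and the conditional law of the next observation. -/

section Noise

variable {Ω : Type*} {mΩ : MeasurableSpace Ω} {P : Measure Ω} [IsProbabilityMeasure P]
  {ℱ : Filtration ℕ mΩ}

/-- A series of martingale differences with summable variances converges almost surely. -/
theorem ae_exists_tendsto_sum_of_martingale_differences {d : ℕ → Ω → ℝ} {a : ℕ → ℝ}
    (hm : ∀ t, StronglyMeasurable[ℱ (t + 1)] (d t)) (hL2 : ∀ t, MemLp (d t) 2 P)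
    (hc : ∀ t, P[d t | ℱ t] =ᵐ[P] 0) (ha : Summable a) (hd : ∀ t, ∫ ω, d t ω ^ 2 ∂P ≤ a t) :
    ∀ᵐ ω ∂P, ∃ s, Tendsto (fun n => ∑ t ∈ Finset.range n, d t ω) atTop (𝓝 s) := by
  set M : ℕ → Ω → ℝ := fun n ω => ∑ t ∈ Finset.range n, d t ω with hM
  have hsucc : ∀ n, M (n + 1) = M n + d n := fun n => by
    ext ω; simp [hM, Finset.sum_range_succ]
  have hML2 : ∀ n, MemLp (M n) 2 P := fun n => memLp_finsetSum _ fun t _ => hL2 t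
  have hMm : StronglyAdapted ℱ M := fun n => Finset.stronglyMeasurable_fun_sum _ fun t ht =>
    (hm t).mono (ℱ.mono (Nat.succ_le_of_lt (Finset.mem_range.1 ht)))
  have hmart : Martingale M ℱ P := by
    refine martingale_of_condExp_sub_eq_zero_nat hMm
      (fun n => (hML2 n).integrable (by norm_num)) fun n => ?_
    rw [hsucc, add_sub_cancel_left]
    exact hc n
  have ha0 : ∀ t, 0 ≤ a t := fun t => (integral_nonneg fun _ => sq_nonneg _).trans (hd t)
  have hsq : ∀ n, ∫ ω, M n ω ^ 2 ∂P ≤ ∑ t ∈ Finset.range n, a t := by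
    intro n
    induction n with
    | zero => simp [hM]
    | succ n ih =>
      have hi : Integrable (M n * d n) P := (hML2 n).integrable_mul (hL2 n)
      -- Orthogonality of increments: the variances add, so the partial sums are bounded in `L²`,
      -- hence in `L¹`.
      have hcross : ∫ ω, (M n * d n) ω ∂P = 0 := by
        rw [← integral_condExp (ℱ.le n)]
        have h1 := condExp_mul_of_stronglyMeasurable_left (hMm n) hi ((hL2 n).integrable (by norm_num))
        have h2 : P[M n * d n | ℱ n] =ᵐ[P] 0 := by
          filter_upwards [h1, hc n] with ω h1 h2
          rw [h1, Pi.mul_apply, h2]; simp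
        rw [integral_congr_ae h2]; simp
      have hM2 := (hML2 n).integrable_sq
      have hd2 := (hL2 n).integrable_sq
      have hexp : ∀ ω, M (n + 1) ω ^ 2 = (M n ω ^ 2 + d n ω ^ 2) + 2 * (M n * d n) ω := by
        intro ω; rw [hsucc]; simp only [Pi.add_apply, Pi.mul_apply]; ring
      simp_rw [hexp]
      rw [integral_add (f := fun ω => M n ω ^ 2 + d n ω ^ 2) (hM2.add hd2) (hi.const_mul 2),
        integral_add hM2 hd2, integral_const_mul, hcross, Finset.sum_range_succ]
      linarith [hd n]
  set R : ℝ := 1 + ∑' t, a t with hR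
  have hR0 : 0 ≤ R := add_nonneg zero_le_one (tsum_nonneg ha0)
  refine hmart.submartingale.exists_ae_tendsto_of_bdd (R := ⟨R, hR0⟩) fun n => ?_
  rw [eLpNorm_one_eq_lintegral_enorm]
  have hint : Integrable (M n) P := (hML2 n).integrable (by norm_num)
  have h1 : ∫ ω, ‖M n ω‖ ∂P ≤ R := by
    calc ∫ ω, ‖M n ω‖ ∂P ≤ ∫ ω, (1 + M n ω ^ 2) ∂P := by
          refine integral_mono hint.norm ((integrable_const _).add (hML2 n).integrable_sq) fun ω => ?_
          change ‖M n ω‖ ≤ 1 + M n ω ^ 2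
          rw [Real.norm_eq_abs, ← sq_abs (M n ω)]
          nlinarith [sq_nonneg (|M n ω| - 1)]
      _ = 1 + ∫ ω, M n ω ^ 2 ∂P := by
          rw [integral_add (integrable_const _) (hML2 n).integrable_sq]; simp
      _ ≤ R := by
          rw [hR]
          gcongr
          exact (hsq n).trans (ha.sum_le_tsum _ fun t _ => ha0 t)
  rw [← ofReal_integral_norm_eq_lintegral_enorm hint]
  refine (ENNReal.ofReal_le_ofReal h1).trans (le_of_eq ?_)
  exact ENNReal.ofReal_eq_coe_nnreal hR0

/-- A weighted series of nonnegative random variables with bounded means and summable weights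
converges almost surely. -/
lemma ae_summable_mul_of_lintegral_le {Y : ℕ → Ω → ℝ} {a : ℕ → ℝ} {Q : ℝ}
    (hY : ∀ t, Measurable (Y t)) (hY0 : ∀ t ω, 0 ≤ Y t ω) (ha0 : ∀ t, 0 ≤ a t) (ha : Summable a)
    (hQ : ∀ t, ∫⁻ ω, ENNReal.ofReal (Y t ω) ∂P ≤ ENNReal.ofReal Q) :
    ∀ᵐ ω ∂P, Summable fun t => a t * Y t ω := by
  have hfin : ∫⁻ ω, ∑' t, ENNReal.ofReal (a t * Y t ω) ∂P < ∞ := by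
    rw [lintegral_tsum fun t => ((hY t).const_mul _).ennreal_ofReal.aemeasurable]
    calc ∑' t, ∫⁻ ω, ENNReal.ofReal (a t * Y t ω) ∂P
        ≤ ∑' t, ENNReal.ofReal (a t) * ENNReal.ofReal Q := by
          refine ENNReal.tsum_le_tsum fun t => ?_
          simp_rw [ENNReal.ofReal_mul (ha0 t)]
          rw [lintegral_const_mul _ (hY t).ennreal_ofReal]
          gcongr
          exact hQ t
      _ = ENNReal.ofReal (∑' t, a t) * ENNReal.ofReal Q := by
          rw [ENNReal.tsum_mul_right, ENNReal.ofReal_tsum_of_nonneg ha0 ha]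
      _ < ∞ := ENNReal.mul_lt_top ENNReal.ofReal_lt_top ENNReal.ofReal_lt_top
  filter_upwards [ae_lt_top (Measurable.tsum
    fun t => ((hY t).const_mul _).ennreal_ofReal) hfin.ne] with ω hω
  refine (ENNReal.summable_toReal hω.ne).congr fun t => ?_
  rw [ENNReal.toReal_ofReal (mul_nonneg (ha0 t) (hY0 t ω))]

variable {E Z : Type*} [NormedAddCommGroup E] [InnerProductSpace ℝ E] [CompleteSpace E]
  [MeasurableSpace E] [MeasurableSpace Z] {K : Kernel (E × Z) Z} [IsMarkovKernel K]
  {F : Z → E → E} {γ : ℕ → ℝ} {w : ℕ → Ω → E} {z : ℕ → Ω → Z}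

namespace IsSARun

lemma measurable_state (h : IsSARun P ℱ K F γ w z) (t : ℕ) :
    Measurable[ℱ t] fun ω => (w t ω, z t ω) :=
  (h.measurable_param t).prodMk (h.measurable_obs t)

lemma measurable_state' (h : IsSARun P ℱ K F γ w z) (t : ℕ) :
    Measurable fun ω => (w t ω, z t ω) := (h.measurable_state t).mono (ℱ.le t) le_rfl

lemma measurable_obs' (h : IsSARun P ℱ K F γ w z) (t : ℕ) : Measurable (z t) :=
  (h.measurable_obs t).mono (ℱ.le t) le_rfl

/-- The joint law of the state at time `t` and the next observation, on an event of the past. -/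
lemma map_restrict_eq_compProd (h : IsSARun P ℱ K F γ w z) (t : ℕ) {B : Set Ω}
    (hB : MeasurableSet[ℱ t] B) :
    (P.restrict B).map (fun ω => ((w t ω, z t ω), z (t + 1) ω)) =
      ((P.restrict B).map fun ω => (w t ω, z t ω)) ⊗ₘ K := by
  have hy := h.measurable_state' t
  have hz := h.measurable_obs' (t + 1)
  refine Measure.ext_prod fun {C A} hC hA => ?_
  have hs : MeasurableSet[ℱ t] ((fun ω => (w t ω, z t ω)) ⁻¹' C ∩ B) :=
    (h.measurable_state t hC).inter hB
  set s : Set Ω := (fun ω => (w t ω, z t ω)) ⁻¹' C ∩ B with hsdef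
  have hzA : MeasurableSet (z (t + 1) ⁻¹' A) := hz hA
  rw [Measure.map_apply (hy.prodMk hz) (hC.prod hA), Measure.compProd_apply_prod hC hA,
    setLIntegral_map hC (K.measurable_coe hA) hy, Measure.restrict_restrict (hy hC),
    Measure.restrict_apply ((hy.prodMk hz) (hC.prod hA))]
  have e1 : (fun ω => ((w t ω, z t ω), z (t + 1) ω)) ⁻¹' C ×ˢ A ∩ B = s ∩ z (t + 1) ⁻¹' A := by
    ext ω; simp [hsdef]; tauto
  rw [e1, ← hsdef]
  have hint : Integrable ((z (t + 1) ⁻¹' A).indicator fun _ => (1 : ℝ)) P :=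
    (integrable_const 1).indicator hzA
  have h1 := setIntegral_condExp (ℱ.le t) hint hs
  rw [setIntegral_congr_ae (ℱ.le t _ hs) ((h.draw t A hA).mono fun ω hω _ => hω),
    setIntegral_indicator hzA, setIntegral_const, smul_eq_mul, mul_one] at h1
  have h2 : ∫⁻ ω in s, (K (w t ω, z t ω)) A ∂P = ENNReal.ofReal (∫ ω in s, (K (w t ω, z t ω)).real A ∂P) := by
    rw [ofReal_integral_eq_lintegral_ofReal]
    · refine lintegral_congr fun ω => ?_
      rw [ofReal_measureReal]
    · refine Integrable.of_bound (C := 1) (((K.measurable_coe hA).comp hy).ennreal_toReal).aestronglyMeasurable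
        (ae_of_all _ fun ω => ?_)
      rw [Real.norm_of_nonneg measureReal_nonneg]
      exact measureReal_le_one
    · exact ae_of_all _ fun ω => measureReal_nonneg
  rw [h2, h1, ofReal_measureReal]

lemma setLIntegral_obs (h : IsSARun P ℱ K F γ w z) (t : ℕ) {B : Set Ω}
    (hB : MeasurableSet[ℱ t] B) {φ : Z → ℝ≥0∞} (hφ : Measurable φ) :
    ∫⁻ ω in B, φ (z (t + 1) ω) ∂P = ∫⁻ ω in B, ∫⁻ z', φ z' ∂K (w t ω, z t ω) ∂P := by
  have hy := h.measurable_state' t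
  have hz := h.measurable_obs' (t + 1)
  have h1 := lintegral_map (μ := P.restrict B) (f := fun x : (E × Z) × Z => φ x.2)
    (hφ.comp measurable_snd) (hy.prodMk hz)
  rw [h.map_restrict_eq_compProd t hB, Measure.lintegral_compProd (f := fun x => φ x.2)
      (hφ.comp measurable_snd),
    lintegral_map (Measurable.lintegral_kernel hφ) hy] at h1
  exact h1.symm

/-- The parameter `w t` is known at time `t`, so only the new observation is averaged. With `B`
ranging over past events, this is the martingale difference property of `G(w_t, z_{t+1}) - K G(w_t,
z_t)`. -/
lemma setIntegral_obs (h : IsSARun P ℱ K F γ w z) (t : ℕ) {B : Set Ω}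
    (hB : MeasurableSet[ℱ t] B) {G : E × Z → E} (hG : StronglyMeasurable G)
    (hi : IntegrableOn (fun ω => G (w t ω, z (t + 1) ω)) B P) :
    ∫ ω in B, G (w t ω, z (t + 1) ω) ∂P =
      ∫ ω in B, ∫ z', G (w t ω, z') ∂K (w t ω, z t ω) ∂P := by
  have hy := h.measurable_state' t
  have hz := h.measurable_obs' (t + 1)
  set φ : (E × Z) × Z → E := fun x => G (x.1.1, x.2) with hφ
  have hφm : StronglyMeasurable φ :=
    hG.comp_measurable (g := fun x : (E × Z) × Z => (x.1.1, x.2)) (by fun_prop)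
  have hiφ : Integrable φ ((P.restrict B).map fun ω => ((w t ω, z t ω), z (t + 1) ω)) :=
    (integrable_map_measure hφm.aestronglyMeasurable (hy.prodMk hz).aemeasurable).2 hi
  have h1 := integral_map (hy.prodMk hz).aemeasurable (μ := P.restrict B) (f := φ)
    hφm.aestronglyMeasurable
  rw [h.map_restrict_eq_compProd t hB] at h1 hiφ
  rw [Measure.integral_compProd hiφ, integral_map hy.aemeasurable
    (hφm.integral_kernel_prod_right').aestronglyMeasurable] at h1
  exact h1.symm

end IsSARun

end Noise

/-! ### Convergence of the noise series and of the algorithm. -/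

section Convergence

/-- Pathwise convergence of the noise series, from the convergence of the martingale part and the
summability of the remainders. -/
lemma exists_tendsto_sum_noise {E : Type*} [NormedAddCommGroup E] [NormedSpace ℝ E]
    [CompleteSpace E] {γ v : ℕ → ℝ} (hγ : LearningRates γ) {g h h' : ℕ → E} {A c : ℝ}
    (hv : ∀ t, 1 ≤ v t) (hA : 0 ≤ A) (hh : ∀ t, ‖h (t + 1)‖ ≤ A * v t)
    (hh' : ∀ t, ‖h (t + 1) - h' t‖ ≤ A * v t * (γ (t + 1) * (c * v t)))
    (hsq : Summable fun t => γ (t + 1) ^ 2 * v t ^ 2)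
    (hdiff : Summable fun t => (γ (t + 1) - γ (t + 2)) * v t ^ 2)
    (hmart : ∃ s, Tendsto (fun n => ∑ t ∈ Finset.range n, γ (t + 1) • (g t - h t)) atTop (𝓝 s)) :
    ∃ s, Tendsto (fun n => ∑ t ∈ Finset.range n, γ (t + 1) • (g t - h' t)) atTop (𝓝 s) := by
  obtain ⟨s₁, hs₁⟩ := hmart
  have hγ0 : ∀ t, 0 ≤ γ (t + 1) - γ (t + 2) := fun t => sub_nonneg.2 (hγ.anti (by omega))
  have hsum₂ : Summable fun t => γ (t + 1) • (h (t + 1) - h' t) := by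
    refine Summable.of_norm_bounded (hsq.mul_left (A * c)) fun t => ?_
    rw [norm_smul, Real.norm_of_nonneg (hγ.pos _).le]
    calc γ (t + 1) * ‖h (t + 1) - h' t‖ ≤ γ (t + 1) * (A * v t * (γ (t + 1) * (c * v t))) :=
          mul_le_mul_of_nonneg_left (hh' t) (hγ.pos _).le
      _ = _ := by ring
  have hsum₃ : Summable fun t => (γ (t + 1) - γ (t + 2)) • h (t + 1) := by
    refine Summable.of_norm_bounded (hdiff.mul_left A) fun t => ?_
    rw [norm_smul, Real.norm_of_nonneg (hγ0 t)]
    have hvt := hv t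
    calc (γ (t + 1) - γ (t + 2)) * ‖h (t + 1)‖ ≤ (γ (t + 1) - γ (t + 2)) * (A * v t ^ 2) := by
          refine mul_le_mul_of_nonneg_left ((hh t).trans ?_) (hγ0 t)
          gcongr
          nlinarith
      _ = _ := by ring
  -- The boundary term is of size `γ v`, whose square is the general term of a convergent series.
  have htel : Tendsto (fun n => γ (n + 1) • h n) atTop (𝓝 0) := by
    rw [← tendsto_add_atTop_iff_nat 1]
    have hlim : Tendsto (fun t => A * √(γ (t + 1) ^ 2 * v t ^ 2)) atTop (𝓝 0) := by
      have := (hsq.tendsto_atTop_zero.sqrt).const_mul A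
      simpa using this
    refine squeeze_zero_norm (fun t => ?_) hlim
    rw [norm_smul, Real.norm_of_nonneg (hγ.pos _).le, ← mul_pow,
      Real.sqrt_sq (mul_nonneg (hγ.pos _).le (zero_le_one.trans (hv t)))]
    calc γ (t + 1 + 1) * ‖h (t + 1)‖ ≤ γ (t + 1) * (A * v t) :=
          mul_le_mul (hγ.anti (by omega)) (hh t) (norm_nonneg _) (hγ.pos _).le
      _ = _ := by ring
  -- `g t - h' t = (g t - h t) + (h (t+1) - h' t) + (h t - h (t+1))`, with Abel summation applied to
  -- the last bracket.
  have hdec : ∀ n, ∑ t ∈ Finset.range n, γ (t + 1) • (g t - h' t) =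
      ∑ t ∈ Finset.range n, γ (t + 1) • (g t - h t) +
      ∑ t ∈ Finset.range n, γ (t + 1) • (h (t + 1) - h' t) -
      ∑ t ∈ Finset.range n, (γ (t + 1) - γ (t + 2)) • h (t + 1) +
      (γ 1 • h 0 - γ (n + 1) • h n) := by
    intro n
    induction n with
    | zero => simp
    | succ n ih =>
      rw [Finset.sum_range_succ, Finset.sum_range_succ, Finset.sum_range_succ,
        Finset.sum_range_succ, ih, smul_sub (γ (n + 1)) (g n) (h' n),
        smul_sub (γ (n + 1)) (g n) (h n), smul_sub (γ (n + 1)) (h (n + 1)) (h' n), sub_smul,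
        show n + 1 + 1 = n + 2 from rfl]
      abel
  refine ⟨s₁ + ∑' t, γ (t + 1) • (h (t + 1) - h' t) - ∑' t, (γ (t + 1) - γ (t + 2)) • h (t + 1) +
    (γ 1 • h 0 - 0), ?_⟩
  simp_rw [hdec]
  exact ((hs₁.add hsum₂.hasSum.tendsto_sum_nat).sub hsum₃.hasSum.tendsto_sum_nat).add
    (tendsto_const_nhds.sub htel)

lemma LearningRates.tendsto_zero {γ : ℕ → ℝ} (hγ : LearningRates γ) : Tendsto γ atTop (𝓝 0) := by
  have := hγ.sum_sq.tendsto_atTop_zero.sqrt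
  simpa [Real.sqrt_sq (hγ.pos _).le] using this

lemma LearningRates.summable_sub {γ : ℕ → ℝ} (hγ : LearningRates γ) :
    Summable fun t => γ (t + 1) - γ (t + 2) := by
  refine summable_of_sum_range_le (c := γ 1) (fun t => sub_nonneg.2 (hγ.anti (by omega))) fun n => ?_
  have : ∑ t ∈ Finset.range n, (γ (t + 1) - γ (t + 2)) = γ 1 - γ (n + 1) :=
    Finset.sum_range_sub' (fun t => γ (t + 1)) n
  rw [this]
  linarith [hγ.pos (n + 1)]

variable {Ω : Type*} {mΩ : MeasurableSpace Ω} {P : Measure Ω} [IsProbabilityMeasure P]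
  {ℱ : Filtration ℕ mΩ}
  {E Z : Type*} [NormedAddCommGroup E] [InnerProductSpace ℝ E] [FiniteDimensional ℝ E]
  [MeasurableSpace E] [BorelSpace E] [MeasurableSpace Z] {K : Kernel (E × Z) Z} [IsMarkovKernel K]
  {F : Z → E → E} {γ : ℕ → ℝ} {w : ℕ → Ω → E} {z : ℕ → Ω → Z}

/-- The event that the parameters have stayed in `S` up to time `t`, from an initial observation
with `V ≤ N`. -/
def stayEvent (S : Set E) (V : Z → ℝ) (w : ℕ → Ω → E) (z : ℕ → Ω → Z) (N : ℕ) (t : ℕ) : Set Ω :=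
  {ω | V (z 0 ω) ≤ N} ∩ ⋂ s ∈ Finset.range (t + 1), w s ⁻¹' S

namespace IsSARun

variable {S : Set E} {V : Z → ℝ} {N : ℕ}

lemma measurableSet_stayEvent (h : IsSARun P ℱ K F γ w z) (hS : MeasurableSet S)
    (hV : Measurable V) (N t : ℕ) : MeasurableSet[ℱ t] (stayEvent S V w z N t) := by
  have h0 : Measurable[ℱ t] fun ω => V (z 0 ω) :=
    (hV.comp (h.measurable_obs 0)).mono (ℱ.mono (Nat.zero_le t)) le_rfl
  refine MeasurableSet.inter (h0 measurableSet_Iic) ?_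
  refine Finset.measurableSet_biInter _ fun s hs => ?_
  exact ℱ.mono (Nat.lt_succ_iff.1 (Finset.mem_range.1 hs)) _ (h.measurable_param s hS)

lemma stayEvent_succ_subset (t : ℕ) :
    stayEvent S V w z N (t + 1) ⊆ stayEvent S V w z N t := by
  rintro ω ⟨h0, h1⟩
  refine ⟨h0, ?_⟩
  simp only [Set.mem_iInter, Finset.mem_range] at h1 ⊢
  exact fun s hs => h1 s (by omega)

lemma param_mem_of_mem_stayEvent {t : ℕ} {ω : Ω} (hω : ω ∈ stayEvent S V w z N t) : w t ω ∈ S := by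
  have := hω.2
  simp only [Set.mem_iInter, Finset.mem_range] at this
  exact this t (by omega)

/-- Second moments of `V` along the run stay bounded as long as the parameters stay in `S`. -/
lemma exists_moment_bound (h : IsSARun P ℱ K F γ w z) (hS : MeasurableSet S)
    (hV : Measurable V) (hV1 : ∀ z, 1 ≤ V z) {ρ b : ℝ} (hρ : 0 < ρ) (hρ1 : ρ < 1) (hb : 0 ≤ b)
    (hdrift : ∀ w ∈ S, ∀ z, ∫⁻ z', ENNReal.ofReal (V z' ^ 2) ∂(K (w, z)) ≤
      ENNReal.ofReal (ρ * V z ^ 2 + b)) (N : ℕ) :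
    ∃ Q : ℝ, 0 ≤ Q ∧
      (∀ t, ∫⁻ ω in stayEvent S V w z N t, ENNReal.ofReal (V (z t ω) ^ 2) ∂P ≤ ENNReal.ofReal Q) ∧
      ∀ t, ∫⁻ ω in stayEvent S V w z N t, ENNReal.ofReal (V (z (t + 1) ω) ^ 2) ∂P ≤
        ENNReal.ofReal Q := by
  have h1ρ : 0 < 1 - ρ := by linarith
  -- Bounds the initial second moment and is preserved by the drift: `ρQ + b ≤ Q`.
  set Q : ℝ := (N : ℝ) ^ 2 + b / (1 - ρ) with hQ
  have hQ0 : 0 ≤ Q := by positivity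
  have hQstep : ρ * Q + b ≤ Q := by
    have : ρ * Q + b = ρ * (N : ℝ) ^ 2 + b / (1 - ρ) := by rw [hQ]; field_simp; ring
    rw [this, hQ]
    gcongr
    exact mul_le_of_le_one_left (sq_nonneg _) hρ1.le
  have hVm : Measurable fun z => ENNReal.ofReal (V z ^ 2) := by fun_prop
  have hstep : ∀ t, ∫⁻ ω in stayEvent S V w z N t, ENNReal.ofReal (V (z t ω) ^ 2) ∂P ≤
      ENNReal.ofReal Q →
      ∫⁻ ω in stayEvent S V w z N t, ENNReal.ofReal (V (z (t + 1) ω) ^ 2) ∂P ≤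
        ENNReal.ofReal Q := by
    intro t ht
    have hm := h.measurableSet_stayEvent hS hV N t
    rw [h.setLIntegral_obs t hm hVm]
    calc ∫⁻ ω in stayEvent S V w z N t, ∫⁻ z', ENNReal.ofReal (V z' ^ 2) ∂K (w t ω, z t ω) ∂P
        ≤ ∫⁻ ω in stayEvent S V w z N t,
            (ENNReal.ofReal ρ * ENNReal.ofReal (V (z t ω) ^ 2) + ENNReal.ofReal b) ∂P := by
          refine setLIntegral_mono' (ℱ.le t _ hm) fun ω hω => ?_
          refine (hdrift _ (param_mem_of_mem_stayEvent hω) _).trans (le_of_eq ?_)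
          rw [ENNReal.ofReal_add (by positivity) hb, ENNReal.ofReal_mul hρ.le]
      _ ≤ ENNReal.ofReal ρ * ENNReal.ofReal Q + ENNReal.ofReal b := by
          rw [lintegral_add_right _ measurable_const,
            lintegral_const_mul (f := fun ω => ENNReal.ofReal (V (z t ω) ^ 2)) _
              (hVm.comp (h.measurable_obs' t))]
          gcongr
          rw [setLIntegral_const]
          exact mul_le_of_le_one_right' prob_le_one
      _ = ENNReal.ofReal (ρ * Q + b) := by
          rw [ENNReal.ofReal_add (by positivity) hb, ENNReal.ofReal_mul hρ.le]
      _ ≤ ENNReal.ofReal Q := ENNReal.ofReal_le_ofReal hQstep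
  have hall : ∀ t, ∫⁻ ω in stayEvent S V w z N t, ENNReal.ofReal (V (z t ω) ^ 2) ∂P ≤
      ENNReal.ofReal Q := by
    intro t
    induction t with
    | zero =>
      calc ∫⁻ ω in stayEvent S V w z N 0, ENNReal.ofReal (V (z 0 ω) ^ 2) ∂P
          ≤ ∫⁻ _ in stayEvent S V w z N 0, ENNReal.ofReal Q ∂P := by
            refine setLIntegral_mono' (ℱ.le 0 _ (h.measurableSet_stayEvent hS hV N 0)) fun ω hω => ?_
            apply ENNReal.ofReal_le_ofReal
            have h1 : V (z 0 ω) ≤ N := hω.1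
            have h2 : V (z 0 ω) ^ 2 ≤ (N : ℝ) ^ 2 := by
              have := hV1 (z 0 ω)
              gcongr
            have : 0 ≤ b / (1 - ρ) := by positivity
            linarith
        _ ≤ ENNReal.ofReal Q := by
            rw [setLIntegral_const]
            exact mul_le_of_le_one_right' prob_le_one
    | succ t ih =>
      exact (lintegral_mono_set (stayEvent_succ_subset t)).trans (hstep t ih)
  exact ⟨Q, hQ0, hall, fun t => hstep t (hall t)⟩

/-- Almost sure convergence of the martingale part of the noise. -/
lemma ae_exists_tendsto_martingale_part (h : IsSARun P ℱ K F γ w z) (hS : MeasurableSet S)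
    (hγ : LearningRates γ) (hV : Measurable V) (hV1 : ∀ z, 1 ≤ V z) {A Q : ℝ}
    {f : E → E} {G : E × Z → E} (hG : PoissonFamily S K F f V A G) (hQ : 0 ≤ Q)
    (hQ1 : ∀ t, ∫⁻ ω in stayEvent S V w z N t, ENNReal.ofReal (V (z t ω) ^ 2) ∂P ≤
      ENNReal.ofReal Q)
    (hQ2 : ∀ t, ∫⁻ ω in stayEvent S V w z N t, ENNReal.ofReal (V (z (t + 1) ω) ^ 2) ∂P ≤
      ENNReal.ofReal Q) :
    ∀ᵐ ω ∂P, (∀ t, ω ∈ stayEvent S V w z N t) →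
      ∃ s, Tendsto (fun n => ∑ t ∈ Finset.range n, γ (t + 1) •
        (G (w t ω, z (t + 1) ω) - ∫ z', G (w t ω, z') ∂K (w t ω, z t ω))) atTop (𝓝 s) := by
  set D : ℕ → Ω → E := fun t ω =>
    G (w t ω, z (t + 1) ω) - ∫ z', G (w t ω, z') ∂K (w t ω, z t ω) with hD
  set B : ℕ → Set Ω := stayEvent S V w z N with hB
  have hBm : ∀ t, MeasurableSet[ℱ t] (B t) := h.measurableSet_stayEvent hS hV N
  have hBm' : ∀ t, MeasurableSet (B t) := fun t => ℱ.le t _ (hBm t)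
  have hH : StronglyMeasurable fun y : E × Z => ∫ z', G (y.1, z') ∂K y := by
    have : StronglyMeasurable fun x : (E × Z) × Z => G (x.1.1, x.2) :=
      hG.stronglyMeasurable.comp_measurable (by fun_prop)
    exact this.integral_kernel_prod_right'
  have hGm : ∀ t, StronglyMeasurable[ℱ (t + 1)] fun ω => G (w t ω, z (t + 1) ω) := fun t =>
    hG.stronglyMeasurable.comp_measurable
      (((h.measurable_param t).mono (ℱ.mono (Nat.le_succ t)) le_rfl).prodMk (h.measurable_obs (t + 1)))
  have hHm : ∀ t, StronglyMeasurable[ℱ t] fun ω => ∫ z', G (w t ω, z') ∂K (w t ω, z t ω) := fun t =>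
    hH.comp_measurable (h.measurable_state t)
  have hDm : ∀ t, StronglyMeasurable[ℱ (t + 1)] (D t) := fun t =>
    (hGm t).sub ((hHm t).mono (ℱ.mono (Nat.le_succ t)))
  have hsq1 : ∀ t, IntegrableOn (fun ω => V (z t ω) ^ 2) (B t) P := fun t =>
    integrable_sq_of_drift (V := fun ω => V (z t ω)) (hV.comp (h.measurable_obs' t)) (hQ1 t)
  have hsq2 : ∀ t, IntegrableOn (fun ω => V (z (t + 1) ω) ^ 2) (B t) P := fun t =>
    integrable_sq_of_drift (V := fun ω => V (z (t + 1) ω)) (hV.comp (h.measurable_obs' _)) (hQ2 t)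
  have hle1 : ∀ t, ∫ ω in B t, V (z t ω) ^ 2 ∂P ≤ Q := fun t =>
    integral_sq_le_of_drift (V := fun ω => V (z t ω)) (hV.comp (h.measurable_obs' t)) hQ (hQ1 t)
  have hle2 : ∀ t, ∫ ω in B t, V (z (t + 1) ω) ^ 2 ∂P ≤ Q := fun t =>
    integral_sq_le_of_drift (V := fun ω => V (z (t + 1) ω)) (hV.comp (h.measurable_obs' _)) hQ (hQ2 t)
  have hGi : ∀ t, IntegrableOn (fun ω => G (w t ω, z (t + 1) ω)) (B t) P := by
    intro t
    refine ((integrable_of_integrable_sq (V := fun ω => V (z (t + 1) ω))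
      (hV.comp (h.measurable_obs' _)) (fun ω => hV1 _) (hsq2 t)).const_mul A).mono'
      ((hGm t).mono (ℱ.le _)).aestronglyMeasurable ?_
    filter_upwards [ae_restrict_mem (hBm' t)] with ω hω
    exact hG.bound _ (param_mem_of_mem_stayEvent hω) _
  have hHi : ∀ t, IntegrableOn (fun ω => ∫ z', G (w t ω, z') ∂K (w t ω, z t ω)) (B t) P := by
    intro t
    refine ((integrable_of_integrable_sq (V := fun ω => V (z t ω))
      (hV.comp (h.measurable_obs' _)) (fun ω => hV1 _) (hsq1 t)).const_mul A).mono'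
      ((hHm t).mono (ℱ.le _)).aestronglyMeasurable ?_
    filter_upwards [ae_restrict_mem (hBm' t)] with ω hω
    exact hG.bound_integral _ (param_mem_of_mem_stayEvent hω) _
  have hDi : ∀ t, IntegrableOn (D t) (B t) P := fun t => (hGi t).sub (hHi t)
  have hDbound : ∀ t ω, ω ∈ B t →
      ‖D t ω‖ ^ 2 ≤ 2 * A ^ 2 * (V (z (t + 1) ω) ^ 2 + V (z t ω) ^ 2) := by
    intro t ω hω
    have h1 := hG.bound _ (param_mem_of_mem_stayEvent hω) (z (t + 1) ω)
    have h2 := hG.bound_integral _ (param_mem_of_mem_stayEvent hω) (z t ω)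
    have h3 : ‖D t ω‖ ≤ A * V (z (t + 1) ω) + A * V (z t ω) :=
      (norm_sub_le _ _).trans (add_le_add h1 h2)
    have h4 : ‖D t ω‖ ^ 2 ≤ (A * V (z (t + 1) ω) + A * V (z t ω)) ^ 2 := by gcongr
    nlinarith [sq_nonneg (A * V (z (t + 1) ω) - A * V (z t ω))]
  have hsq12 : ∀ t, IntegrableOn
      (fun ω => 2 * A ^ 2 * (V (z (t + 1) ω) ^ 2 + V (z t ω) ^ 2)) (B t) P := fun t =>
    ((hsq2 t).add (hsq1 t)).const_mul _
  set β := stdOrthonormalBasis ℝ E with hβ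
  -- Real martingale convergence is applied to each coordinate. The indicator of `B t` is known at
  -- time `t`, so it preserves the martingale property and makes the increments square integrable;
  -- on paths that stay in `S` it equals one.
  have hcoord : ∀ i, ∀ᵐ ω ∂P, ∃ s, Tendsto (fun n => ∑ t ∈ Finset.range n,
      (B t).indicator (fun ω => γ (t + 1) * inner ℝ (β i) (D t ω)) ω) atTop (𝓝 s) := by
    intro i
    have hdm : ∀ t, StronglyMeasurable[ℱ (t + 1)]
        ((B t).indicator (fun ω => γ (t + 1) * inner ℝ (β i) (D t ω))) := fun t =>
      (StronglyMeasurable.const_mul ((stronglyMeasurable_const (b := β i)).inner (hDm t))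
        (γ (t + 1))).indicator (ℱ.mono (Nat.le_succ t) _ (hBm t))
    have hsqeq : ∀ t ω, (B t).indicator (fun ω => γ (t + 1) * inner ℝ (β i) (D t ω)) ω ^ 2 ≤
        (B t).indicator (fun ω => γ (t + 1) ^ 2 *
          (2 * A ^ 2 * (V (z (t + 1) ω) ^ 2 + V (z t ω) ^ 2))) ω := by
      intro t ω
      by_cases hω : ω ∈ B t
      · rw [Set.indicator_of_mem hω, Set.indicator_of_mem hω, mul_pow]
        refine mul_le_mul_of_nonneg_left (le_trans ?_ (hDbound t ω hω)) (sq_nonneg _)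
        have h1 : |inner ℝ (β i) (D t ω)| ≤ ‖D t ω‖ := by
          simpa using abs_real_inner_le_norm (β i) (D t ω)
        rw [← sq_abs]
        gcongr
      · simp [hω]
    have hbdint : ∀ t, Integrable ((B t).indicator (fun ω => γ (t + 1) ^ 2 *
          (2 * A ^ 2 * (V (z (t + 1) ω) ^ 2 + V (z t ω) ^ 2)))) P := fun t =>
      (integrable_indicator_iff (hBm' t)).2 ((hsq12 t).const_mul _)
    have hdsq : ∀ t, Integrable (fun ω =>
        (B t).indicator (fun ω => γ (t + 1) * inner ℝ (β i) (D t ω)) ω ^ 2) P := fun t =>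
      (hbdint t).mono' (((hdm t).mono (ℱ.le _)).aestronglyMeasurable.pow 2) (ae_of_all _ fun ω => by
        rw [Real.norm_of_nonneg (sq_nonneg _)]; exact hsqeq t ω)
    refine ae_exists_tendsto_sum_of_martingale_differences (ℱ := ℱ)
      (a := fun t => γ (t + 1) ^ 2 * (4 * A ^ 2 * Q)) hdm
      (fun t => (memLp_two_iff_integrable_sq ((hdm t).mono (ℱ.le _)).aestronglyMeasurable).2 (hdsq t))
      (fun t => ?_) (((summable_nat_add_iff 1).2 hγ.sum_sq).mul_right _) (fun t => ?_)
    · have hdi : Integrable ((B t).indicator (fun ω => γ (t + 1) * inner ℝ (β i) (D t ω))) P :=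
        (integrable_indicator_iff (hBm' t)).2 (((hDi t).const_inner (β i)).const_mul _)
      refine (ae_eq_condExp_of_forall_setIntegral_eq (ℱ.le t) hdi
        (fun s _ _ => integrableOn_zero) (fun s hs _ => ?_) aestronglyMeasurable_zero).symm
      have hsB : MeasurableSet[ℱ t] (s ∩ B t) := hs.inter (hBm t)
      have hsub : s ∩ B t ⊆ B t := Set.inter_subset_right
      have hDzero : ∫ ω in s ∩ B t, D t ω ∂P = 0 := by
        rw [integral_sub ((hGi t).mono_set hsub) ((hHi t).mono_set hsub),
          h.setIntegral_obs t hsB hG.stronglyMeasurable ((hGi t).mono_set hsub), sub_self]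
      rw [setIntegral_indicator (hBm' t), integral_const_mul,
        integral_inner ((hDi t).mono_set hsub), hDzero]
      simp
    · calc ∫ ω, (B t).indicator (fun ω => γ (t + 1) * inner ℝ (β i) (D t ω)) ω ^ 2 ∂P
          ≤ ∫ ω, (B t).indicator (fun ω => γ (t + 1) ^ 2 *
              (2 * A ^ 2 * (V (z (t + 1) ω) ^ 2 + V (z t ω) ^ 2))) ω ∂P :=
            integral_mono (hdsq t) (hbdint t) (hsqeq t)
        _ ≤ _ := by
            rw [integral_indicator (hBm' t), integral_const_mul, integral_const_mul,
              integral_add (hsq2 t) (hsq1 t)]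
            refine mul_le_mul_of_nonneg_left ?_ (sq_nonneg _)
            nlinarith [mul_le_mul_of_nonneg_left (add_le_add (hle2 t) (hle1 t)) (sq_nonneg A)]
  filter_upwards [ae_all_iff.2 hcoord] with ω hω hstay
  choose s hs using hω
  refine ⟨∑ i, s i • β i, ?_⟩
  have heq : ∀ n, ∑ t ∈ Finset.range n, γ (t + 1) • D t ω =
      ∑ i, (∑ t ∈ Finset.range n,
        (B t).indicator (fun ω => γ (t + 1) * inner ℝ (β i) (D t ω)) ω) • β i := by
    intro n
    rw [← β.sum_repr' (∑ t ∈ Finset.range n, γ (t + 1) • D t ω)]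
    refine Finset.sum_congr rfl fun i _ => ?_
    rw [inner_sum]
    congr 1
    refine Finset.sum_congr rfl fun t _ => ?_
    rw [Set.indicator_of_mem (hstay t), inner_smul_right]
  exact (tendsto_finsetSum _ fun i _ => (hs i).smul_const (β i)).congr fun n => (heq n).symm

end IsSARun

/-- **Convergence of stochastic approximation with Markovian observations.** -/
theorem IsSARun.ae_tendsto_infDist (h : IsSARun P ℱ K F γ w z) {S : Set E} (hS : IsCompact S)
    {p : E → Measure Z} (hp : ∀ w ∈ S, IsProbabilityMeasure (p w))
    (hinv : ∀ w ∈ S, (K.sectR w).Invariant (p w))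
    (hFm : ∀ w ∈ S, StronglyMeasurable fun z => F z w) (hdrift : DriftCondition S K F)
    (hlyap : LyapunovCondition S (meanField p F)) (hγ : LearningRates γ) :
    ∀ᵐ ω ∂P, (∀ t, w t ω ∈ S) →
      Tendsto (fun t => Metric.infDist (w t ω) {w ∈ S | meanField p F w = 0}) atTop (𝓝 0) := by
  rcases S.eq_empty_or_nonempty with rfl | hne
  · exact ae_of_all _ fun ω hω => absurd (hω 0) (Set.notMem_empty _)
  obtain ⟨V, ρ, b, c, hV, hV1, hρ, hρ1, hb, hc, hdr, hF, A, G, hA, hG⟩ :=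
    exists_poissonFamily hS.measurableSet hne hp hinv hFm hdrift
  have hall : ∀ N : ℕ, ∀ᵐ ω ∂P, (∀ t, ω ∈ stayEvent S V w z N t) →
      ∃ s, Tendsto (fun n => ∑ t ∈ Finset.range n, γ (t + 1) •
        (F (z (t + 1) ω) (w t ω) - meanField p F (w t ω))) atTop (𝓝 s) := by
    intro N
    obtain ⟨Q, hQ, hQ1, hQ2⟩ := h.exists_moment_bound hS.measurableSet hV hV1 hρ hρ1 hb hdr N
    have hBm : ∀ t, MeasurableSet (stayEvent S V w z N t) := fun t =>
      ℱ.le t _ (h.measurableSet_stayEvent hS.measurableSet hV N t)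
    -- Bounded means of `V²` on the stay events make both `∑ γ² V²` and `∑ (γ_{t+1} - γ_{t+2}) V²`
    -- finite almost surely.
    set Y : ℕ → Ω → ℝ := fun t =>
      (stayEvent S V w z N t).indicator fun ω => V (z (t + 1) ω) ^ 2 with hY
    have hYm : ∀ t, Measurable (Y t) := fun t =>
      ((hV.comp (h.measurable_obs' _)).pow_const 2).indicator (hBm t)
    have hY0 : ∀ t ω, 0 ≤ Y t ω := fun t ω => Set.indicator_nonneg (fun _ _ => sq_nonneg _) _
    have hYQ : ∀ t, ∫⁻ ω, ENNReal.ofReal (Y t ω) ∂P ≤ ENNReal.ofReal Q := by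
      intro t
      refine le_trans (le_of_eq ?_) (hQ2 t)
      rw [← lintegral_indicator (hBm t)]
      refine lintegral_congr fun ω => ?_
      by_cases hω : ω ∈ stayEvent S V w z N t <;> simp [hY, hω]
    filter_upwards [h.ae_exists_tendsto_martingale_part hS.measurableSet hγ hV hV1 hG hQ hQ1 hQ2,
      ae_summable_mul_of_lintegral_le hYm hY0 (fun t => sq_nonneg (γ (t + 1)))
        ((summable_nat_add_iff 1).2 hγ.sum_sq) hYQ,
      ae_summable_mul_of_lintegral_le hYm hY0 (fun t => sub_nonneg.2 (hγ.anti (by omega)))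
        hγ.summable_sub hYQ] with ω h1 h2 h3 hstay
    have hYω : ∀ t, Y t ω = V (z (t + 1) ω) ^ 2 := fun t => Set.indicator_of_mem (hstay t) _
    simp_rw [hYω] at h2 h3
    have hw : ∀ t, w t ω ∈ S := fun t => param_mem_of_mem_stayEvent (hstay t)
    have key := exists_tendsto_sum_noise hγ (v := fun t => V (z (t + 1) ω))
      (g := fun t => G (w t ω, z (t + 1) ω))
      (h := fun t => ∫ z', G (w t ω, z') ∂K (w t ω, z t ω))
      (h' := fun t => ∫ z', G (w t ω, z') ∂K (w t ω, z (t + 1) ω)) (A := A) (c := c)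
      (fun t => hV1 _) hA (fun t => hG.bound_integral _ (hw (t + 1)) _)
      (fun t => by
        refine (hG.lipschitz _ (hw (t + 1)) _ (hw t) _).trans ?_
        have hV0 := hV1 (z (t + 1) ω)
        refine mul_le_mul_of_nonneg_left ?_ (by positivity)
        rw [h.update t ω, add_sub_cancel_left, norm_smul, Real.norm_of_nonneg (hγ.pos _).le]
        exact mul_le_mul_of_nonneg_left (hF _ (hw t) _) (hγ.pos _).le) h2 h3 (h1 hstay)
    simpa only [hG.eq _ (hw _)] using key
  filter_upwards [ae_all_iff.2 hall] with ω hω hw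
  -- The initialization may have infinite second moment, hence the countable exhaustion by `V (z 0)
  -- ≤ N`.
  obtain ⟨N, hN⟩ := exists_nat_ge (V (z 0 ω))
  obtain ⟨s, hs⟩ := hω N fun t => ⟨hN, by simpa using fun s _ => hw s⟩
  -- The perturbation `r` is the tail of the noise series.
  refine tendsto_infDist_of_lyapunovCondition hS hlyap hγ.pos hγ.tendsto_zero hγ.sum_eq_top
    (r := fun n => s - ∑ t ∈ Finset.range n, γ (t + 1) •
      (F (z (t + 1) ω) (w t ω) - meanField p F (w t ω))) hw ?_ fun t => ?_
  · simpa using hs.const_sub s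
  · rw [Finset.sum_range_succ, h.update t ω, smul_sub]
    abel

end Convergence

/-! ### Gradients: calculus, measurability and differentiation under the integral. -/

section GradientCalculus

variable {X : Type*} [MeasurableSpace X] {E : Type*} [NormedAddCommGroup E]
  [InnerProductSpace ℝ E] [FiniteDimensional ℝ E]

lemma norm_gradient_eq (g : E → ℝ) (θ : E) : ‖gradient g θ‖ = ‖fderiv ℝ g θ‖ :=
  (InnerProductSpace.toDual ℝ E).symm.norm_map _

lemma hasGradientAt_exp_comp {g : E → ℝ} {v θ : E} (h : HasGradientAt g v θ) :
    HasGradientAt (fun t => Real.exp (g t)) (Real.exp (g θ) • v) θ := by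
  rw [hasGradientAt_iff_hasFDerivAt] at h ⊢
  simpa using h.exp

lemma hasGradientAt_log_comp {g : E → ℝ} {v θ : E} (h : HasGradientAt g v θ) (h0 : g θ ≠ 0) :
    HasGradientAt (fun t => Real.log (g t)) ((g θ)⁻¹ • v) θ := by
  rw [hasGradientAt_iff_hasFDerivAt] at h ⊢
  simpa using h.log h0

lemma hasGradientAt_const_mul {g : E → ℝ} {v θ : E} (h : HasGradientAt g v θ) (a : ℝ) :
    HasGradientAt (fun t => a * g t) (a • v) θ := by
  rw [hasGradientAt_iff_hasFDerivAt] at h ⊢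
  simpa using h.const_mul a

lemma hasGradientAt_sub {g g' : E → ℝ} {v v' θ : E} (h : HasGradientAt g v θ)
    (h' : HasGradientAt g' v' θ) : HasGradientAt (fun t => g t - g' t) (v - v') θ := by
  rw [hasGradientAt_iff_hasFDerivAt] at h h' ⊢
  simpa using h.fun_sub h'

lemma hasGradientAt_sum {ι : Type*} (s : Finset ι) {g : ι → E → ℝ} {v : ι → E} {θ : E}
    (h : ∀ i ∈ s, HasGradientAt (g i) (v i) θ) :
    HasGradientAt (fun t => ∑ i ∈ s, g i t) (∑ i ∈ s, v i) θ := by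
  simp only [hasGradientAt_iff_hasFDerivAt] at h ⊢
  simpa using HasFDerivAt.fun_sum h

lemma gradient_eq_sum (g : E → ℝ) (θ : E) :
    gradient g θ = ∑ i, fderiv ℝ g θ (stdOrthonormalBasis ℝ E i) • stdOrthonormalBasis ℝ E i := by
  conv_lhs => rw [← (stdOrthonormalBasis ℝ E).sum_repr' (gradient g θ)]
  refine Finset.sum_congr rfl fun i _ => ?_
  rw [real_inner_comm, gradient, InnerProductSpace.toDual_symm_apply]

lemma tendsto_difference_quotient {g : E → ℝ} {θ : E} (h : DifferentiableAt ℝ g θ) (v : E) :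
    Tendsto (fun n : ℕ => (1 / ((n : ℝ) + 1))⁻¹ • (g (θ + (1 / ((n : ℝ) + 1)) • v) - g θ)) atTop
      (𝓝 (fderiv ℝ g θ v)) := by
  refine (h.hasFDerivAt.hasLineDerivAt v).tendsto_slope_zero.comp ?_
  refine tendsto_nhdsWithin_iff.2 ⟨tendsto_one_div_add_atTop_nhds_zero_nat, ?_⟩
  exact Eventually.of_forall fun n => (Nat.one_div_pos_of_nat (α := ℝ)).ne'

/-- Each coordinate of the gradient is a limit of difference quotients along the steps `1/(n+1)`;
hence measurability in `x` for each fixed parameter suffices. -/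
lemma stronglyMeasurable_gradient {g : E → X → ℝ} (hm : ∀ t, Measurable (g t)) {θ : E}
    (hd : ∀ x, DifferentiableAt ℝ (fun t => g t x) θ) :
    StronglyMeasurable fun x => gradient (fun t => g t x) θ := by
  simp_rw [gradient_eq_sum]
  refine Finset.stronglyMeasurable_fun_sum _ fun i _ => StronglyMeasurable.smul_const ?_ _
  refine (measurable_of_tendsto_metrizable (f := fun (n : ℕ) x => (1 / ((n : ℝ) + 1))⁻¹ •
    (g (θ + (1 / ((n : ℝ) + 1)) • stdOrthonormalBasis ℝ E i) x - g θ x)) (fun n => ?_)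
    (tendsto_pi_nhds.2 fun x => tendsto_difference_quotient (hd x) _)).stronglyMeasurable
  exact ((hm _).sub (hm _)).const_mul _

lemma aestronglyMeasurable_gradient {μ : Measure X} {g : E → X → ℝ}
    (hm : ∀ t, Measurable (g t)) {θ : E}
    (hd : ∀ᵐ x ∂μ, DifferentiableAt ℝ (fun t => g t x) θ) :
    AEStronglyMeasurable (fun x => gradient (fun t => g t x) θ) μ := by
  simp_rw [gradient_eq_sum]
  refine Finset.aestronglyMeasurable_fun_sum _ fun i _ => AEStronglyMeasurable.smul_const ?_ _
  refine aestronglyMeasurable_of_tendsto_ae (u := atTop) (f := fun (n : ℕ) x =>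
    (1 / ((n : ℝ) + 1))⁻¹ •
    (g (θ + (1 / ((n : ℝ) + 1)) • stdOrthonormalBasis ℝ E i) x - g θ x)) (fun n => ?_)
    (hd.mono fun x hx => tendsto_difference_quotient hx _)
  exact (((hm _).sub (hm _)).const_mul _).aestronglyMeasurable

/-- Differentiation under the integral sign on a ball of locally dominated gradients. -/
lemma hasGradientAt_integral {μ : Measure X} {g : E → X → ℝ} (hm : ∀ t, Measurable (g t)) {θ : E}
    {ε : ℝ} (hint : Integrable (g θ) μ)
    (hd : ∀ᵐ x ∂μ, ∀ t ∈ Metric.ball θ ε, DifferentiableAt ℝ (fun t => g t x) t)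
    {G : X → ℝ} (hG : Integrable G μ)
    (hb : ∀ᵐ x ∂μ, ∀ t ∈ Metric.ball θ ε, ‖gradient (fun t => g t x) t‖ ≤ G x) :
    ∀ s ∈ Metric.ball θ ε, Integrable (g s) μ ∧
      Integrable (fun x => gradient (fun t => g t x) s) μ ∧
      HasGradientAt (fun t => ∫ x, g t x ∂μ) (∫ x, gradient (fun t => g t x) s ∂μ) s := by
  intro s hs
  have hθ : θ ∈ Metric.ball θ ε := Metric.mem_ball_self (Metric.pos_of_mem_ball hs)
  have hints : Integrable (g s) μ := by
    -- The mean value inequality on the convex ball carries integrability from the centre to `s`.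
    have hbd : Integrable (fun x => ‖g θ x‖ + G x * ‖s - θ‖) μ := hint.norm.add (hG.mul_const _)
    refine hbd.mono' (hm s).aestronglyMeasurable ?_
    filter_upwards [hd, hb] with x hdx hbx
    have := (convex_ball θ ε).norm_image_sub_le_of_norm_fderiv_le (𝕜 := ℝ)
      (f := fun t => g t x) hdx (fun t ht => by rw [← norm_gradient_eq]; exact hbx t ht) hθ hs
    have h2 : ‖g s x‖ ≤ ‖g θ x‖ + ‖g s x - g θ x‖ := by
      simpa using norm_add_le (g θ x) (g s x - g θ x)
    exact h2.trans (add_le_add le_rfl this)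
  have hmeas : AEStronglyMeasurable (fun x => gradient (fun t => g t x) s) μ :=
    aestronglyMeasurable_gradient hm (hd.mono fun x hx => hx s hs)
  have hgint : Integrable (fun x => gradient (fun t => g t x) s) μ :=
    hG.mono' hmeas (hb.mono fun x hx => hx s hs)
  refine ⟨hints, hgint, ?_⟩
  rw [hasGradientAt_iff_hasFDerivAt]
  have hcomm : InnerProductSpace.toDual ℝ E (∫ x, gradient (fun t => g t x) s ∂μ) =
      ∫ x, InnerProductSpace.toDual ℝ E (gradient (fun t => g t x) s) ∂μ :=
    ((InnerProductSpace.toDual ℝ E).toContinuousLinearEquiv.integral_comp_comm _).symm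
  rw [hcomm]
  refine hasFDerivAt_integral_of_dominated_of_fderiv_le (bound := G)
    (F' := fun t x => InnerProductSpace.toDual ℝ E (gradient (fun t => g t x) t))
    (Metric.isOpen_ball.mem_nhds hs) (Eventually.of_forall fun t => (hm t).aestronglyMeasurable)
    hints ((InnerProductSpace.toDual ℝ E).continuous.comp_aestronglyMeasurable hmeas)
    (hb.mono fun x hx t ht => ?_) hG (hd.mono fun x hx t ht => ?_)
  · rw [LinearIsometryEquiv.norm_map]; exact hx t ht
  · exact hasGradientAt_iff_hasFDerivAt.1 (hx t ht).hasGradientAt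

end GradientCalculus

/-! ### Elementary facts about the densities of the model. -/

namespace Model

variable {a b n : ℕ} {X H : Type*} [MeasurableSpace X] [MeasurableSpace H] (M : Model a b n X H)

instance : SigmaFinite M.dx := M.sigmaFinite_dx

instance : SigmaFinite M.dh := M.sigmaFinite_dh

section Empirical

variable {E : Type*} [NormedAddCommGroup E] [NormedSpace ℝ E] [CompleteSpace E]

lemma integrable_empirical (hn : 0 < n) {g : X → E} (hg : StronglyMeasurable g) :
    Integrable g M.empirical := by
  have hn' : ((n : ℝ≥0∞)⁻¹) ≠ ∞ := by simp [hn.ne']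
  refine Integrable.smul_measure ?_ hn'
  exact integrable_finsetSum_measure.2 fun k _ => integrable_dirac' hg enorm_lt_top

lemma integral_empirical {g : X → E} (hg : StronglyMeasurable g) :
    ∫ x, g x ∂M.empirical = (n : ℝ)⁻¹ • ∑ k, g (M.data k) := by
  rw [empirical, integral_smul_measure, integral_finsetSum_measure
    fun k _ => integrable_dirac' hg enorm_lt_top]
  simp_rw [integral_dirac' g _ hg]
  simp

lemma isProbabilityMeasure_empirical (hn : 0 < n) : IsProbabilityMeasure M.empirical := by
  refine ⟨?_⟩
  simp only [empirical, Measure.smul_apply, Measure.finsetSum_apply, measure_univ, Finset.sum_const,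
    Finset.card_univ, Fintype.card_fin, smul_eq_mul, nsmul_eq_mul, mul_one]
  exact ENNReal.inv_mul_cancel (by simp [hn.ne']) (by simp)

end Empirical

section Density

lemma nonempty_latent (M : Model a b n X H) : Nonempty H := by
  by_contra h
  rw [not_nonempty_iff] at h
  have := M.integral_prior
  simp [Measure.eq_zero_of_isEmpty M.dh] at this

lemma neZero_dx : NeZero M.dx := by
  obtain ⟨h⟩ := M.nonempty_latent
  refine ⟨fun h0 => ?_⟩
  have := M.integral_decoder 0 h
  simp [h0] at this

/-- A non-integrable function has integral `0` by convention, so normalization to `1` already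
implies integrability. -/
lemma integrable_prior : Integrable M.prior M.dh := by
  by_contra h
  have := M.integral_prior
  rw [integral_undef h] at this
  exact zero_ne_one this

lemma integrable_decoder (φ : EuclideanSpace ℝ (Fin b)) (h : H) :
    Integrable (fun x => M.decoder φ x h) M.dx := by
  by_contra hc
  have := M.integral_decoder φ h
  rw [integral_undef hc] at this
  exact zero_ne_one this

lemma measurable_qJoint (φ : EuclideanSpace ℝ (Fin b)) :
    Measurable fun y : X × H => M.qJoint φ y.1 y.2 :=
  (M.measurable_prior.comp measurable_snd).mul (M.measurable_decoder φ)

lemma qJoint_nonneg (φ : EuclideanSpace ℝ (Fin b)) (x : X) (h : H) : 0 ≤ M.qJoint φ x h :=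
  mul_nonneg (M.prior_nonneg h) (M.decoder_pos φ x h).le

lemma q_nonneg (φ : EuclideanSpace ℝ (Fin b)) (x : X) : 0 ≤ M.q φ x :=
  integral_nonneg fun h => M.qJoint_nonneg φ x h

lemma measurable_q (φ : EuclideanSpace ℝ (Fin b)) : Measurable (M.q φ) := by
  have : StronglyMeasurable (Function.uncurry fun x h => M.qJoint φ x h) :=
    (M.measurable_qJoint φ).stronglyMeasurable
  exact this.integral_prod_right.measurable

lemma measurable_qPost (φ : EuclideanSpace ℝ (Fin b)) :
    Measurable fun y : X × H => M.qPost φ y.1 y.2 :=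
  (M.measurable_qJoint φ).div ((M.measurable_q φ).comp measurable_fst)

lemma qPost_nonneg (φ : EuclideanSpace ℝ (Fin b)) (x : X) (h : H) : 0 ≤ M.qPost φ x h :=
  div_nonneg (M.qJoint_nonneg φ x h) (M.q_nonneg φ x)

lemma measurable_p (θ : EuclideanSpace ℝ (Fin a)) : Measurable (M.p θ) :=
  (Real.measurable_exp.comp (M.measurable_u θ)).div_const _

lemma p_nonneg (θ : EuclideanSpace ℝ (Fin a)) (x : X) : 0 ≤ M.p θ x :=
  div_nonneg (Real.exp_pos _).le (integral_nonneg fun _ => (Real.exp_pos _).le)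

/-- Tonelli with `x` integrated first: the decoder integrates to one, so the joint density is
integrable and so are almost all its sections. -/
lemma ae_integrable_qJoint (φ : EuclideanSpace ℝ (Fin b)) :
    ∀ᵐ x ∂M.dx, Integrable (M.qJoint φ x) M.dh := by
  have hprod : Integrable (fun y : X × H => M.qJoint φ y.1 y.2) (M.dx.prod M.dh) := by
    rw [integrable_prod_iff' (M.measurable_qJoint φ).aestronglyMeasurable]
    refine ⟨ae_of_all _ fun h =>
      (M.integrable_decoder φ h).const_mul (M.prior h), ?_⟩
    refine M.integrable_prior.congr (ae_of_all _ fun h => ?_)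
    simp_rw [Real.norm_of_nonneg (M.qJoint_nonneg φ _ h), qJoint]
    rw [integral_const_mul, M.integral_decoder, mul_one]
  exact hprod.prod_right_ae

/-- As the decoder is positive, the section has the support of the prior, which has positive
measure. Without integrability `q φ x` would be the default value `0`. -/
lemma q_pos {φ : EuclideanSpace ℝ (Fin b)} {x : X} (h : Integrable (M.qJoint φ x) M.dh) :
    0 < M.q φ x := by
  have hsupp : Function.support (M.qJoint φ x) = Function.support M.prior := by
    ext y
    simp [qJoint, (M.decoder_pos φ x y).ne']
  have hprior : 0 < M.dh (Function.support M.prior) := by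
    rw [← integral_pos_iff_support_of_nonneg M.prior_nonneg M.integrable_prior, M.integral_prior]
    exact one_pos
  rw [q, integral_pos_iff_support_of_nonneg (M.qJoint_nonneg φ x) h, hsupp]
  exact hprior

lemma integral_pDist {E : Type*} [NormedAddCommGroup E] [NormedSpace ℝ E]
    (θ : EuclideanSpace ℝ (Fin a)) (g : X → E) :
    ∫ x, g x ∂M.pDist θ = ∫ x, M.p θ x • g x ∂M.dx := by
  rw [pDist, integral_withDensity_eq_integral_toReal_smul (M.measurable_p θ).ennreal_ofReal
    (ae_of_all _ fun _ => ENNReal.ofReal_lt_top)]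
  simp_rw [ENNReal.toReal_ofReal (M.p_nonneg θ _)]

lemma integrable_pDist_iff {E : Type*} [NormedAddCommGroup E] [NormedSpace ℝ E]
    (θ : EuclideanSpace ℝ (Fin a)) {g : X → E} :
    Integrable g (M.pDist θ) ↔ Integrable (fun x => M.p θ x • g x) M.dx := by
  rw [pDist, integrable_withDensity_iff_integrable_smul' (M.measurable_p θ).ennreal_ofReal
    (ae_of_all _ fun _ => ENNReal.ofReal_lt_top)]
  simp_rw [ENNReal.toReal_ofReal (M.p_nonneg θ _)]

lemma measurable_p_mul_qPost (θ : EuclideanSpace ℝ (Fin a)) (φ : EuclideanSpace ℝ (Fin b)) :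
    Measurable fun y : X × H => M.p θ y.1 * M.qPost φ y.1 y.2 :=
  ((M.measurable_p θ).comp measurable_fst).mul (M.measurable_qPost φ)

lemma integral_pqDist {E : Type*} [NormedAddCommGroup E] [NormedSpace ℝ E]
    (θ : EuclideanSpace ℝ (Fin a)) (φ : EuclideanSpace ℝ (Fin b)) (g : X × H → E) :
    ∫ y, g y ∂M.pqDist θ φ = ∫ y, (M.p θ y.1 * M.qPost φ y.1 y.2) • g y ∂(M.dx.prod M.dh) := by
  rw [pqDist, integral_withDensity_eq_integral_toReal_smul
    (M.measurable_p_mul_qPost θ φ).ennreal_ofReal (ae_of_all _ fun _ => ENNReal.ofReal_lt_top)]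
  simp_rw [ENNReal.toReal_ofReal (mul_nonneg (M.p_nonneg θ _) (M.qPost_nonneg φ _ _))]

lemma integrable_pqDist_iff {E : Type*} [NormedAddCommGroup E] [NormedSpace ℝ E]
    (θ : EuclideanSpace ℝ (Fin a)) (φ : EuclideanSpace ℝ (Fin b)) {g : X × H → E} :
    Integrable g (M.pqDist θ φ) ↔
      Integrable (fun y => (M.p θ y.1 * M.qPost φ y.1 y.2) • g y) (M.dx.prod M.dh) := by
  rw [pqDist, integrable_withDensity_iff_integrable_smul'
    (M.measurable_p_mul_qPost θ φ).ennreal_ofReal (ae_of_all _ fun _ => ENNReal.ofReal_lt_top)]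
  simp_rw [ENNReal.toReal_ofReal (mul_nonneg (M.p_nonneg θ _) (M.qPost_nonneg φ _ _))]

/-- The first marginal of `p_θ(x) q_φ(h|x)` is `p_θ`. -/
lemma map_fst_pqDist (θ : EuclideanSpace ℝ (Fin a)) (φ : EuclideanSpace ℝ (Fin b)) :
    (M.pqDist θ φ).map Prod.fst = M.pDist θ := by
  ext A hA
  have hm := (M.measurable_p_mul_qPost θ φ).ennreal_ofReal
  rw [Measure.map_apply measurable_fst hA, pqDist, withDensity_apply _ (measurable_fst hA), pDist,
    withDensity_apply _ hA]
  have hset : (Prod.fst ⁻¹' A : Set (X × H)) = A ×ˢ Set.univ := by ext; simp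
  rw [hset, ← Measure.prod_restrict, lintegral_prod _ hm.aemeasurable, Measure.restrict_univ]
  refine lintegral_congr_ae (ae_restrict_of_ae ?_)
  filter_upwards [M.ae_integrable_qJoint φ] with x hx
  simp_rw [ENNReal.ofReal_mul (M.p_nonneg θ x)]
  have hmx : Measurable fun h => ENNReal.ofReal (M.qPost φ x h) :=
    ((M.measurable_qPost φ).comp measurable_prodMk_left).ennreal_ofReal
  have hone : ∫⁻ h, ENNReal.ofReal (M.qPost φ x h) ∂M.dh = 1 := by
    rw [← ofReal_integral_eq_lintegral_ofReal (f := M.qPost φ x) (hx.div_const _)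
      (ae_of_all _ fun h => M.qPost_nonneg φ x h)]
    have : ∫ h, M.qPost φ x h ∂M.dh = 1 := by
      simp only [qPost]
      rw [integral_div]
      exact div_self (M.q_pos hx).ne'
    rw [this, ENNReal.ofReal_one]
  rw [lintegral_const_mul _ hmx, hone, mul_one]

end Density

end Model

namespace Model

variable {a b n : ℕ} {X H : Type*} [MeasurableSpace X] [MeasurableSpace H] {M : Model a b n X H}

namespace RegularAt

variable {w : Param a b}

/-! ### Log-likelihood gradient of the random field. -/

section RandomField

lemma partition_pos (hw : M.RegularAt w) : 0 < M.partition w.fst := by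
  have := M.neZero_dx
  exact integral_exp_pos hw.integrable_exp

lemma hasGradientAt_u (hw : M.RegularAt w) (x : X) :
    HasGradientAt (fun t => M.u t x) (M.gradU w.fst x) w.fst := by
  obtain ⟨ε, hε, hd, -⟩ := hw.partition_dominated
  exact (hd x _ (Metric.mem_ball_self hε)).hasGradientAt

lemma stronglyMeasurable_gradU (hw : M.RegularAt w) : StronglyMeasurable (M.gradU w.fst) :=
  stronglyMeasurable_gradient M.measurable_u fun x => (hw.hasGradientAt_u x).differentiableAt

lemma isProbabilityMeasure_pDist (hw : M.RegularAt w) : IsProbabilityMeasure (M.pDist w.fst) := by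
  refine ⟨?_⟩
  rw [pDist, withDensity_apply _ MeasurableSet.univ, Measure.restrict_univ,
    ← ofReal_integral_eq_lintegral_ofReal (f := M.p w.fst) (hw.integrable_exp.div_const _)
      (ae_of_all _ fun x => M.p_nonneg _ x)]
  have : ∫ x, M.p w.fst x ∂M.dx = 1 := by
    simp only [p]
    rw [integral_div]
    exact div_self hw.partition_pos.ne'
  rw [this, ENNReal.ofReal_one]

/-- The gradient of `Z(θ)` is `Z(θ) E_{p_θ}[∇u_θ]`. -/
lemma hasGradientAt_partition (hw : M.RegularAt w) :
    Integrable (M.gradU w.fst) (M.pDist w.fst) ∧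
    HasGradientAt M.partition (M.partition w.fst • ∫ x, M.gradU w.fst x ∂M.pDist w.fst) w.fst := by
  obtain ⟨ε, hε, hd, G, hG, hb⟩ := hw.partition_dominated
  have hgrad : ∀ x, ∀ t ∈ Metric.ball w.fst ε,
      HasGradientAt (fun t => Real.exp (M.u t x)) (Real.exp (M.u t x) • M.gradU t x) t :=
    fun x t ht => hasGradientAt_exp_comp (hd x t ht).hasGradientAt
  obtain ⟨-, hi, hg⟩ := hasGradientAt_integral (g := fun t x => Real.exp (M.u t x)) (μ := M.dx)
    (fun t => Real.measurable_exp.comp (M.measurable_u t)) hw.integrable_exp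
    (ae_of_all _ fun x t ht => (hgrad x t ht).differentiableAt) hG
    (hb.mono fun x hx t ht => by
      rw [(hgrad x t ht).gradient, norm_smul, Real.norm_of_nonneg (Real.exp_pos _).le, mul_comm]
      exact hx t ht) w.fst (Metric.mem_ball_self hε)
  have hgx : ∀ x, gradient (fun t => Real.exp (M.u t x)) w.fst =
      Real.exp (M.u w.fst x) • M.gradU w.fst x := fun x =>
    (hgrad x _ (Metric.mem_ball_self hε)).gradient
  simp_rw [hgx] at hi hg
  have hp : ∀ x, M.p w.fst x • M.gradU w.fst x =
      (M.partition w.fst)⁻¹ • (Real.exp (M.u w.fst x) • M.gradU w.fst x) := fun x => by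
    rw [p, div_eq_inv_mul, mul_smul]
  refine ⟨?_, ?_⟩
  · rw [integrable_pDist_iff]
    simp_rw [hp]
    exact hi.smul (M.partition w.fst)⁻¹
  · rw [integral_pDist]
    simp_rw [hp]
    rw [integral_smul, smul_inv_smul₀ hw.partition_pos.ne']
    exact hg

lemma hasGradientAt_log_p (hw : M.RegularAt w) (x : X) :
    HasGradientAt (fun t => Real.log (M.p t x))
      (M.gradU w.fst x - ∫ x, M.gradU w.fst x ∂M.pDist w.fst) w.fst := by
  have hZ := hw.partition_pos
  have hg := hw.hasGradientAt_partition.2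
  have h1 := hasGradientAt_sub (hw.hasGradientAt_u x) (hasGradientAt_log_comp hg hZ.ne')
  rw [inv_smul_smul₀ hZ.ne'] at h1
  refine h1.congr_of_eventuallyEq ?_
  have hcont : ContinuousAt M.partition w.fst := hg.differentiableAt.continuousAt
  -- `log p_t = u_t - log Z(t)` needs `Z(t) ≠ 0`, which holds near `θ` by continuity.
  filter_upwards [hcont.eventually (lt_mem_nhds hZ)] with t ht
  rw [p, Real.log_div (Real.exp_pos _).ne' ht.ne', Real.log_exp]

lemma gradLogP_eq (hw : M.RegularAt w) (x : X) :
    M.gradLogP w.fst x = M.gradU w.fst x - ∫ x, M.gradU w.fst x ∂M.pDist w.fst :=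
  (hw.hasGradientAt_log_p x).gradient

lemma integral_gradLogP (hw : M.RegularAt w) (hn : 0 < n) :
    ∫ x, M.gradLogP w.fst x ∂M.empirical =
      ∫ x, M.gradU w.fst x ∂M.empirical - ∫ x, M.gradU w.fst x ∂(M.pDist w.fst) := by
  have := M.isProbabilityMeasure_empirical hn
  simp_rw [hw.gradLogP_eq]
  rw [integral_sub (M.integrable_empirical hn hw.stronglyMeasurable_gradU) (integrable_const _)]
  simp

lemma hasGradientAt_logLik (hw : M.RegularAt w) :
    HasGradientAt M.logLik (∫ x, M.gradLogP w.fst x ∂M.empirical) w.fst := by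
  have hm : StronglyMeasurable (M.gradLogP w.fst) := by
    have : M.gradLogP w.fst = fun x =>
        M.gradU w.fst x - ∫ x, M.gradU w.fst x ∂M.pDist w.fst := funext hw.gradLogP_eq
    rw [this]
    exact hw.stronglyMeasurable_gradU.sub stronglyMeasurable_const
  have hlog : M.logLik = fun t => (n : ℝ)⁻¹ * ∑ k, Real.log (M.p t (M.data k)) := by
    funext t
    rw [logLik, M.integral_empirical (g := fun x => Real.log (M.p t x))
      (Real.measurable_log.comp (M.measurable_p t)).stronglyMeasurable, smul_eq_mul]
  rw [M.integral_empirical hm, hlog]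
  refine hasGradientAt_const_mul (hasGradientAt_sum _ fun k _ => ?_) _
  rw [hw.gradLogP_eq]
  exact hw.hasGradientAt_log_p _

end RandomField

/-! ### Gradient of the inclusive divergence and the score identity. -/

section Generator

lemma differentiableAt_decoder (hw : M.RegularAt w) (x : X) (h : H) :
    DifferentiableAt ℝ (fun s => M.decoder s x h) w.snd := by
  obtain ⟨ε, hε, hd, -⟩ := hw.generator_dominated
  exact hd x h _ (Metric.mem_ball_self hε)

/-- Where the prior vanishes, `log 0 = 0` makes the function constant, and `0⁻¹ = 0` keeps the
formula valid. -/
lemma hasGradientAt_log_qJoint (hw : M.RegularAt w) (x : X) (h : H) :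
    HasGradientAt (fun s => Real.log (M.qJoint s x h))
      ((M.qJoint w.snd x h)⁻¹ • gradient (fun s => M.qJoint s x h) w.snd) w.snd := by
  have hq : DifferentiableAt ℝ (fun s => M.qJoint s x h) w.snd :=
    (hw.differentiableAt_decoder x h).const_mul (M.prior h)
  by_cases h0 : M.prior h = 0
  · have : (fun s => Real.log (M.qJoint s x h)) = fun _ => 0 := by
      funext s; simp [qJoint, h0]
    rw [this]
    have hz : M.qJoint w.snd x h = 0 := by simp [qJoint, h0]
    rw [hz, inv_zero, zero_smul]
    exact hasGradientAt_const _ _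
  · exact hasGradientAt_log_comp hq.hasGradientAt (mul_ne_zero h0 (M.decoder_pos _ x h).ne')

lemma stronglyMeasurable_gradLogQJoint (hw : M.RegularAt w) :
    StronglyMeasurable fun y : X × H => M.gradLogQJoint w.snd y.1 y.2 :=
  stronglyMeasurable_gradient (g := fun s (y : X × H) => Real.log (M.qJoint s y.1 y.2))
    (fun s => Real.measurable_log.comp (M.measurable_qJoint s))
    fun y => (hw.hasGradientAt_log_qJoint y.1 y.2).differentiableAt

/-- Near `φ`, for almost every `x`, the marginal `q_φ(x)` is positive and may be differentiated
under the integral. -/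
lemma ae_hasGradientAt_q (hw : M.RegularAt w) : ∃ ε > 0,
    (∀ᵐ x ∂M.dx, ∀ s ∈ Metric.ball w.snd ε, 0 < M.q s x ∧
      HasGradientAt (fun s => M.q s x) (∫ h, gradient (fun s => M.qJoint s x h) s ∂M.dh) s) ∧
    ∃ G : X → ℝ, Integrable G M.dx ∧
      ∀ᵐ x ∂M.dx, ∀ s ∈ Metric.ball w.snd ε, M.p w.fst x * ‖M.gradLogQ s x‖ ≤ G x := by
  obtain ⟨ε, hε, hd, hdom, hG⟩ := hw.generator_dominated
  refine ⟨ε, hε, ?_, hG⟩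
  filter_upwards [M.ae_integrable_qJoint w.snd, hdom] with x hx ⟨G, hG, hb⟩ s hs
  obtain ⟨h1, -, h3⟩ := hasGradientAt_integral (g := fun s h => M.qJoint s x h) (μ := M.dh)
    (fun s => (M.measurable_qJoint s).comp measurable_prodMk_left) hx
    (ae_of_all _ fun h s hs => (hd x h s hs).const_mul (M.prior h)) hG hb s hs
  exact ⟨M.q_pos h1, h3⟩

/-- With `θ` fixed, only `-p_θ log q_φ` depends on `φ`, and its gradient is dominated by assumption.
-/
lemma hasGradientAt_klInclusive (hw : M.RegularAt w) :
    HasGradientAt (M.klInclusive w.fst) (-∫ x, M.gradLogQ w.snd x ∂(M.pDist w.fst)) w.snd := by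
  obtain ⟨ε, hε, hq, G, hG, hb⟩ := hw.ae_hasGradientAt_q
  have hp : ∀ x, 0 < M.p w.fst x := fun x => div_pos (Real.exp_pos _) hw.partition_pos
  have hgrad : ∀ᵐ x ∂M.dx, ∀ s ∈ Metric.ball w.snd ε,
      HasGradientAt (fun s => M.p w.fst x * Real.log (M.p w.fst x / M.q s x))
        (-(M.p w.fst x • M.gradLogQ s x)) s := by
    filter_upwards [hq] with x hx s hs
    have h1 : HasGradientAt (fun s => Real.log (M.q s x)) (M.gradLogQ s x) s :=
      (hasGradientAt_log_comp (hx s hs).2 (hx s hs).1.ne').differentiableAt.hasGradientAt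
    have h2 := hasGradientAt_const_mul
      (hasGradientAt_sub (hasGradientAt_const s (Real.log (M.p w.fst x))) h1) (M.p w.fst x)
    rw [zero_sub, smul_neg] at h2
    refine h2.congr_of_eventuallyEq ?_
    filter_upwards [Metric.isOpen_ball.mem_nhds hs] with s' hs'
    rw [Real.log_div (hp x).ne' (hx s' hs').1.ne']
  obtain ⟨-, -, h3⟩ := hasGradientAt_integral
    (g := fun s x => M.p w.fst x * Real.log (M.p w.fst x / M.q s x)) (μ := M.dx)
    (fun s => (M.measurable_p _).mul
      (Real.measurable_log.comp ((M.measurable_p _).div (M.measurable_q s))))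
    hw.integrable_kl (hgrad.mono fun x hx s hs => (hx s hs).differentiableAt) hG (by
      filter_upwards [hgrad, hb] with x hx hbx s hs
      rw [(hx s hs).gradient, norm_neg, norm_smul, Real.norm_of_nonneg (M.p_nonneg _ x)]
      exact hbx s hs) w.snd (Metric.mem_ball_self hε)
  rw [M.integral_pDist, ← integral_neg]
  rw [integral_congr_ae (hgrad.mono fun x hx => (hx _ (Metric.mem_ball_self hε)).gradient)] at h3
  exact h3

/-- The score of the marginal is the posterior mean of the joint score. -/
lemma integral_gradLogQ (hw : M.RegularAt w) :
    ∫ x, M.gradLogQ w.snd x ∂(M.pDist w.fst) =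
      ∫ y, M.gradLogQJoint w.snd y.1 y.2 ∂(M.pqDist w.fst w.snd) := by
  obtain ⟨ε, hε, hq, -⟩ := hw.ae_hasGradientAt_q
  have hi := (M.integrable_pqDist_iff w.fst w.snd).1 hw.integrable_score
  rw [M.integral_pDist, M.integral_pqDist w.fst w.snd fun y => M.gradLogQJoint w.snd y.1 y.2,
    integral_prod _ hi]
  refine integral_congr_ae ?_
  filter_upwards [hq] with x hx
  obtain ⟨hpos, hg⟩ := hx _ (Metric.mem_ball_self hε)
  have h1 : M.gradLogQ w.snd x = (M.q w.snd x)⁻¹ •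
      ∫ h, gradient (fun s => M.qJoint s x h) w.snd ∂M.dh :=
    (hasGradientAt_log_comp hg hpos.ne').gradient
  -- The joint density cancels between posterior and score; where the prior vanishes both sides are
  -- zero.
  have h2 : ∀ h, M.qPost w.snd x h • M.gradLogQJoint w.snd x h =
      (M.q w.snd x)⁻¹ • gradient (fun s => M.qJoint s x h) w.snd := by
    intro h
    rw [gradLogQJoint, (hw.hasGradientAt_log_qJoint x h).gradient, qPost, smul_smul]
    by_cases h0 : M.prior h = 0
    · have : (fun s => M.qJoint s x h) = Function.const _ 0 := by
        funext s; simp [qJoint, h0]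
      rw [this, gradient_const]
      simp
    · have : M.qJoint w.snd x h ≠ 0 := mul_ne_zero h0 (M.decoder_pos _ x h).ne'
      congr 1
      field_simp
  simp_rw [mul_smul, h2]
  rw [integral_smul, integral_smul, h1]

end Generator

/-! ### The law of the observation and its mean field. -/

section Law

lemma isProbabilityMeasure_pqDist (hw : M.RegularAt w) :
    IsProbabilityMeasure (M.pqDist w.fst w.snd) := by
  have := hw.isProbabilityMeasure_pDist
  refine ⟨?_⟩
  have h := M.map_fst_pqDist w.fst w.snd
  rw [← Set.preimage_univ (f := (Prod.fst : X × H → X)),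
    ← Measure.map_apply measurable_fst MeasurableSet.univ, h, measure_univ]

lemma isProbabilityMeasure_law (hw : M.RegularAt w) (hn : 0 < n) :
    IsProbabilityMeasure (M.law w) := by
  have := M.isProbabilityMeasure_empirical hn
  have := hw.isProbabilityMeasure_pqDist
  unfold law
  infer_instance

lemma stronglyMeasurable_F (hw : M.RegularAt w) : StronglyMeasurable fun z => M.F z w := by
  have h1 : StronglyMeasurable fun z : X × X × H => M.gradU w.fst z.1 - M.gradU w.fst z.2.1 :=
    (hw.stronglyMeasurable_gradU.comp_measurable measurable_fst).sub
      (hw.stronglyMeasurable_gradU.comp_measurable (measurable_fst.comp measurable_snd))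
  have h2 : StronglyMeasurable fun z : X × X × H => M.gradLogQJoint w.snd z.2.1 z.2.2 :=
    hw.stronglyMeasurable_gradLogQJoint.comp_measurable measurable_snd
  exact (WithLp.prodContinuousLinearEquiv 2 ℝ _ _).symm.continuous.comp_stronglyMeasurable
    (h1.prodMk h2)

/-- Under the product law `x̃` is independent of `(x, h)`, and `x` has law `p_θ`, so each term of
`F` is integrated against its own marginal. -/
lemma integrable_F_and_meanField (hw : M.RegularAt w) (hn : 0 < n) :
    Integrable (fun z => M.F z w) (M.law w) ∧
    meanField M.law M.F w = WithLp.toLp 2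
      (∫ x, M.gradLogP w.fst x ∂M.empirical, ∫ x, M.gradLogQ w.snd x ∂(M.pDist w.fst)) := by
  have := M.isProbabilityMeasure_empirical hn
  have := hw.isProbabilityMeasure_pqDist
  have hgU := hw.stronglyMeasurable_gradU
  have hmap := M.map_fst_pqDist w.fst w.snd
  have hi1 : Integrable (M.gradU w.fst) M.empirical := M.integrable_empirical hn hgU
  have hi2 : Integrable (fun y : X × H => M.gradU w.fst y.1) (M.pqDist w.fst w.snd) := by
    have h := hw.hasGradientAt_partition.1
    rw [← hmap] at h
    exact h.comp_measurable measurable_fst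
  have he2 : ∫ y : X × H, M.gradU w.fst y.1 ∂M.pqDist w.fst w.snd =
      ∫ x, M.gradU w.fst x ∂M.pDist w.fst := by
    rw [← hmap, integral_map measurable_fst.aemeasurable hgU.aestronglyMeasurable]
  have hz1 : Integrable (fun z : X × X × H => M.gradU w.fst z.1) (M.law w) := hi1.comp_fst _
  have hz2 : Integrable (fun z : X × X × H => M.gradU w.fst z.2.1) (M.law w) :=
    hi2.comp_snd M.empirical
  have hz3 : Integrable (fun z : X × X × H => M.gradLogQJoint w.snd z.2.1 z.2.2) (M.law w) :=
    hw.integrable_score.comp_snd M.empirical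
  have hz12 : Integrable (fun z : X × X × H => M.gradU w.fst z.1 - M.gradU w.fst z.2.1) (M.law w) :=
    hz1.sub hz2
  set L := (WithLp.prodContinuousLinearEquiv 2 ℝ (EuclideanSpace ℝ (Fin a))
    (EuclideanSpace ℝ (Fin b))).symm with hL
  have hF : (fun z => M.F z w) = fun z => L (M.gradU w.fst z.1 - M.gradU w.fst z.2.1,
      M.gradLogQJoint w.snd z.2.1 z.2.2) := rfl
  refine ⟨?_, ?_⟩
  · rw [hF, ContinuousLinearEquiv.integrable_comp_iff]
    exact hz12.prodMk hz3
  · rw [meanField, hF, L.integral_comp_comm, integral_pair hz12 hz3, integral_sub hz1 hz2,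
      hw.integral_gradLogP hn, hw.integral_gradLogQ, law,
      integral_fun_fst (M.gradU w.fst), integral_fun_snd (fun y : X × H => M.gradU w.fst y.1),
      integral_fun_snd (fun y : X × H => M.gradLogQJoint w.snd y.1 y.2), he2]
    simp [hL]

lemma isStationary_iff (hw : M.RegularAt w) (hn : 0 < n) :
    M.IsStationary w ↔ meanField M.law M.F w = 0 := by
  rw [(hw.integrable_F_and_meanField hn).2, IsStationary,
    WithLp.toLp_eq_zero (V := EuclideanSpace ℝ (Fin a) × EuclideanSpace ℝ (Fin b)),
    Prod.mk_eq_zero]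

end Law

end RegularAt

end Model

end NRF

end

/-! ### The main theorem. -/

theorem mainTheorem2 {a b n : ℕ} (hn : 0 < n) {X : Type*} {H : Type*}
    [MeasurableSpace X] [MeasurableSpace H] (M : NRF.Model a b n X H)
    (S : Set (NRF.Param a b)) (hS : IsCompact S) (hreg : ∀ w ∈ S, M.RegularAt w) :
    -- the stationarity equations of the learning problem have the form `f(w) = 0`
    (∀ w ∈ S,
      HasGradientAt M.logLik (∫ x, M.gradLogP w.fst x ∂M.empirical) w.fst ∧
      ∫ x, M.gradLogP w.fst x ∂M.empirical =
        ∫ x, M.gradU w.fst x ∂M.empirical - ∫ x, M.gradU w.fst x ∂(M.pDist w.fst) ∧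
      HasGradientAt (M.klInclusive w.fst) (-∫ x, M.gradLogQ w.snd x ∂(M.pDist w.fst)) w.snd ∧
      ∫ x, M.gradLogQ w.snd x ∂(M.pDist w.fst) =
        ∫ y, M.gradLogQJoint w.snd y.1 y.2 ∂(M.pqDist w.fst w.snd) ∧
      IsProbabilityMeasure (M.law w) ∧
      Integrable (fun z => M.F z w) (M.law w) ∧
      NRF.meanField M.law M.F w = WithLp.toLp 2
        (∫ x, M.gradLogP w.fst x ∂M.empirical, ∫ x, M.gradLogQ w.snd x ∂(M.pDist w.fst)) ∧
      (M.IsStationary w ↔ NRF.meanField M.law M.F w = 0)) ∧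
    -- if they are solvable, stochastic approximation converges to the set of their roots
    ((∃ w ∈ S, M.IsStationary w) →
      ∀ (K : Kernel (NRF.Param a b × (X × X × H)) (X × X × H)) [IsMarkovKernel K],
        (∀ w ∈ S, (K.sectR w).Invariant (M.law w)) →
        NRF.DriftCondition S K M.F →
        NRF.LyapunovCondition S (NRF.meanField M.law M.F) →
        ∀ γ : ℕ → ℝ, NRF.LearningRates γ →
        ∀ {Ω : Type*} [MeasurableSpace Ω] (P : Measure Ω) [IsProbabilityMeasure P]
          (ℱ : Filtration ℕ ‹MeasurableSpace Ω›)
          (w : ℕ → Ω → NRF.Param a b) (z : ℕ → Ω → X × X × H),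
          NRF.IsSARun P ℱ K M.F γ w z →
          ∀ᵐ ω ∂P, (∀ t, w t ω ∈ S) →
            Tendsto (fun t => Metric.infDist (w t ω) {v ∈ S | M.IsStationary v}) atTop (𝓝 0)) := by
  refine ⟨fun w hw => ?_, ?_⟩
  · have h := hreg w hw
    obtain ⟨hF, hmean⟩ := h.integrable_F_and_meanField hn
    exact ⟨h.hasGradientAt_logLik, h.integral_gradLogP hn, h.hasGradientAt_klInclusive,
      h.integral_gradLogQ, h.isProbabilityMeasure_law hn, hF, hmean, h.isStationary_iff hn⟩
  · intro _ K _ hinv hdrift hlyap γ hγ Ω _ P _ ℱ w z hrun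
    have hset : {v ∈ S | M.IsStationary v} =
        {v ∈ S | NRF.meanField M.law M.F v = 0} := by
      ext v
      exact and_congr_right fun hv => (hreg v hv).isStationary_iff hn
    rw [hset]
    exact hrun.ae_tendsto_infDist hS (fun w hw => (hreg w hw).isProbabilityMeasure_law hn) hinv
      (fun w hw => (hreg w hw).stronglyMeasurable_F) hdrift hlyap hγ
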